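/- Let $D\subset\mathbb R^n$ ($n\ge 1$) be a bounded open set and let $m\in L^\infty(D)$ be complex-valued. On $L^2(D)\oplus L^2(D)$ let $$B_m=\begin{pmatrix}\Delta_{00}&m\\0&\Delta_{--}\end{pmatrix},\qquad I_m=\begin{pmatrix}1+m&0\\0&1\end{pmatrix},$$ where $B_m$ is the unbounded operator with domain $H^2_0(D)\oplus\{v\in L^2(D):\Delta v\in L^2(D)\}$ ($\Delta v$ in the sense of distributions) and $H^2_0(D)$ is the completion of $C_c^\infty(D)$ in the norm $(\|u\|^2+\|\Delta u\|^2)^{1/2}$. The spectrum $\sigma(m)$ is the set of $\lambda\in\mathbb C$ for which $B_m-\lambda I_m$ has no bounded inverse; eigenspaces and generalized eigenspaces are those of $I_m^{-1}B_m$. (The interior transmission eigenvalues $k^2$ correspond to $\lambda=-k^2$.) Suppose that there are real numbers $m^*\ge m_*>0$ and $\delta>0$ such that, almost everywhere, 1. there is an open neighbourhood $N$ of $\partial D$ such that either $\operatorname{Re}(e^{i\theta}m(x))>m_*$ in $N\cap D$ for some $\theta\in(-\frac{\pi}{2},\frac{\pi}{2})$, or $m$ is real in all of $D$ and $m(x)\le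 -m_*$ in $N\cap D$; 2. $|m(x)|<m^*$ in $D$; 3. $\operatorname{Re}(1+m(x))\ge\delta$ in $D$. Then $\sigma(m)$ is a (possibly empty) discrete set without accumulation points in $\mathbb C$, it consists of eigenvalues, and all generalized eigenspaces are finite-dimensional. Eigenspaces, and also generalized eigenspaces, for different eigenvalues are linearly independent. The eigenvalues and the generalized eigenspaces depend continuously on $m$ in the $L^\infty(D)$ topology, in the following sense. * For every compact $K\subset\mathbb C\setminus\sigma(m)$ and every $\varepsilon>0$ there is $\eta>0$ such that for all $p\in L^\infty(D)$ with $\|p-m\|_\infty<\eta$ one has $K\cap\sigma(p)=\emptyset$ and $\|(I_p^{-1}B_p-\lambda)^{-1}-(I_m^{-1}B_m-\lambda)^{-1}\|\le\varepsilon$ for all $\lambda\in K$, in the norm of operators from $L^2(D)\oplus L^2(D)$ to $H^2_0(D)\oplus L^2(D)$. * For every circle $\gamma$ in $\mathbb C\setminus\sigma(m)$ and every $\varepsilon>0$ there is $\eta>0$ such that for all $p\in L^\infty(D)$ with $\|p-m\|_\infty<\eta$: $\gamma\cap\sigma(p)=\emptyset$; inside $\gamma$ the set $\sigma(p)$ consists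 of finitely many eigenvalues with finite-dimensional generalized eigenspaces; the operator $P_\gamma(p)=\frac1{2\pi i}\oint_\gamma(\lambda-I_p^{-1}B_p)^{-1}d\lambda$ is a projection onto the sum of these generalized eigenspaces; $\|P_\gamma(p)-P_\gamma(m)\|\le\varepsilon$ in the norm of operators from $L^2(D)\oplus L^2(D)$ to $H^2_0(D)\oplus L^2(D)$; and the total algebraic multiplicity of the eigenvalues inside $\gamma$ is the same for $p$ and for $m$. -/

import Mathlib

open MeasureTheory Set Metric
open scoped ENNReal ContDiff Laplacian

noncomputable section

namespace InteriorTransmission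

/-! ### Generalized eigenvalue problems `B - z M`

`B` is an unbounded operator on a complex Banach space and `M` a bounded operator.  When `M` has a
bounded inverse, the notions below are the usual ones of the unbounded operator `M⁻¹ B`. -/

section Pencil

variable {X : Type*} [NormedAddCommGroup X] [NormedSpace ℂ X]

/-- The bounded operator `R` is the inverse of `B - z M : dom B → X`. -/
def IsPencilInverse (B : X →ₗ.[ℂ] X) (M : X →L[ℂ] X) (z : ℂ) (R : X →L[ℂ] X) : Prop :=
  (∀ f : X, ∃ h : R f ∈ B.domain, B ⟨R f, h⟩ - z • M (R f) = f) ∧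
    ∀ w : B.domain, R (B w - z • M (w : X)) = w

/-- The spectrum of `B - z M`: those `z` for which `B - z M : dom B → X` has no bounded
inverse. -/
def pencilSpectrum (B : X →ₗ.[ℂ] X) (M : X →L[ℂ] X) : Set ℂ :=
  {z | ¬ ∃ R : X →L[ℂ] X, IsPencilInverse B M z R}

open Classical in
/-- `(B - z M)⁻¹`, for `z` outside the spectrum (and `0` on the spectrum). -/
def pencilInverse (B : X →ₗ.[ℂ] X) (M : X →L[ℂ] X) (z : ℂ) : X →L[ℂ] X :=
  if h : ∃ R : X →L[ℂ] X, IsPencilInverse B M z R then h.choose else 0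

/-- The resolvent `(M⁻¹ B - z)⁻¹ = (B - z M)⁻¹ M`. -/
def pencilResolvent (B : X →ₗ.[ℂ] X) (M : X →L[ℂ] X) (z : ℂ) : X →L[ℂ] X :=
  pencilInverse B M z ∘L M

/-- `{w ∈ dom B : (B - z M) w ∈ M G}`; for invertible `M` these are the `w ∈ dom B` with
`(M⁻¹ B - z) w ∈ G`. -/
def pencilStep (B : X →ₗ.[ℂ] X) (M : X →L[ℂ] X) (z : ℂ) (G : Submodule ℂ X) :
    Submodule ℂ X where
  carrier := {w | ∃ h : w ∈ B.domain, ∃ y ∈ G, B ⟨w, h⟩ - z • M w = M y}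
  add_mem' := by
    rintro a b ⟨ha, y, hy, hay⟩ ⟨hb, y', hy', hby⟩
    refine ⟨B.domain.add_mem ha hb, y + y', G.add_mem hy hy', ?_⟩
    have h := B.map_add ⟨a, ha⟩ ⟨b, hb⟩
    rw [AddMemClass.mk_add_mk] at h
    rw [h, map_add, map_add, smul_add, ← hay, ← hby]
    abel
  zero_mem' := by
    refine ⟨B.domain.zero_mem, 0, G.zero_mem, ?_⟩
    have h : B ⟨0, B.domain.zero_mem⟩ = 0 := B.map_zero
    rw [h, map_zero M, smul_zero, sub_zero]
  smul_mem' := by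
    rintro c a ⟨ha, y, hy, hay⟩
    refine ⟨B.domain.smul_mem c ha, c • y, G.smul_mem c hy, ?_⟩
    have h := B.map_smul c ⟨a, ha⟩
    rw [SetLike.mk_smul_mk] at h
    rw [h, map_smul, map_smul, ← hay, smul_sub, smul_comm]

/-- The eigenspace `{w ∈ dom B : B w = z M w}`. -/
def pencilEigenspace (B : X →ₗ.[ℂ] X) (M : X →L[ℂ] X) (z : ℂ) : Submodule ℂ X :=
  pencilStep B M z ⊥

/-- The generalized eigenspace: all vectors in Jordan chains, `⋃ₖ ker (M⁻¹ B - z) ^ k`. -/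
def pencilGenEigenspace (B : X →ₗ.[ℂ] X) (M : X →L[ℂ] X) (z : ℂ) : Submodule ℂ X :=
  ⨆ k : ℕ, (pencilStep B M z)^[k] ⊥

/-- The spectral projection of `M⁻¹ B` for the disc with centre `c` and radius `r`,
`(2πi)⁻¹ ∮ (ζ - M⁻¹ B)⁻¹ dζ` over the counterclockwise boundary circle. -/
def pencilProjection [CompleteSpace X] (B : X →ₗ.[ℂ] X) (M : X →L[ℂ] X) (c : ℂ) (r : ℝ) :
    X →L[ℂ] X :=
  (2 * Real.pi * Complex.I : ℂ)⁻¹ • ∮ z in C(c, r), -pencilResolvent B M z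

end Pencil

/-! ### The two realizations of the Laplacian on `L²(D)` -/

section Laplacian

variable {n : ℕ}

/-- Lebesgue measure on `D ⊆ ℝⁿ`. -/
abbrev domainMeasure (D : Set (EuclideanSpace ℝ (Fin n))) :
    Measure (EuclideanSpace ℝ (Fin n)) :=
  volume.restrict D

/-- Complex-valued `L²(D)`. -/
abbrev L2 (D : Set (EuclideanSpace ℝ (Fin n))) : Type :=
  Lp ℂ 2 (domainMeasure D)

/-- Complex-valued `L^∞(D)`. -/
abbrev LInf (D : Set (EuclideanSpace ℝ (Fin n))) : Type :=
  Lp ℂ ∞ (domainMeasure D)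

/-- `φ ∈ C_c^∞(D)`. -/
def IsTest (D : Set (EuclideanSpace ℝ (Fin n))) (φ : EuclideanSpace ℝ (Fin n) → ℂ) : Prop :=
  ContDiff ℝ ∞ φ ∧ HasCompactSupport φ ∧ tsupport φ ⊆ D

variable {D : Set (EuclideanSpace ℝ (Fin n))} {φ : EuclideanSpace ℝ (Fin n) → ℂ}

lemma IsTest.memLp (h : IsTest D φ) (p : ℝ≥0∞) : MemLp φ p (domainMeasure D) :=
  (h.1.continuous.memLp_of_hasCompactSupport h.2.1).restrict D

lemma IsTest.laplacian_continuous (h : IsTest D φ) : Continuous (Δ φ) := by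
  have e : Δ φ = Δ (h.2.1.toSchwartzMap h.1) := by
    ext x; rw [SchwartzMap.laplacian_apply]; rfl
  rw [e]; exact SchwartzMap.continuous _

lemma IsTest.laplacian_hasCompactSupport (h : IsTest D φ) : HasCompactSupport (Δ φ) := by
  refine HasCompactSupport.intro h.2.1 fun x hx => ?_
  have h0 : φ =ᶠ[nhds x] fun _ => (0 : ℂ) := notMem_tsupport_iff_eventuallyEq.mp hx
  have := (InnerProductSpace.laplacian_congr_nhds h0).self_of_nhds
  simpa using this

lemma IsTest.laplacian_memLp (h : IsTest D φ) (p : ℝ≥0∞) : MemLp (Δ φ) p (domainMeasure D) :=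
  (h.laplacian_continuous.memLp_of_hasCompactSupport h.laplacian_hasCompactSupport).restrict D

lemma integrable_mul_of_memLp (v : L2 D) {ψ : EuclideanSpace ℝ (Fin n) → ℂ}
    (h : MemLp ψ 2 (domainMeasure D)) :
    Integrable (fun x => v x * ψ x) (domainMeasure D) :=
  MemLp.integrable_mul (Lp.memLp v) h

/-- The pairs `(v, g) ∈ L²(D) × L²(D)` with `Δ v = g` in the sense of distributions on `D`. -/
def weakLaplacianGraph (D : Set (EuclideanSpace ℝ (Fin n))) : Submodule ℂ (L2 D × L2 D) where
  carrier := {w | ∀ φ : EuclideanSpace ℝ (Fin n) → ℂ, IsTest D φ →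
    ∫ x in D, w.1 x * (Δ φ) x = ∫ x in D, w.2 x * φ x}
  add_mem' := by
    intro a b ha hb φ hφ
    have e1 : ∫ x in D, (a.1 + b.1 : L2 D) x * (Δ φ) x =
        ∫ x in D, (a.1 x * (Δ φ) x + b.1 x * (Δ φ) x) := by
      refine integral_congr_ae ?_
      filter_upwards [Lp.coeFn_add a.1 b.1] with x hx
      rw [hx, Pi.add_apply, add_mul]
    have e2 : ∫ x in D, (a.2 + b.2 : L2 D) x * φ x =
        ∫ x in D, (a.2 x * φ x + b.2 x * φ x) := by
      refine integral_congr_ae ?_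
      filter_upwards [Lp.coeFn_add a.2 b.2] with x hx
      rw [hx, Pi.add_apply, add_mul]
    simp only [Prod.fst_add, Prod.snd_add]
    rw [e1, e2, integral_add (integrable_mul_of_memLp _ (hφ.laplacian_memLp 2))
      (integrable_mul_of_memLp _ (hφ.laplacian_memLp 2)),
      integral_add (integrable_mul_of_memLp _ (hφ.memLp 2))
      (integrable_mul_of_memLp _ (hφ.memLp 2)), ha φ hφ, hb φ hφ]
  zero_mem' := by
    intro φ _
    have e : ∀ ψ : EuclideanSpace ℝ (Fin n) → ℂ, ∫ x in D, (0 : L2 D) x * ψ x = 0 := by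
      intro ψ
      refine integral_eq_zero_of_ae ?_
      filter_upwards [Lp.coeFn_zero ℂ 2 (domainMeasure D)] with x hx
      rw [hx]; simp
    simp only [Prod.fst_zero, Prod.snd_zero]
    rw [e, e]
  smul_mem' := by
    intro c a ha φ hφ
    have e : ∀ (v : L2 D) (ψ : EuclideanSpace ℝ (Fin n) → ℂ),
        ∫ x in D, (c • v : L2 D) x * ψ x = c * ∫ x in D, v x * ψ x := by
      intro v ψ
      rw [← integral_const_mul]
      refine integral_congr_ae ?_
      filter_upwards [Lp.coeFn_smul c v] with x hx
      rw [hx]; simp [mul_assoc]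
    simp only [Prod.smul_fst, Prod.smul_snd]
    rw [e, e, ha φ hφ]

/-- The closure in `L²(D) × L²(D)` of `{(φ, Δ φ) : φ ∈ C_c^∞(D)}`; equivalently, the completion of
`C_c^∞(D)` in the norm `(‖φ‖² + ‖Δ φ‖²)^{1/2}`. -/
def testLaplacianGraph (D : Set (EuclideanSpace ℝ (Fin n))) : Submodule ℂ (L2 D × L2 D) :=
  (Submodule.span ℂ {w | ∃ φ : EuclideanSpace ℝ (Fin n) → ℂ, IsTest D φ ∧
    w.1 =ᵐ[domainMeasure D] φ ∧ w.2 =ᵐ[domainMeasure D] Δ φ}).topologicalClosure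

/-- The operator `Δ` with domain `{v ∈ L²(D) : Δ v ∈ L²(D)}` (no boundary condition). -/
def maxLaplacian (D : Set (EuclideanSpace ℝ (Fin n))) : L2 D →ₗ.[ℂ] L2 D :=
  (weakLaplacianGraph D).toLinearPMap

/-- The operator `Δ` with domain `H²₀(D)` (two boundary conditions). -/
def minLaplacian (D : Set (EuclideanSpace ℝ (Fin n))) : L2 D →ₗ.[ℂ] L2 D :=
  (testLaplacianGraph D).toLinearPMap

/-- The space `H²₀(D)`, as a subspace of `L²(D)`. -/
def H20 (D : Set (EuclideanSpace ℝ (Fin n))) : Submodule ℂ (L2 D) :=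
  (minLaplacian D).domain

/-! The two graphs really are graphs of operators, so that the two definitions above are not
degenerate. -/

lemma weakLaplacianGraph_single_valued (hD : IsOpen D) (w : L2 D × L2 D)
    (hw : w ∈ weakLaplacianGraph D) (h0 : w.1 = 0) : w.2 = 0 := by
  have key : ∀ φ, IsTest D φ → ∫ x in D, w.2 x * φ x = 0 := by
    intro φ hφ
    rw [← hw φ hφ, h0]
    refine integral_eq_zero_of_ae ?_
    filter_upwards [Lp.coeFn_zero ℂ 2 (domainMeasure D)] with x hx
    rw [hx]; simp
  have hloc : LocallyIntegrableOn (w.2 : EuclideanSpace ℝ (Fin n) → ℂ) D volume := by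
    refine (locallyIntegrableOn_iff hD.isLocallyClosed).mpr fun k hk hkc => ?_
    have h2 : MemLp (w.2 : EuclideanSpace ℝ (Fin n) → ℂ) 2 (volume.restrict k) :=
      (Lp.memLp w.2).mono_measure (Measure.restrict_mono hk le_rfl)
    have : IsFiniteMeasure (volume.restrict k) := ⟨by simpa using hkc.measure_lt_top⟩
    exact h2.integrable (by norm_num)
  have hae := hD.ae_eq_zero_of_integral_contDiff_smul_eq_zero hloc (by
    intro g hg hgc hgD
    have ht : IsTest D fun x => (g x : ℂ) := by
      refine ⟨Complex.ofRealCLM.contDiff.comp hg, hgc.comp_left (g := ((↑) : ℝ → ℂ)) rfl, ?_⟩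
      refine subset_trans (closure_mono ?_) hgD
      intro x hx
      simpa using hx
    have h3 := key _ ht
    rw [← h3, ← integral_indicator hD.measurableSet]
    refine integral_congr_ae (Filter.Eventually.of_forall fun x => ?_)
    by_cases hx : x ∈ D
    · simp [hx, mul_comm]
    · have : g x = 0 := image_eq_zero_of_notMem_tsupport fun h => hx (hgD h)
      simp [hx, this])
  refine Lp.ext ?_
  have h4 : ∀ᵐ x ∂(volume.restrict D), (w.2 : EuclideanSpace ℝ (Fin n) → ℂ) x = 0 :=
    (ae_restrict_iff' hD.measurableSet).mpr hae
  filter_upwards [h4, Lp.coeFn_zero ℂ 2 (domainMeasure D)] with x hx hx0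
  rw [hx, hx0]; rfl

lemma isClosed_weakLaplacianGraph :
    IsClosed (weakLaplacianGraph D : Set (L2 D × L2 D)) := by
  have hc : ∀ ψ : EuclideanSpace ℝ (Fin n) → ℂ, MemLp ψ 2 (domainMeasure D) →
      Continuous fun v : L2 D => ∫ x in D, v x * ψ x := by
    intro ψ hψ
    have e : (fun v : L2 D => ∫ x in D, v x * ψ x) = fun v : L2 D =>
        (ContinuousLinearMap.mul ℂ ℂ).lpPairing (domainMeasure D) 2 2 v (hψ.toLp ψ) := by
      funext v
      rw [ContinuousLinearMap.lpPairing_eq_integral]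
      refine integral_congr_ae ?_
      filter_upwards [hψ.coeFn_toLp] with x hx
      simp [hx]
    rw [e]
    fun_prop
  have : (weakLaplacianGraph D : Set (L2 D × L2 D)) = ⋂ φ : {φ // IsTest D φ},
      {w | ∫ x in D, w.1 x * (Δ φ.1) x = ∫ x in D, w.2 x * φ.1 x} := by
    ext w
    simp only [mem_iInter, mem_ofPred_eq, Subtype.forall]
    rfl
  rw [this]
  exact isClosed_iInter fun φ => isClosed_eq
    ((hc _ (φ.2.laplacian_memLp 2)).comp continuous_fst)
    ((hc _ (φ.2.memLp 2)).comp continuous_snd)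

lemma testLaplacianGraph_le : testLaplacianGraph D ≤ weakLaplacianGraph D := by
  refine Submodule.topologicalClosure_minimal _ ?_ isClosed_weakLaplacianGraph
  rw [Submodule.span_le]
  rintro w ⟨ψ, hψ, h1, h2⟩ φ hφ
  have e1 : ∫ x in D, w.1 x * (Δ φ) x = ∫ x in D, ψ x * (Δ φ) x := by
    refine integral_congr_ae ?_
    filter_upwards [h1] with x hx
    rw [hx]
  have e2 : ∫ x in D, w.2 x * φ x = ∫ x in D, (Δ ψ) x * φ x := by
    refine integral_congr_ae ?_
    filter_upwards [h2] with x hx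
    rw [hx]
  rw [e1, e2, setIntegral_eq_integral_of_forall_compl_eq_zero,
    setIntegral_eq_integral_of_forall_compl_eq_zero]
  · have h3 := SchwartzMap.integral_mul_laplacian_right_eq_left (μ := volume)
      (hψ.2.1.toSchwartzMap hψ.1) (hφ.2.1.toSchwartzMap hφ.1)
    simp only [SchwartzMap.laplacian_apply] at h3
    exact h3
  · intro x hx
    rw [image_eq_zero_of_notMem_tsupport fun h => hx (hφ.2.2 h), mul_zero]
  · intro x hx
    rw [image_eq_zero_of_notMem_tsupport fun h => hx (hψ.2.2 h), zero_mul]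

lemma graph_maxLaplacian (hD : IsOpen D) : (maxLaplacian D).graph = weakLaplacianGraph D :=
  Submodule.toLinearPMap_graph_eq _ (weakLaplacianGraph_single_valued hD)

lemma graph_minLaplacian (hD : IsOpen D) : (minLaplacian D).graph = testLaplacianGraph D :=
  Submodule.toLinearPMap_graph_eq _ fun w hw =>
    weakLaplacianGraph_single_valued hD w (testLaplacianGraph_le hw)

end Laplacian

/-! ### The interior transmission operator -/

section Operator

variable {n : ℕ}

/-- The Hilbert space `L²(D) ⊕ L²(D)`. -/
abbrev L2Sum (D : Set (EuclideanSpace ℝ (Fin n))) : Type :=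
  WithLp 2 (L2 D × L2 D)

/-- Multiplication by `m ∈ L^∞(D)` on `L²(D)`. -/
def mulBy {D : Set (EuclideanSpace ℝ (Fin n))} (m : LInf D) : L2 D →L[ℂ] L2 D :=
  (ContinuousLinearMap.mul ℂ ℂ).holderL (domainMeasure D) ∞ 2 2 m

/-- The operator `B (u, v) = (Δ u + m v, Δ v)` on `L²(D) ⊕ L²(D)`, with domain
`H²₀(D) ⊕ {v ∈ L²(D) : Δ v ∈ L²(D)}`. -/
def transmissionOp {D : Set (EuclideanSpace ℝ (Fin n))} (m : LInf D) :
    L2Sum D →ₗ.[ℂ] L2Sum D where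
  domain := ((H20 D).prod (maxLaplacian D).domain).comap
    (WithLp.linearEquiv 2 ℂ (L2 D × L2 D)).toLinearMap
  toFun :=
    { toFun := fun w => WithLp.toLp 2
        (minLaplacian D ⟨w.1.fst, w.2.1⟩ + mulBy m w.1.snd, maxLaplacian D ⟨w.1.snd, w.2.2⟩)
      map_add' := by
        intro a b
        have h1 : minLaplacian D ⟨(a + b).1.fst, (a + b).2.1⟩ =
            minLaplacian D ⟨a.1.fst, a.2.1⟩ + minLaplacian D ⟨b.1.fst, b.2.1⟩ :=
          (minLaplacian D).map_add ⟨a.1.fst, a.2.1⟩ ⟨b.1.fst, b.2.1⟩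
        have h2 : maxLaplacian D ⟨(a + b).1.snd, (a + b).2.2⟩ =
            maxLaplacian D ⟨a.1.snd, a.2.2⟩ + maxLaplacian D ⟨b.1.snd, b.2.2⟩ :=
          (maxLaplacian D).map_add ⟨a.1.snd, a.2.2⟩ ⟨b.1.snd, b.2.2⟩
        have h3 : mulBy m (a + b).1.snd = mulBy m a.1.snd + mulBy m b.1.snd :=
          (mulBy m).map_add _ _
        rw [h1, h2, h3, ← WithLp.toLp_add, Prod.mk_add_mk, add_add_add_comm]
      map_smul' := by
        intro c a
        have h1 : minLaplacian D ⟨(c • a).1.fst, (c • a).2.1⟩ =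
            c • minLaplacian D ⟨a.1.fst, a.2.1⟩ :=
          (minLaplacian D).map_smul c ⟨a.1.fst, a.2.1⟩
        have h2 : maxLaplacian D ⟨(c • a).1.snd, (c • a).2.2⟩ =
            c • maxLaplacian D ⟨a.1.snd, a.2.2⟩ :=
          (maxLaplacian D).map_smul c ⟨a.1.snd, a.2.2⟩
        have h3 : mulBy m (c • a).1.snd = c • mulBy m a.1.snd := (mulBy m).map_smul c _
        rw [h1, h2, h3, ← smul_add, RingHom.id_apply, ← WithLp.toLp_smul, Prod.smul_mk] }

/-- The bounded operator `I_m (u, v) = ((1 + m) u, v)` on `L²(D) ⊕ L²(D)`. -/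
def weightOp {D : Set (EuclideanSpace ℝ (Fin n))} (m : LInf D) : L2Sum D →L[ℂ] L2Sum D :=
  (WithLp.prodContinuousLinearEquiv 2 ℂ (L2 D) (L2 D)).symm.toContinuousLinearMap ∘L
    ((ContinuousLinearMap.id ℂ (L2 D) + mulBy m).prodMap (ContinuousLinearMap.id ℂ (L2 D))) ∘L
      (WithLp.prodContinuousLinearEquiv 2 ℂ (L2 D) (L2 D)).toContinuousLinearMap

/-- The spectrum of `B - λ I_m`. -/
def transmissionSpectrum {D : Set (EuclideanSpace ℝ (Fin n))} (m : LInf D) : Set ℂ :=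
  pencilSpectrum (transmissionOp m) (weightOp m)

/-- The eigenspaces of `B - λ I_m`. -/
def eigenspace {D : Set (EuclideanSpace ℝ (Fin n))} (m : LInf D) (z : ℂ) :
    Submodule ℂ (L2Sum D) :=
  pencilEigenspace (transmissionOp m) (weightOp m) z

/-- The generalized eigenspaces of `B - λ I_m`, that is, of `I_m⁻¹ B`. -/
def genEigenspace {D : Set (EuclideanSpace ℝ (Fin n))} (m : LInf D) (z : ℂ) :
    Submodule ℂ (L2Sum D) :=
  pencilGenEigenspace (transmissionOp m) (weightOp m) z

/-- The resolvent `(I_m⁻¹ B - z)⁻¹`. -/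
def resolventOp {D : Set (EuclideanSpace ℝ (Fin n))} (m : LInf D) (z : ℂ) :
    L2Sum D →L[ℂ] L2Sum D :=
  pencilResolvent (transmissionOp m) (weightOp m) z

/-- The spectral projection of `I_m⁻¹ B` for the disc with centre `c` and radius `r`. -/
def spectralProjection {D : Set (EuclideanSpace ℝ (Fin n))} (m : LInf D) (c : ℂ) (r : ℝ) :
    L2Sum D →L[ℂ] L2Sum D :=
  pencilProjection (transmissionOp m) (weightOp m) c r

/-- The algebraic multiplicity of `z`: the dimension of its generalized eigenspace. -/
def algMult {D : Set (EuclideanSpace ℝ (Fin n))} (m : LInf D) (z : ℂ) : ℕ :=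
  Module.finrank ℂ (genEigenspace m z)

/-- No spectrum lies on the circle with centre `c` and radius `r`; the spectrum inside it consists
of finitely many eigenvalues with finite-dimensional generalized eigenspaces; and the spectral
projection of the disc is a projection onto the sum of the generalized eigenspaces inside. -/
def SplitsAlong {D : Set (EuclideanSpace ℝ (Fin n))} (m : LInf D) (c : ℂ) (r : ℝ) : Prop :=
  Disjoint (sphere c r) (transmissionSpectrum m) ∧
    (transmissionSpectrum m ∩ ball c r).Finite ∧
    (∀ z ∈ ball c r, (z ∈ transmissionSpectrum m ↔ eigenspace m z ≠ ⊥) ∧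
      FiniteDimensional ℂ (genEigenspace m z)) ∧
    IsIdempotentElem (spectralProjection m c r) ∧
    LinearMap.range (spectralProjection m c r).toLinearMap =
      ⨆ z ∈ ball c r, genEigenspace m z

/-- `T` maps `L²(D) ⊕ L²(D)` into `H²₀(D) ⊕ L²(D)`, with operator norm at most `C`, where the norm
of `(u, v)` in `H²₀(D) ⊕ L²(D)` is `(‖u‖² + ‖Δ u‖² + ‖v‖²)^{1/2}`. -/
def H20NormLE {D : Set (EuclideanSpace ℝ (Fin n))} (T : L2Sum D →L[ℂ] L2Sum D) (C : ℝ) : Prop :=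
  0 ≤ C ∧ ∀ f : L2Sum D, ∃ h : (T f).fst ∈ H20 D,
    ‖(T f).fst‖ ^ 2 + ‖minLaplacian D ⟨(T f).fst, h⟩‖ ^ 2 + ‖(T f).snd‖ ^ 2 ≤ (C * ‖f‖) ^ 2

end Operator

end InteriorTransmission

end

noncomputable section

namespace InteriorTransmission

/-! ### Riesz–Schauder theory for operators `N` with `1 - N` compact. -/

section Riesz

variable {X : Type*} [NormedAddCommGroup X] [NormedSpace ℂ X]

/-! The resolvent equation at `λ` is the system `Δu = λ(1+m)u - mv + f`, `Δv = λv + g`, where `u ∈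
H²₀(D)` carries both boundary conditions and `v` carries none. The two Laplacians are adjoint to
each other, so pairing the equations eliminates `Δ`. For real `λ = l` this gives `⟨v, mv⟩ = l⟨v, mu⟩
+ ⟨v, f⟩ - ⟨g, u⟩`. Near the boundary `m` is coercive after rotation or up to sign, so this identity
controls everything except an interior term `‖χv‖`.

A priori bound for large `l`. In the sectorial case put `w = v - lu`; then `Δw = l(1+m)w + (g - lf)`
and `⟨w, mw⟩ = -l²‖u‖² + l⟨u, Δu⟩ + data`. As `⟨u, Δu⟩ ≤ 0` is real and the rotation `ζ` has
positive real part, multiplying by `ζ` bounds both `w` and `u`. In the real negative case symmetry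
of `m` turns `l⟨v, mu⟩` into at least `l²δ‖u‖²` up to data, which bounds `v` and `u`. The interior
terms are absorbed because solutions of such equations are small inside `D` when `l` is large
(`interior_concentration`), a Fourier-series estimate combined with `Re(1+m) ≥ δ`. The bound gives
closed range; the same bound for the adjoint multiplier gives dense range. Hence a resolvent point
exists (`exists_isPencilInverse_transmissionOp`).

Compactness. The resolvent itself need not be compact, since `v` satisfies no boundary condition.
But `u` depends compactly on the data, `χv` does by interior regularity, and when `f = 0` the
pairing identity gives `‖v‖² ≤ K(‖χv‖² + ‖u‖‖g‖)`, so then `v` does too. The only possibly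
noncompact entry is `f ↦ v`, and it disappears in the square: `T = (B - z₀ I_m)⁻¹ I_m` has `T²`
compact (`isCompactOperator_sq`).

Spectral theory. A point `z` is in the resolvent set exactly when `1 - (z - z₀)T` is invertible. For
`T²` compact, `exists_finiteRank_splitting` cuts off a finite-dimensional invariant part carrying
all the spectrum in a given disc. Discreteness, finite multiplicity and the description of the
contour projection (`IsPencilInverse.pencilProjection_spec`) follow.

Continuity. Changing `(m, z)` changes `B - z I_m` by a bounded operator that depends continuously on
`(m, z)`, so resolvents and contour integrals vary continuously, also in the graph norm. Local
coercivity survives small perturbations of `m`, so the compactness argument applies to `p` as well.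
Projections at distance less than `1` have equal rank, which preserves the total multiplicity. -/

theorem IsCompactOperator.not_strictMono_chain {K : X →L[ℂ] X} (hK : IsCompactOperator K)
    (V : ℕ → Submodule ℂ X) (hcl : ∀ n, IsClosed (V n : Set X)) (hlt : ∀ n, V n < V (n + 1))
    (ν : ℕ → ℂ) {ε : ℝ} (hε : 0 < ε) (hν : ∀ n, ε ≤ ‖ν n‖)
    (h1 : ∀ n, ∀ x ∈ V (n + 1), K x - ν n • x ∈ V n) : False := by
  have hmono : Monotone V := monotone_nat_of_le_succ fun n => (hlt n).le
  have ex : ∀ n, ∃ x ∈ V (n + 1), ‖x‖ = 1 ∧ ∀ y ∈ V n, (1 / 2 : ℝ) ≤ ‖x - y‖ := by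
    intro n
    have hc : IsClosed ((V n).comap (V (n + 1)).subtype : Set (V (n + 1))) :=
      (hcl n).preimage continuous_subtype_val
    have hne : ∃ x : V (n + 1), x ∉ (V n).comap (V (n + 1)).subtype := by
      obtain ⟨x, hx, hx'⟩ := SetLike.exists_of_lt (hlt n)
      exact ⟨⟨x, hx⟩, hx'⟩
    obtain ⟨x, -, hx1, hx2⟩ := riesz_lemma_of_lt_one hc hne (r := 1 / 2) (by norm_num)
    exact ⟨x, x.2, hx1, fun y hy => hx2 ⟨y, hmono (Nat.le_succ n) hy⟩ hy⟩
  choose x hxV hx1 hx2 using ex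
  have hKx : ∀ n, K (x n) ∈ V (n + 1) := fun n => by
    have h := (V (n + 1)).add_mem (hmono (Nat.le_succ n) (h1 n _ (hxV n)))
      ((V (n + 1)).smul_mem (ν n) (hxV n))
    simpa using h
  -- The difference is `ν n` times `x n - y` with `y ∈ V n`, and `x n` has distance at least `1 / 2`
  -- from `V n`. So the images of the unit vectors `x n` have no Cauchy subsequence.
  have hfar : ∀ j n, j < n → ε / 2 ≤ ‖K (x n) - K (x j)‖ := by
    intro j n hjn
    have hν0 : ν n ≠ 0 := fun h => by
      have := hν n
      rw [h, norm_zero] at this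
      linarith
    have hy : -(ν n)⁻¹ • ((K (x n) - ν n • x n) - K (x j)) ∈ V n :=
      (V n).smul_mem _ ((V n).sub_mem (h1 n _ (hxV n)) (hmono hjn (hKx j)))
    have e : K (x n) - K (x j) =
        ν n • (x n - -(ν n)⁻¹ • ((K (x n) - ν n • x n) - K (x j))) := by
      rw [smul_sub, smul_smul, mul_neg, mul_inv_cancel₀ hν0]
      module
    rw [e, norm_smul]
    nlinarith [hν n, hx2 n _ hy]
  obtain ⟨C, hC, hC'⟩ := hK.image_closedBall_subset_compact (f := (K : X →ₗ[ℂ] X)) 1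
  obtain ⟨y, -, ψ, hψ, hψy⟩ := hC.tendsto_subseq (x := fun n => K (x n))
    fun n => hC' ⟨x n, by simp [hx1], rfl⟩
  obtain ⟨M, hM⟩ := Metric.cauchySeq_iff'.mp hψy.cauchySeq (ε / 2) (by positivity)
  have h3 := hM (M + 1) (Nat.le_succ M)
  rw [dist_eq_norm] at h3
  exact absurd h3 (not_lt.mpr (hfar _ _ (hψ (Nat.lt_succ_self M))))

theorem isCompactOperator_one_sub_mul {N₁ N₂ : X →L[ℂ] X}
    (h₁ : IsCompactOperator (1 - N₁ : X →L[ℂ] X)) (h₂ : IsCompactOperator (1 - N₂ : X →L[ℂ] X)) :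
    IsCompactOperator (1 - N₁ * N₂ : X →L[ℂ] X) := by
  have e : (1 - N₁ * N₂ : X →L[ℂ] X) = (1 - N₁) + N₁ * (1 - N₂) := by noncomm_ring
  rw [e]
  exact h₁.add (h₂.clm_comp N₁)

theorem isCompactOperator_one_sub_pow {N : X →L[ℂ] X}
    (h : IsCompactOperator (1 - N : X →L[ℂ] X)) (k : ℕ) :
    IsCompactOperator (1 - N ^ k : X →L[ℂ] X) := by
  induction k with
  | zero =>
    rw [pow_zero, sub_self]
    exact isCompactOperator_zero
  | succ k ih =>
    rw [pow_succ]
    exact isCompactOperator_one_sub_mul ih h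

theorem finiteDimensional_ker_of_isCompactOperator_one_sub {N : X →L[ℂ] X}
    (h : IsCompactOperator (1 - N : X →L[ℂ] X)) :
    FiniteDimensional ℂ (LinearMap.ker N.toLinearMap) := by
  have hmaps : ∀ v ∈ LinearMap.ker N.toLinearMap,
      ((1 - N : X →L[ℂ] X) : X →ₗ[ℂ] X) v ∈ LinearMap.ker N.toLinearMap := by
    intro v hv
    have hv' : N v = 0 := hv
    simp [hv']
  have h2 := IsCompactOperator.restrict (f := ((1 - N : X →L[ℂ] X) : X →ₗ[ℂ] X)) h hmaps
    N.isClosed_ker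
  refine FiniteDimensional.of_isCompactOperator_id (𝕜 := ℂ) ?_
  have e : (LinearMap.restrict ((1 - N : X →L[ℂ] X) : X →ₗ[ℂ] X) hmaps :
      LinearMap.ker N.toLinearMap → LinearMap.ker N.toLinearMap) = id := by
    funext ⟨v, hv⟩
    have hv' : N v = 0 := hv
    exact Subtype.ext (by simp [LinearMap.restrict_apply, hv'])
  rwa [e] at h2

variable [CompleteSpace X]

theorem isUnit_of_isCompactOperator_one_sub {N : X →L[ℂ] X}
    (h : IsCompactOperator (1 - N : X →L[ℂ] X)) (hinj : ∀ x, N x = 0 → x = 0) : IsUnit N := by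
  rcases h.hasEigenvalue_or_mem_resolventSet (μ := 1) one_ne_zero with h1 | h1
  · obtain ⟨x, hx⟩ := h1.exists_hasEigenvector
    refine absurd (hinj x ?_) hx.2
    have := hx.apply_eq_smul
    simpa using this
  · rw [spectrum.mem_resolventSet_iff] at h1
    simpa using h1

/-- Fitting decomposition. The kernels of `N ^ k` stabilize, since otherwise they form a forbidden
strict chain; after that kernel and range of the power meet only in `0`. Adding a projection onto
the kernel produces an injective compact perturbation of the identity, hence an invertible operator,
from which the projection along the range is read off. -/
theorem exists_fitting_projection {N : X →L[ℂ] X}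
    (h : IsCompactOperator (1 - N : X →L[ℂ] X)) :
    ∃ (k : ℕ) (P : X →L[ℂ] X), 0 < k ∧ FiniteDimensional ℂ (LinearMap.ker (N ^ k).toLinearMap) ∧
      (∀ x, (N ^ k) (P x) = 0) ∧ (∀ x, ∃ y, x - P x = (N ^ k) y) ∧
      ∀ y, (N ^ k) ((N ^ k) y) = 0 → (N ^ k) y = 0 := by
  let V : ℕ → Submodule ℂ X := fun k => LinearMap.ker (N ^ k).toLinearMap
  have hVle : ∀ k, V k ≤ V (k + 1) := by
    intro k x hx
    have hx' : (N ^ k) x = 0 := hx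
    change (N ^ (k + 1)) x = 0
    rw [pow_succ', mul_apply_eq_comp, hx', map_zero]
  obtain ⟨k, hk⟩ : ∃ k, V k = V (k + 1) := by
    by_contra! hne
    refine IsCompactOperator.not_strictMono_chain h V (fun k => (N ^ k).isClosed_ker)
      (fun k => lt_of_le_of_ne (hVle k) (hne k)) (fun _ => 1) one_pos (fun _ => by simp) ?_
    intro n x hx
    have hx' : (N ^ (n + 1)) x = 0 := hx
    rw [pow_succ, mul_apply_eq_comp] at hx'
    change (N ^ n) ((1 - N) x - (1 : ℂ) • x) = 0
    rw [show (1 - N) x - (1 : ℂ) • x = -N x by simp, map_neg, hx', neg_zero]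
  have hstab : ∀ j, ∀ x, (N ^ (k + j)) x = 0 → (N ^ k) x = 0 := by
    intro j
    induction j with
    | zero => exact fun x hx => hx
    | succ j ih =>
      intro x hx
      refine ih x ?_
      have hx2 : (N ^ j) x ∈ V (k + 1) := by
        change (N ^ (k + 1)) ((N ^ j) x) = 0
        rw [← mul_apply_eq_comp, ← pow_add]
        convert hx using 3
        ring
      rw [← hk] at hx2
      rw [pow_add]
      exact hx2
  -- Passing to the exponent `k + 1` keeps the kernel and makes the exponent positive, so that a
  -- factor `N` can later be split off.
  replace hstab : ∀ j, ∀ x, (N ^ (k + j)) x = 0 → (N ^ (k + 1)) x = 0 :=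
    fun j x hx => hVle k (hstab j x hx)
  have hdisj : ∀ y, (N ^ (k + 1)) ((N ^ (k + 1)) y) = 0 → (N ^ (k + 1)) y = 0 := by
    intro y hy
    refine hstab (1 + (k + 1)) y ?_
    rw [← add_assoc, pow_add]
    exact hy
  have hA := isCompactOperator_one_sub_pow h (k + 1)
  set A := N ^ (k + 1) with hAdef
  have hfin := finiteDimensional_ker_of_isCompactOperator_one_sub hA
  obtain ⟨q, hq⟩ := Submodule.ClosedComplemented.of_finiteDimensional (𝕜 := ℂ)
    (LinearMap.ker A.toLinearMap)
  let Q : X →L[ℂ] X := (LinearMap.ker A.toLinearMap).subtypeL ∘L q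
  have hQA : ∀ x, A (Q x) = 0 := fun x => (q x).2
  have hQid : ∀ x, A x = 0 → Q x = x := fun x hx => congrArg Subtype.val (hq ⟨x, hx⟩)
  have hQc : IsCompactOperator Q := by
    have := FiniteDimensional.proper_rclike ℂ (LinearMap.ker A.toLinearMap)
    have : IsCompactOperator q := isCompactOperator_of_locallyCompactSpace_dom q
    exact this.clm_comp (LinearMap.ker A.toLinearMap).subtypeL
  have hc : IsCompactOperator (1 - (A + Q) : X →L[ℂ] X) := by
    have e : (1 - (A + Q) : X →L[ℂ] X) = (1 - A) - Q := by abel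
    rw [e]
    exact hA.sub hQc
  -- If `A x = -Q x`, then `A x` lies in both range and kernel of `A`, so it vanishes; then `x` is
  -- in the kernel, where `Q` is the identity.
  have hu : IsUnit (A + Q) := by
    refine isUnit_of_isCompactOperator_one_sub hc fun x hx => ?_
    have hx1 : A x = A 0 - Q x := by
      rw [map_zero, zero_sub]
      exact eq_neg_of_add_eq_zero_left hx
    have hx2 : A (A x) = 0 := by rw [hx1, map_sub, hQA]; simp
    have hx3 := hdisj x hx2
    have hx4 : Q x = 0 := by
      have hx' : A x + Q x = 0 := hx
      rwa [hx3, zero_add] at hx'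
    rw [← hQid x hx3, hx4]
  obtain ⟨W, hW⟩ := hu
  refine ⟨k + 1, Q * (↑W⁻¹ : X →L[ℂ] X), k.succ_pos, hfin, fun x => hQA _,
    fun x => ⟨(↑W⁻¹ : X →L[ℂ] X) x, ?_⟩,
    hdisj⟩
  have : ((A + Q) * (↑W⁻¹ : X →L[ℂ] X)) x = x := by
    rw [← hW, Units.mul_inv]
    rfl
  have h2 : A ((↑W⁻¹ : X →L[ℂ] X) x) + Q ((↑W⁻¹ : X →L[ℂ] X) x) = x := this
  change x - Q ((↑W⁻¹ : X →L[ℂ] X) x) = _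
  rw [sub_eq_iff_eq_add]
  exact h2.symm

end Riesz

/-! ### Operators with compact square. -/

section Riesz

variable {X : Type*} [NormedAddCommGroup X] [NormedSpace ℂ X] [CompleteSpace X]

theorem isUnit_of_bijective {A : X →L[ℂ] X} (hi : ∀ x, A x = 0 → x = 0) (hs : ∀ y, ∃ x, A x = y) :
    IsUnit A := by
  rw [ContinuousLinearMap.isUnit_iff_bijective]
  exact ⟨(injective_iff_map_eq_zero A).mpr hi, hs⟩

/-- Fredholm alternative for a square-compact `G`. Since `1 - G` is a factor of `(1 - G²)^k`, its
range contains the range of that power; on the finite-dimensional kernel of the power, which `1 - G`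
preserves, injectivity gives surjectivity. -/
theorem isUnit_one_sub_of_isCompactOperator_sq {G : X →L[ℂ] X}
    (hG : IsCompactOperator (G * G : X →L[ℂ] X)) (hi : ∀ x, G x = x → x = 0) :
    IsUnit (1 - G) := by
  have hN : IsCompactOperator (1 - (1 - G * G) : X →L[ℂ] X) := by
    rwa [sub_sub_cancel]
  obtain ⟨k, P, hk, hfin, hP0, hP1, -⟩ := exists_fitting_projection hN
  have hcomm : Commute (1 - G) ((1 - G * G) ^ k) := by
    refine Commute.pow_right ?_ k
    simp only [Commute, SemiconjBy]
    noncomm_ring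
  have hfac : (1 - G * G) ^ k = (1 - G) * ((1 + G) * (1 - G * G) ^ (k - 1)) := by
    obtain ⟨j, rfl⟩ := Nat.exists_eq_succ_of_ne_zero hk.ne'
    rw [Nat.succ_sub_one, pow_succ', ← mul_assoc]
    congr 1
    noncomm_ring
  set A := (1 - G * G) ^ k with hA
  have hi' : ∀ x, (1 - G) x = 0 → x = 0 := fun x hx => hi x (sub_eq_zero.mp hx).symm
  refine isUnit_of_bijective hi' fun y => ?_
  have hmaps : ∀ v ∈ LinearMap.ker A.toLinearMap,
      ((1 - G : X →L[ℂ] X) : X →ₗ[ℂ] X) v ∈ LinearMap.ker A.toLinearMap := by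
    intro v hv
    have hv' : A v = 0 := hv
    change A ((1 - G) v) = 0
    rw [← mul_apply_eq_comp, ← hcomm.eq, mul_apply_eq_comp, hv', map_zero]
  have hsurj : Function.Surjective (LinearMap.restrict _ hmaps) := by
    rw [← LinearMap.injective_iff_surjective, injective_iff_map_eq_zero]
    rintro ⟨v, hv⟩ h0
    exact Subtype.ext (hi' v (congrArg Subtype.val h0))
  obtain ⟨a, ha⟩ := hsurj ⟨P y, hP0 y⟩
  obtain ⟨b, hb⟩ := hP1 y
  refine ⟨(a : X) + ((1 + G) * (1 - G * G) ^ (k - 1)) b, ?_⟩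
  have ha' : (1 - G) (a : X) = P y := congrArg Subtype.val ha
  rw [map_add, ha', ← mul_apply_eq_comp, ← hfac, ← hb]
  abel

theorem exists_eigenvector_of_not_isUnit {T : X →L[ℂ] X}
    (hT : IsCompactOperator (T * T : X →L[ℂ] X)) {μ : ℂ} (h : ¬ IsUnit (1 - μ • T)) :
    ∃ x, x ≠ 0 ∧ μ • T x = x := by
  by_contra! hne
  refine h (isUnit_one_sub_of_isCompactOperator_sq ?_ fun x hx => ?_)
  · have : (μ • T) * (μ • T) = (μ * μ) • (T * T) := by
      rw [smul_mul_smul_comm]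
    rw [this]
    exact hT.smul (μ * μ)
  · by_contra h0
    exact hne x h0 hx

theorem finite_setOf_not_isUnit_one_sub_smul {T : X →L[ℂ] X}
    (hT : IsCompactOperator (T * T : X →L[ℂ] X)) (r : ℝ) :
    {μ : ℂ | ‖μ‖ ≤ r ∧ ¬ IsUnit (1 - μ • T)}.Finite := by
  by_contra hinf
  rw [← Set.Infinite] at hinf
  let μ : ℕ → ℂ := fun n => (hinf.natEmbedding _ n : ℂ)
  have hμinj : Function.Injective μ := fun a b hab =>
    (hinf.natEmbedding _).injective (Subtype.ext hab)
  have hμ : ∀ n, ‖μ n‖ ≤ r ∧ ¬ IsUnit (1 - μ n • T) := fun n => (hinf.natEmbedding _ n).2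
  choose e he0 he using fun n => exists_eigenvector_of_not_isUnit hT (hμ n).2
  have hμ0 : ∀ n, μ n ≠ 0 := fun n h => he0 n (by rw [← he n, h, zero_smul])
  have hTe : ∀ n, T (e n) = (μ n)⁻¹ • e n := fun n => by
    conv_rhs => rw [← he n]
    rw [smul_smul, inv_mul_cancel₀ (hμ0 n), one_smul]
  have hli : LinearIndependent ℂ e := by
    refine Module.End.eigenvectors_linearIndependent' (T : Module.End ℂ X) (fun n => (μ n)⁻¹)
      (fun a b hab => hμinj (inv_injective hab)) e fun n => ?_
    exact ⟨Module.End.mem_eigenspace_iff.mpr (hTe n), he0 n⟩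
  have hr : 0 < r := lt_of_lt_of_le (norm_pos_iff.mpr (hμ0 0)) (hμ 0).1
  let V : ℕ → Submodule ℂ X := fun n => Submodule.span ℂ (e '' Iio n)
  have hfd : ∀ n, FiniteDimensional ℂ (V n) := fun n =>
    FiniteDimensional.span_of_finite ℂ ((finite_Iio n).image e)
  have hle : ∀ n, V n ≤ V (n + 1) := fun n =>
    Submodule.span_mono (image_mono (Iio_subset_Iio (Nat.le_succ n)))
  -- On the span of the first eigenvectors, `T² - μₙ⁻²` kills the last one. The radius `r` keeps
  -- `|μₙ⁻²|` above `r⁻²`.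
  refine IsCompactOperator.not_strictMono_chain hT V (fun n => (V n).closed_of_finiteDimensional)
    (fun n => lt_of_le_of_ne (hle n) ?_) (fun n => (μ n)⁻¹ * (μ n)⁻¹) (ε := r⁻¹ * r⁻¹)
    (by positivity) (fun n => ?_) ?_
  · intro heq
    have h1 : e n ∈ V n := by
      rw [heq]
      exact Submodule.subset_span ⟨n, Nat.lt_succ_self n, rfl⟩
    exact hli.notMem_span_image (s := Iio n) (x := n) (by simp) h1
  · rw [norm_mul, norm_inv]
    have h1 : r⁻¹ ≤ ‖μ n‖⁻¹ := inv_anti₀ (norm_pos_iff.mpr (hμ0 n)) (hμ n).1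
    gcongr
  · intro n x hx
    induction hx using Submodule.span_induction with
    | mem x hx =>
      obtain ⟨j, hj, rfl⟩ := hx
      have e1 : (T * T) (e j) - ((μ n)⁻¹ * (μ n)⁻¹) • e j =
          ((μ j)⁻¹ * (μ j)⁻¹ - (μ n)⁻¹ * (μ n)⁻¹) • e j := by
        rw [mul_apply_eq_comp, hTe, map_smul, hTe, smul_smul, sub_smul]
      rw [e1]
      rcases eq_or_lt_of_le (Nat.lt_succ_iff.mp hj) with rfl | hj'
      · rw [sub_self, zero_smul]
        exact zero_mem _
      · exact Submodule.smul_mem _ _ (Submodule.subset_span ⟨j, hj', rfl⟩)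
    | zero =>
      simp
    | add x y _ _ hx hy =>
      have e1 : (T * T) (x + y) - ((μ n)⁻¹ * (μ n)⁻¹) • (x + y) =
          ((T * T) x - ((μ n)⁻¹ * (μ n)⁻¹) • x) + ((T * T) y - ((μ n)⁻¹ * (μ n)⁻¹) • y) := by
        rw [map_add]
        module
      rw [e1]
      exact add_mem hx hy
    | smul c x _ hx =>
      have e1 : (T * T) (c • x) - ((μ n)⁻¹ * (μ n)⁻¹) • (c • x) =
          c • ((T * T) x - ((μ n)⁻¹ * (μ n)⁻¹) • x) := by
        rw [map_smul]
        module
      rw [e1]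
      exact Submodule.smul_mem _ _ hx

omit [CompleteSpace X] in
-- The operator is the product of the factors `1 - μ² T²`. Using `T²` rather than `T` makes each
-- factor a compact perturbation of the identity, and each factor is the identity on the kernel of
-- `T`.
theorem exists_annihilator {T : X →L[ℂ] X} (hT : IsCompactOperator (T * T : X →L[ℂ] X))
    (l : List ℂ) : ∃ N : X →L[ℂ] X, IsCompactOperator (1 - N : X →L[ℂ] X) ∧ Commute T N ∧
      (∀ x, ∀ μ ∈ l, μ • T x = x → N x = 0) ∧ ∀ x, T x = 0 → N x = x := by
  induction l with
  | nil => exact ⟨1, by rw [sub_self]; exact isCompactOperator_zero, Commute.one_right T,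
      fun x μ h => absurd h (by simp), fun x _ => rfl⟩
  | cons a l ih =>
    obtain ⟨N, h1, h2, h3, h4⟩ := ih
    refine ⟨(1 - (a * a) • (T * T)) * N, isCompactOperator_one_sub_mul ?_ h1, ?_, ?_, ?_⟩
    · rw [sub_sub_cancel]
      exact hT.smul (a * a)
    · refine Commute.mul_right ?_ h2
      exact (Commute.one_right T).sub_right
        ((((Commute.refl T).mul_right (Commute.refl T))).smul_right (a * a))
    · intro x μ hμ hx
      rcases List.mem_cons.mp hμ with rfl | hμ
      · have hc : Commute (1 - (μ * μ) • (T * T)) N :=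
          (Commute.one_left N).sub_left ((h2.mul_left h2).smul_left (μ * μ))
        rw [hc.eq, mul_apply_eq_comp]
        have : (1 - (μ * μ) • (T * T)) x = 0 := by
          change x - (μ * μ) • T (T x) = 0
          rw [mul_smul, ← map_smul T μ, hx, hx, sub_self]
        rw [this, map_zero]
      · rw [mul_apply_eq_comp, h3 x μ hμ hx, map_zero]
    · intro x hx
      rw [mul_apply_eq_comp, h4 x hx]
      change x - (a * a) • T (T x) = x
      rw [hx, map_zero, smul_zero, sub_zero]

/-- A power-compact operator splits off a finite-dimensional invariant part such that
`1 - μ T` is invertible on the complementary part for all `μ` in a given disc. -/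
theorem exists_finiteRank_splitting {T : X →L[ℂ] X}
    (hT : IsCompactOperator (T * T : X →L[ℂ] X)) (r : ℝ) :
    ∃ P : X →L[ℂ] X, FiniteDimensional ℂ (LinearMap.range P.toLinearMap) ∧ Commute T P ∧
      P * P = P ∧ (∀ μ : ℂ, ‖μ‖ ≤ r → IsUnit (1 - μ • (T * (1 - P)))) ∧
      ∀ x, T (P x) = 0 → P x = 0 := by
  have hS := finite_setOf_not_isUnit_one_sub_smul hT r
  obtain ⟨N, hN, hTN, hN0, hN1⟩ := exists_annihilator hT hS.toFinset.toList
  obtain ⟨k, P, hk, hfin, hP0, hP1, hdisj⟩ := exists_fitting_projection hN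
  have hTA : Commute T (N ^ k) := hTN.pow_right k
  have hNk : ∀ x, N x = 0 → (N ^ k) x = 0 := by
    intro x hx
    obtain ⟨j, rfl⟩ := Nat.exists_eq_succ_of_ne_zero hk.ne'
    rw [pow_succ, mul_apply_eq_comp, hx, map_zero]
  have hNk1 : ∀ x, N x = x → (N ^ k) x = x := by
    intro x hx
    clear hTA hNk hdisj hP1 hP0 hfin hk
    induction k with
    | zero => rfl
    | succ k ih => rw [pow_succ, mul_apply_eq_comp, hx, ih]
  set A := N ^ k with hA
  have hPE : ∀ a, A a = 0 → P a = a := by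
    intro a ha
    obtain ⟨y, hy⟩ := hP1 a
    have h1 : A (A y) = 0 := by rw [← hy, map_sub, ha, hP0, sub_zero]
    rw [hdisj y h1] at hy
    exact (sub_eq_zero.mp hy).symm
  have hPF : ∀ y, P (A y) = 0 := by
    intro y
    obtain ⟨y', hy'⟩ := hP1 (A y)
    have h1 : P (A y) = A (y - y') := by rw [map_sub, ← hy']; abel
    have h2 := hP0 (A y)
    rw [h1] at h2 ⊢
    exact hdisj _ h2
  have hAT : ∀ x, A (T x) = T (A x) := fun x => by
    rw [← mul_apply_eq_comp, ← hTA.eq, mul_apply_eq_comp]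
  have hPP : P * P = P := by
    ext x
    exact hPE _ (hP0 x)
  have hTP : Commute T P := by
    ext x
    change T (P x) = P (T x)
    obtain ⟨y, hy⟩ := hP1 x
    have hx : x = P x + A y := by rw [← hy]; abel
    conv_rhs => rw [hx]
    rw [map_add, map_add, ← hAT, hPF, add_zero, hPE (T (P x)) (by rw [hAT, hP0, map_zero])]
  have hTP' : ∀ x, P (T x) = T (P x) := fun x => by
    rw [← mul_apply_eq_comp, ← hTP.eq, mul_apply_eq_comp]
  refine ⟨P, ?_, hTP, hPP, fun μ hμ => ?_, fun x hx => ?_⟩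
  · refine Submodule.finiteDimensional_of_le (S₂ := LinearMap.ker A.toLinearMap) ?_
    rintro _ ⟨x, rfl⟩
    exact hP0 x
  · refine isUnit_one_sub_of_isCompactOperator_sq ?_ fun x hx => ?_
    · have e1 : (μ • (T * (1 - P))) * (μ • (T * (1 - P))) = ((μ * μ) • (T * T)) * (1 - P) := by
        have e2 : (1 - P) * T = T * (1 - P) := by rw [sub_mul, mul_sub, hTP.eq, one_mul, mul_one]
        have e3 : (1 - P) * (1 - P) = 1 - P := by
          rw [sub_mul, mul_sub, mul_sub, hPP]
          simp
        rw [smul_mul_smul_comm, smul_mul_assoc]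
        congr 1
        rw [mul_assoc, ← mul_assoc (1 - P), e2, mul_assoc T (1 - P), e3, mul_assoc]
      rw [e1]
      exact (hT.smul (μ * μ)).comp_clm (1 - P)
    · have hx' : μ • T (x - P x) = x := hx
      have hPx : P x = 0 := by
        rw [← hx', map_smul, hTP', map_sub, hPE _ (hP0 x), sub_self, map_zero, smul_zero]
      rw [hPx, sub_zero] at hx'
      -- A nonzero `x` would be an eigenvector for one of the finitely many bad `μ`, hence
      -- annihilated by `N` and fixed by `P`, whereas `P x = 0`.
      by_contra h0
      have hnu : ¬ IsUnit (1 - μ • T) := by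
        intro hu
        rw [ContinuousLinearMap.isUnit_iff_bijective] at hu
        refine h0 ((injective_iff_map_eq_zero _).mp hu.1 x ?_)
        exact sub_eq_zero.mpr hx'.symm
      have hNx : N x = 0 := hN0 x μ (by simpa using ⟨hμ, hnu⟩) hx'
      have h1 := hPE x (hNk x hNx)
      rw [hPx] at h1
      exact h0 h1.symm
  -- On the kernel of `T` the power of `N` is the identity, while on the range of `P` it vanishes.
  · rw [← hNk1 _ (hN1 _ hx), hP0]

end Riesz

/-! ### Reduction of the pencil to the bounded operator `R ∘L M`. -/

section PencilAlgebra

variable {X : Type*} [NormedAddCommGroup X] [NormedSpace ℂ X]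
  {B : X →ₗ.[ℂ] X} {M R : X →L[ℂ] X} {z₀ z : ℂ}

theorem IsPencilInverse.unique {R₁ R₂ : X →L[ℂ] X} (h₁ : IsPencilInverse B M z R₁)
    (h₂ : IsPencilInverse B M z R₂) : R₁ = R₂ := by
  ext f
  obtain ⟨h, hf⟩ := h₁.1 f
  have := h₂.2 ⟨R₁ f, h⟩
  rw [hf] at this
  exact this.symm

theorem pencilInverse_eq (h : IsPencilInverse B M z R) : pencilInverse B M z = R := by
  have hex : ∃ R : X →L[ℂ] X, IsPencilInverse B M z R := ⟨R, h⟩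
  rw [pencilInverse, dif_pos hex]
  exact hex.choose_spec.unique h

theorem isPencilInverse_pencilInverse (h : z ∉ pencilSpectrum B M) :
    IsPencilInverse B M z (pencilInverse B M z) := by
  have hex : ∃ R : X →L[ℂ] X, IsPencilInverse B M z R := not_not.mp h
  rw [pencilInverse, dif_pos hex]
  exact hex.choose_spec

theorem inverse_apply_of_isUnit {A : X →L[ℂ] X} (hA : IsUnit A) (x : X) :
    Ring.inverse A (A x) = x := by
  have := Ring.inverse_mul_cancel A hA
  rw [← mul_apply_eq_comp, this]
  rfl

theorem apply_inverse_of_isUnit {A : X →L[ℂ] X} (hA : IsUnit A) (x : X) :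
    A (Ring.inverse A x) = x := by
  have := Ring.mul_inverse_cancel A hA
  rw [← mul_apply_eq_comp, this]
  rfl

theorem eq_zero_of_isUnit {A : X →L[ℂ] X} (hA : IsUnit A) {x : X} (hx : A x = 0) : x = 0 := by
  rw [← inverse_apply_of_isUnit hA x, hx, map_zero]

/-- Solving `B w - z M w = f` for `w`, in terms of the inverse at another point. -/
theorem IsPencilInverse.solution_iff (hR : IsPencilInverse B M z₀ R) (w f : X) :
    (∃ h : w ∈ B.domain, B ⟨w, h⟩ - z • M w = f) ↔ w = R (f + (z - z₀) • M w) := by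
  constructor
  · rintro ⟨h, hw⟩
    have h1 : R (B ⟨w, h⟩ - z₀ • M w) = w := hR.2 ⟨w, h⟩
    refine h1.symm.trans (congrArg R ?_)
    rw [← hw]
    module
  · intro hw
    obtain ⟨h, h1⟩ := hR.1 (f + (z - z₀) • M w)
    have key : ∀ w' (h' : w' ∈ B.domain), w' = w →
        B ⟨w', h'⟩ - z₀ • M w' = f + (z - z₀) • M w →
        ∃ h : w ∈ B.domain, B ⟨w, h⟩ - z • M w = f := by
      rintro w' h' rfl h2
      refine ⟨h', ?_⟩
      rw [sub_eq_iff_eq_add] at h2 ⊢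
      rw [h2]
      module
    exact key _ h hw.symm h1

theorem one_sub_smul_apply (T : X →L[ℂ] X) (μ : ℂ) (x : X) :
    (1 - μ • T) x = x - μ • T x := rfl

theorem IsPencilInverse.shift (hR : IsPencilInverse B M z₀ R)
    (hu : IsUnit (1 - (z - z₀) • (R ∘L M))) :
    IsPencilInverse B M z (Ring.inverse (1 - (z - z₀) • (R ∘L M)) ∘L R) := by
  refine ⟨fun f => ?_, fun w => ?_⟩
  · rw [hR.solution_iff (z := z)]
    have h := apply_inverse_of_isUnit hu (R f)
    rw [one_sub_smul_apply, sub_eq_iff_eq_add] at h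
    rw [map_add, map_smul]
    exact h
  · have h := (hR.solution_iff (z := z) (w : X) (B w - z • M (w : X))).mp ⟨w.2, rfl⟩
    rw [map_add, map_smul, ← sub_eq_iff_eq_add] at h
    change Ring.inverse (1 - (z - z₀) • (R ∘L M)) (R (B w - z • M (w : X))) = w
    rw [← h]
    exact inverse_apply_of_isUnit hu (w : X)

/-- This removes the unbounded operator from Jordan chains: they are described by `T = R ∘L M`
alone. -/
theorem IsPencilInverse.mem_pencilStep_iff (hR : IsPencilInverse B M z₀ R) (G : Submodule ℂ X)
    (w : X) : w ∈ pencilStep B M z G ↔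
      ∃ y ∈ G, w - (z - z₀) • (R ∘L M) w = (R ∘L M) y := by
  have : w ∈ pencilStep B M z G ↔ ∃ y ∈ G, ∃ h : w ∈ B.domain, B ⟨w, h⟩ - z • M w = M y :=
    ⟨fun ⟨h, y, hy, e⟩ => ⟨y, hy, h, e⟩, fun ⟨y, hy, h, e⟩ => ⟨h, y, hy, e⟩⟩
  rw [this]
  refine exists_congr fun y => and_congr_right fun _ => ?_
  rw [hR.solution_iff (z := z), map_add, map_smul, sub_eq_iff_eq_add]
  rfl

theorem pencilStep_mono {G G' : Submodule ℂ X} (h : G ≤ G') :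
    pencilStep B M z G ≤ pencilStep B M z G' := by
  rintro w ⟨hw, y, hy, e⟩
  exact ⟨hw, y, h hy, e⟩

theorem monotone_iterate_pencilStep (B : X →ₗ.[ℂ] X) (M : X →L[ℂ] X) (z : ℂ) :
    Monotone fun k : ℕ => (pencilStep B M z)^[k] ⊥ := by
  have hm : Monotone (pencilStep B M z) := fun _ _ h => pencilStep_mono h
  exact hm.monotone_iterate_of_le_map bot_le

theorem mem_pencilGenEigenspace {w : X} :
    w ∈ pencilGenEigenspace B M z ↔ ∃ k : ℕ, w ∈ (pencilStep B M z)^[k] ⊥ :=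
  Submodule.mem_iSup_of_directed _ (monotone_iterate_pencilStep B M z).directed_le

theorem pencilEigenspace_le_pencilGenEigenspace :
    pencilEigenspace B M z ≤ pencilGenEigenspace B M z :=
  le_iSup (fun k : ℕ => (pencilStep B M z)^[k] ⊥) 1

theorem IsPencilInverse.pencilGenEigenspace_eq_bot (hR : IsPencilInverse B M z R) :
    pencilGenEigenspace B M z = ⊥ := by
  refine iSup_eq_bot.mpr fun k => ?_
  induction k with
  | zero => rfl
  | succ k ih =>
    rw [Function.iterate_succ_apply', ih, eq_bot_iff]
    intro w hw
    obtain ⟨y, hy, e⟩ := (hR.mem_pencilStep_iff (z := z) ⊥ w).mp hw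
    rw [Submodule.mem_bot] at hy ⊢
    simpa [hy] using e

/-- With `ν = (z - z₀)⁻¹`, a link `w ↦ y` of a Jordan chain reads `(T - ν) w = -ν T y`, and `T`
commutes with powers of `T - ν`. -/
theorem IsPencilInverse.iterate_le_maxGenEigenspace (hR : IsPencilInverse B M z₀ R) (hz : z ≠ z₀)
    (k : ℕ) {w : X} (hw : w ∈ (pencilStep B M z)^[k] ⊥) :
    (((R ∘L M : X →L[ℂ] X) : Module.End ℂ X) - (z - z₀)⁻¹ • 1) ^ k • w = 0 := by
  set f : Module.End ℂ X := ((R ∘L M : X →L[ℂ] X) : Module.End ℂ X) with hf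
  have hz' : z - z₀ ≠ 0 := sub_ne_zero.mpr hz
  induction k generalizing w with
  | zero => exact (Submodule.mem_bot ℂ).mp hw
  | succ k ih =>
    rw [Function.iterate_succ_apply'] at hw
    obtain ⟨y, hy, e⟩ := (hR.mem_pencilStep_iff (z := z) _ w).mp hw
    have hy' := ih hy
    have e1 : (f - (z - z₀)⁻¹ • 1) w = f (-(z - z₀)⁻¹ • y) := by
      have e2 : w - (z - z₀) • f w = f y := e
      rw [map_smul, ← e2, LinearMap.sub_apply, LinearMap.smul_apply, Module.End.one_apply,
        neg_smul, smul_sub, smul_smul, inv_mul_cancel₀ hz', one_smul]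
      abel
    have hc : Commute ((f - (z - z₀)⁻¹ • 1) ^ k) f := by
      refine Commute.pow_left ?_ k
      exact (Commute.refl f).sub_left ((Commute.one_left f).smul_left _)
    rw [pow_succ]
    change ((f - (z - z₀)⁻¹ • 1) ^ k) ((f - (z - z₀)⁻¹ • 1) w) = 0
    rw [e1, ← Module.End.mul_apply, hc.eq, Module.End.mul_apply, map_smul]
    have hy'' : ((f - (z - z₀)⁻¹ • 1) ^ k) y = 0 := hy'
    rw [hy'', smul_zero, map_zero]

theorem IsPencilInverse.pencilGenEigenspace_le (hR : IsPencilInverse B M z₀ R) (z : ℂ) :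
    pencilGenEigenspace B M z ≤
      Module.End.maxGenEigenspace ((R ∘L M : X →L[ℂ] X) : Module.End ℂ X) (z - z₀)⁻¹ := by
  -- At `z = z₀` the inverse takes its default value `0`; this is harmless since the generalized
  -- eigenspace is trivial there.
  rcases eq_or_ne z z₀ with rfl | hz
  · rw [hR.pencilGenEigenspace_eq_bot]
    exact bot_le
  · intro w hw
    obtain ⟨k, hk⟩ := mem_pencilGenEigenspace.mp hw
    exact (Module.End.mem_maxGenEigenspace _ _ _).mpr ⟨k, hR.iterate_le_maxGenEigenspace hz k hk⟩

/-- Needed to turn Jordan chains of `T` back into chains of the pencil, where the link involves `T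
y` instead of `y`. If `y` is a preimage of `(f - ν) v`, then `ν⁻¹ (v - y)` is a preimage of `v`. -/
theorem exists_preimage_of_pow_sub_smul_eq_zero {f : Module.End ℂ X} {ν : ℂ} (hν : ν ≠ 0) (k : ℕ)
    (v : X) (hv : ((f - ν • 1) ^ k) v = 0) : ∃ y, ((f - ν • 1) ^ k) y = 0 ∧ f y = v := by
  induction k generalizing v with
  | zero => exact ⟨0, map_zero _, by rw [map_zero]; exact hv.symm⟩
  | succ k ih =>
    rw [pow_succ, Module.End.mul_apply] at hv
    obtain ⟨y, hy, hfy⟩ := ih _ hv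
    refine ⟨ν⁻¹ • (v - y), ?_, ?_⟩
    · have h1 : ((f - ν • 1) ^ (k + 1)) y = 0 := by
        rw [pow_succ', Module.End.mul_apply, hy, map_zero]
      have h2 : ((f - ν • 1) ^ (k + 1)) v = 0 := by rw [pow_succ, Module.End.mul_apply, hv]
      rw [map_smul, map_sub, h1, h2, sub_zero, smul_zero]
    · rw [map_smul, map_sub, hfy, LinearMap.sub_apply, LinearMap.smul_apply, Module.End.one_apply,
        sub_sub_cancel, smul_smul, inv_mul_cancel₀ hν, one_smul]

theorem IsPencilInverse.maxGenEigenspace_le (hR : IsPencilInverse B M z₀ R) (hz : z ≠ z₀) :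
    Module.End.maxGenEigenspace ((R ∘L M : X →L[ℂ] X) : Module.End ℂ X) (z - z₀)⁻¹ ≤
      pencilGenEigenspace B M z := by
  set f : Module.End ℂ X := ((R ∘L M : X →L[ℂ] X) : Module.End ℂ X) with hf
  have hz' : z - z₀ ≠ 0 := sub_ne_zero.mpr hz
  intro w hw
  obtain ⟨k, hk⟩ := (Module.End.mem_maxGenEigenspace _ _ _).mp hw
  refine mem_pencilGenEigenspace.mpr ⟨k, ?_⟩
  clear hw
  induction k generalizing w with
  | zero => exact (Submodule.mem_bot ℂ).mpr hk
  | succ k ih =>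
    rw [pow_succ, Module.End.mul_apply] at hk
    obtain ⟨y, hy, hfy⟩ := exists_preimage_of_pow_sub_smul_eq_zero (inv_ne_zero hz') k _ hk
    rw [Function.iterate_succ_apply']
    refine (hR.mem_pencilStep_iff (z := z) _ w).mpr ⟨-(z - z₀) • y, ?_, ?_⟩
    · exact Submodule.smul_mem _ _ (ih hy)
    · change w - (z - z₀) • f w = f (-(z - z₀) • y)
      rw [map_smul, hfy, LinearMap.sub_apply, LinearMap.smul_apply, Module.End.one_apply,
        neg_smul, smul_sub, smul_smul, mul_inv_cancel₀ hz', one_smul]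
      abel

theorem IsPencilInverse.iSupIndep_pencilGenEigenspace (hR : IsPencilInverse B M z₀ R) :
    iSupIndep (pencilGenEigenspace B M) := by
  refine iSupIndep.mono ?_ hR.pencilGenEigenspace_le
  refine (Module.End.independent_maxGenEigenspace _).comp fun a b hab => ?_
  exact sub_left_injective (inv_injective hab)

variable [CompleteSpace X]

theorem IsPencilInverse.isUnit (hR : IsPencilInverse B M z₀ R) {R' : X →L[ℂ] X}
    (hR' : IsPencilInverse B M z R') : IsUnit (1 - (z - z₀) • (R ∘L M)) := by
  refine isUnit_of_bijective (fun x hx => ?_) fun y => ?_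
  · rw [one_sub_smul_apply, sub_eq_zero] at hx
    have h := (hR.solution_iff (z := z) x 0).mpr (by rw [zero_add, map_smul]; exact hx)
    have h2 := (hR'.solution_iff (z := z) x 0).mp h
    rw [h2, sub_self, zero_smul, add_zero, map_zero]
  · obtain ⟨h, hx⟩ := hR'.1 (M y)
    have h2 := (hR.solution_iff (z := z) _ _).mp ⟨h, hx⟩
    -- By the resolvent identity the inverse of `1 - (z - z₀) R M` is `1 + (z - z₀) R' M`.
    refine ⟨y + (z - z₀) • R' (M y), ?_⟩
    rw [one_sub_smul_apply]
    change _ - (z - z₀) • R (M _) = y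
    rw [map_add M, map_smul M, ← h2]
    abel

theorem IsPencilInverse.notMem_pencilSpectrum_iff (hR : IsPencilInverse B M z₀ R) (z : ℂ) :
    z ∉ pencilSpectrum B M ↔ IsUnit (1 - (z - z₀) • (R ∘L M)) := by
  constructor
  · intro h
    exact hR.isUnit (isPencilInverse_pencilInverse h)
  · intro h hz
    exact hz ⟨_, hR.shift h⟩

theorem IsPencilInverse.pencilResolvent_eq (hR : IsPencilInverse B M z₀ R)
    (hz : z ∉ pencilSpectrum B M) :
    pencilResolvent B M z = Ring.inverse (1 - (z - z₀) • (R ∘L M)) * (R ∘L M) := by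
  rw [pencilResolvent, pencilInverse_eq (hR.shift ((hR.notMem_pencilSpectrum_iff z).mp hz))]
  rfl

theorem IsPencilInverse.mem_pencilSpectrum_iff (hR : IsPencilInverse B M z₀ R)
    (hT : IsCompactOperator ((R ∘L M) * (R ∘L M) : X →L[ℂ] X)) (z : ℂ) :
    z ∈ pencilSpectrum B M ↔ pencilEigenspace B M z ≠ ⊥ := by
  rw [← not_iff_not, hR.notMem_pencilSpectrum_iff, not_not]
  constructor
  · intro hu
    rw [eq_bot_iff]
    intro w hw
    obtain ⟨y, hy, e⟩ := (hR.mem_pencilStep_iff (z := z) ⊥ w).mp hw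
    rw [(Submodule.mem_bot ℂ).mp hy, map_zero] at e
    exact eq_zero_of_isUnit hu e
  · intro h
    by_contra hu
    obtain ⟨x, hx0, hx⟩ := exists_eigenvector_of_not_isUnit hT hu
    refine hx0 ?_
    rw [← Submodule.mem_bot ℂ, ← h]
    exact (hR.mem_pencilStep_iff (z := z) ⊥ x).mpr
      ⟨0, zero_mem _, by rw [hx, sub_self, map_zero]⟩

theorem IsPencilInverse.finite_pencilSpectrum_inter (hR : IsPencilInverse B M z₀ R)
    (hT : IsCompactOperator ((R ∘L M) * (R ∘L M) : X →L[ℂ] X)) {K : Set ℂ}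
    (hK : Bornology.IsBounded K) : (pencilSpectrum B M ∩ K).Finite := by
  obtain ⟨r, hr⟩ := hK.subset_closedBall z₀
  refine Set.Finite.subset (((finite_setOf_not_isUnit_one_sub_smul hT r).image
    fun μ => μ + z₀)) ?_
  rintro z ⟨hz, hzK⟩
  refine ⟨z - z₀, ⟨by simpa [dist_eq_norm] using hr hzK, fun hu => ?_⟩, by simp⟩
  exact (hR.notMem_pencilSpectrum_iff z).mpr hu hz

end PencilAlgebra

/-! ### Contour integrals of the resolvent. -/

section PencilProjection

theorem ContinuousLinearMap.circleIntegral_comp_comm {E F : Type*} [NormedAddCommGroup E]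
    [NormedSpace ℂ E] [CompleteSpace E] [NormedAddCommGroup F] [NormedSpace ℂ F] [CompleteSpace F]
    (L : E →L[ℂ] F) {f : ℂ → E} {c : ℂ} {r : ℝ} (hf : CircleIntegrable f c r) :
    ∮ z in C(c, r), L (f z) = L (∮ z in C(c, r), f z) := by
  rw [circleIntegral, circleIntegral, ← L.intervalIntegral_comp_comm hf.out]
  simp_rw [map_smul]

theorem ContinuousLinearMap.circleIntegral_apply {E : Type*} [NormedAddCommGroup E]
    [NormedSpace ℂ E] [CompleteSpace E] {f : ℂ → E →L[ℂ] E} {c : ℂ} {r : ℝ}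
    (hf : CircleIntegrable f c r) (x : E) :
    (∮ z in C(c, r), f z) x = ∮ z in C(c, r), f z x :=
  (ContinuousLinearMap.circleIntegral_comp_comm (ContinuousLinearMap.apply ℂ E x) hf).symm

theorem circleIntegral_zpow_eq_zero_of_notMem_closedBall {c w : ℂ} {r : ℝ} (hr : 0 ≤ r)
    (hw : w ∉ closedBall c r) (n : ℤ) : ∮ z in C(c, r), (z - w) ^ n = 0 := by
  refine DiffContOnCl.circleIntegral_eq_zero hr (DifferentiableOn.diffContOnCl ?_)
  refine DifferentiableOn.zpow (differentiableOn_id.sub_const w) (Or.inl fun z hz => ?_)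
  rintro h0
  have : z = w := sub_eq_zero.mp h0
  exact hw (closure_ball_subset_closedBall (this ▸ hz))

variable {X : Type*} [NormedAddCommGroup X] [NormedSpace ℂ X] [CompleteSpace X]
  {B : X →ₗ.[ℂ] X} {M R : X →L[ℂ] X} {z₀ c : ℂ} {r : ℝ}

theorem differentiableAt_inverse_one_sub_smul {G : X →L[ℂ] X} {z : ℂ}
    (hu : IsUnit (1 - (z - z₀) • G)) :
    DifferentiableAt ℂ (fun z => Ring.inverse (1 - (z - z₀) • G)) z := by
  refine DifferentiableAt.inverse (𝕜 := ℂ) ?_ hu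
  exact (differentiableAt_const _).sub ((differentiableAt_id.sub_const z₀).smul_const G)

theorem IsPencilInverse.continuousOn_pencilResolvent (hR : IsPencilInverse B M z₀ R) :
    ContinuousOn (pencilResolvent B M) (pencilSpectrum B M)ᶜ := by
  have h1 : ContinuousOn (fun z => Ring.inverse (1 - (z - z₀) • (R ∘L M)) * (R ∘L M))
      (pencilSpectrum B M)ᶜ := by
    refine ContinuousOn.mul ?_ continuousOn_const
    intro z hz
    exact (differentiableAt_inverse_one_sub_smul
      ((hR.notMem_pencilSpectrum_iff z).mp hz)).continuousAt.continuousWithinAt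
  exact h1.congr fun z hz => hR.pencilResolvent_eq hz

theorem IsPencilInverse.circleIntegrable_pencilResolvent (hR : IsPencilInverse B M z₀ R)
    (hr : 0 ≤ r) (hs : Disjoint (sphere c r) (pencilSpectrum B M)) :
    CircleIntegrable (pencilResolvent B M) c r :=
  (hR.continuousOn_pencilResolvent.mono
    (subset_compl_iff_disjoint_right.mpr hs)).circleIntegrable hr

theorem IsPencilInverse.pencilProjection_apply (hR : IsPencilInverse B M z₀ R)
    (hr : 0 ≤ r) (hs : Disjoint (sphere c r) (pencilSpectrum B M)) (x : X) :
    pencilProjection B M c r x =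
      -(2 * Real.pi * Complex.I : ℂ)⁻¹ • ∮ z in C(c, r), pencilResolvent B M z x := by
  have hi := hR.circleIntegrable_pencilResolvent hr hs
  rw [pencilProjection, smul_apply]
  have : (∮ z in C(c, r), -pencilResolvent B M z) = -∮ z in C(c, r), pencilResolvent B M z := by
    have h := circleIntegral.integral_smul (-1 : ℂ) (pencilResolvent B M) c r
    simpa using h
  rw [this, neg_apply, ContinuousLinearMap.circleIntegral_apply hi, smul_neg,
    neg_smul]

/-- The resolvent on a Jordan chain. -/
theorem IsPencilInverse.resolvent_jordan (hR : IsPencilInverse B M z₀ R) {z w : ℂ}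
    (hz : z ∉ pencilSpectrum B M) {x y : X}
    (hxy : x - (w - z₀) • (R ∘L M) x = (R ∘L M) y) :
    (z - w) • pencilResolvent B M z x = pencilResolvent B M z y - x := by
  have hu := (hR.notMem_pencilSpectrum_iff z).mp hz
  rw [hR.pencilResolvent_eq hz, mul_apply_eq_comp, mul_apply_eq_comp, ← map_smul, ← hxy]
  rw [eq_sub_iff_add_eq]
  calc _ = Ring.inverse (1 - (z - z₀) • (R ∘L M)) ((z - w) • (R ∘L M) x) +
        Ring.inverse (1 - (z - z₀) • (R ∘L M)) ((1 - (z - z₀) • (R ∘L M)) x) := by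
        rw [inverse_apply_of_isUnit hu x]
    _ = _ := by
        rw [← map_add, one_sub_smul_apply]
        congr 1
        module

theorem continuousOn_sub_zpow_smul {E : Type*} [NormedAddCommGroup E] [NormedSpace ℂ E]
    {f : ℂ → E} {w : ℂ} (n : ℤ) (hf : ContinuousOn f (sphere c r)) (hw : w ∉ sphere c r) :
    ContinuousOn (fun z => (z - w) ^ n • f z) (sphere c r) := by
  refine ContinuousOn.smul (ContinuousOn.zpow₀ (by fun_prop) n fun z hz => Or.inl ?_) hf
  rintro h0
  exact hw ((sub_eq_zero.mp h0) ▸ hz)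

variable (hR : IsPencilInverse B M z₀ R) (hr : 0 ≤ r)
  (hs : Disjoint (sphere c r) (pencilSpectrum B M))

include hR hr hs

omit hr in
theorem IsPencilInverse.continuousOn_pencilResolvent_apply (x : X) :
    ContinuousOn (fun z => pencilResolvent B M z x) (sphere c r) :=
  (hR.continuousOn_pencilResolvent.mono (subset_compl_iff_disjoint_right.mpr hs)).clm_apply
    continuousOn_const

/-- Integrated form of the resolvent on a chain. One step down the chain lowers the exponent by one,
so only scalar integrals of powers of `z - w` remain in the end. -/
theorem IsPencilInverse.circleIntegral_zpow_smul_jordan {w : ℂ} (hw : w ∉ sphere c r) {x y : X}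
    (hxy : x - (w - z₀) • (R ∘L M) x = (R ∘L M) y) (n : ℤ) :
    ∮ z in C(c, r), (z - w) ^ n • pencilResolvent B M z x =
      (∮ z in C(c, r), (z - w) ^ (n - 1) • pencilResolvent B M z y) -
        (∮ z in C(c, r), (z - w) ^ (n - 1)) • x := by
  have hsub : ∀ z ∈ sphere c r, z - w ≠ 0 := fun z hz h0 => hw ((sub_eq_zero.mp h0) ▸ hz)
  have h1 := continuousOn_sub_zpow_smul (n - 1) (hR.continuousOn_pencilResolvent_apply hs y) hw
  have h2 := continuousOn_sub_zpow_smul (n - 1) (continuousOn_const (c := x)) hw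
  rw [← circleIntegral.integral_smul_const,
    ← circleIntegral.integral_sub (h1.circleIntegrable hr) (h2.circleIntegrable hr)]
  refine circleIntegral.integral_congr hr fun z hz => ?_
  have hz' : z ∉ pencilSpectrum B M := hs.notMem_of_mem_left hz
  have h3 := hR.resolvent_jordan hz' hxy
  rw [← smul_sub, ← h3, smul_smul, ← zpow_add_one₀ (hsub z hz), sub_add_cancel]

/-- The threshold is `n₀ = -1` for `w` inside the circle, where powers below `-1` integrate to zero,
and `n₀ = 0` for `w` outside. -/
theorem IsPencilInverse.circleIntegral_zpow_smul_eq_zero {w : ℂ} (hw : w ∉ sphere c r) {n₀ : ℤ}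
    (hn₀ : ∀ n ≤ n₀, ∮ z in C(c, r), (z - w) ^ (n - 1) = 0) (k : ℕ) {x : X}
    (hx : x ∈ (pencilStep B M w)^[k] ⊥) {n : ℤ} (hn : n ≤ n₀) :
    ∮ z in C(c, r), (z - w) ^ n • pencilResolvent B M z x = 0 := by
  induction k generalizing x n with
  | zero =>
    rw [(Submodule.mem_bot ℂ).mp hx]
    simp [circleIntegral]
  | succ k ih =>
    rw [Function.iterate_succ_apply'] at hx
    obtain ⟨y, hy, e⟩ := (hR.mem_pencilStep_iff (z := w) _ x).mp hx
    rw [hR.circleIntegral_zpow_smul_jordan hr hs hw e, ih hy (by lia), hn₀ n hn, zero_smul,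
      sub_zero]

theorem IsPencilInverse.pencilProjection_apply_of_mem_ball {w : ℂ} (hw : w ∈ ball c r) {x : X}
    (hx : x ∈ pencilGenEigenspace B M w) : pencilProjection B M c r x = x := by
  obtain ⟨k, hk⟩ := mem_pencilGenEigenspace.mp hx
  have hw' : w ∉ sphere c r := fun h => (mem_ball.mp hw).ne (mem_sphere.mp h)
  rw [hR.pencilProjection_apply hr hs]
  cases k with
  | zero =>
    rw [(Submodule.mem_bot ℂ).mp hk]
    simp [circleIntegral]
  | succ k =>
    rw [Function.iterate_succ_apply'] at hk
    obtain ⟨y, hy, e⟩ := (hR.mem_pencilStep_iff (z := w) _ x).mp hk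
    have h1 := hR.circleIntegral_zpow_smul_jordan hr hs hw' e 0
    -- The term with the next chain vector `y` has exponent `-1` and vanishes; the residue of `(z -
    -- w)⁻¹` returns `x` itself.
    have h2 := hR.circleIntegral_zpow_smul_eq_zero hr hs hw' (n₀ := -1)
      (fun n hn => circleIntegral.integral_sub_zpow_of_ne (by lia) c w r) k hy (n := 0 - 1)
      (by simp)
    rw [h2] at h1
    simp only [zpow_zero, one_smul, zero_sub, zpow_neg_one] at h1
    rw [h1, circleIntegral.integral_sub_inv_of_mem_ball hw, neg_smul_neg, smul_smul,
      inv_mul_cancel₀ Complex.two_pi_I_ne_zero, one_smul]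

theorem IsPencilInverse.pencilProjection_apply_of_notMem_ball {w : ℂ} (hw : w ∉ ball c r) {x : X}
    (hx : x ∈ pencilGenEigenspace B M w) : pencilProjection B M c r x = 0 := by
  by_cases hw' : w ∈ sphere c r
  · rw [(isPencilInverse_pencilInverse (hs.notMem_of_mem_left hw')).pencilGenEigenspace_eq_bot,
      Submodule.mem_bot] at hx
    rw [hx, map_zero]
  obtain ⟨k, hk⟩ := mem_pencilGenEigenspace.mp hx
  have hcb : w ∉ closedBall c r := by
    rw [← ball_union_sphere]
    exact fun h => h.elim hw hw'
  rw [hR.pencilProjection_apply hr hs]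
  have h2 := hR.circleIntegral_zpow_smul_eq_zero hr hs hw' (n₀ := 0)
      (fun n hn => circleIntegral_zpow_eq_zero_of_notMem_closedBall hr hcb _) k hk le_rfl
  simp only [zpow_zero, one_smul] at h2
  rw [h2, smul_zero]

omit [CompleteSpace X] hr hs in
/-- The generalized eigenspaces in a disc lie in the finite-dimensional part of a splitting. -/
theorem IsPencilInverse.apply_eq_of_mem_pencilGenEigenspace {P : X →L[ℂ] X}
    (hTP : Commute (R ∘L M) P) (hPP : P * P = P) {w : ℂ}
    (hu : IsUnit (1 - (w - z₀) • ((R ∘L M) * (1 - P)))) {x : X}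
    (hx : x ∈ pencilGenEigenspace B M w) : P x = x := by
  obtain ⟨k, hk⟩ := mem_pencilGenEigenspace.mp hx
  clear hx
  have hTP' : ∀ x, P ((R ∘L M) x) = (R ∘L M) (P x) := fun x => by
    rw [← mul_apply_eq_comp, ← hTP.eq, mul_apply_eq_comp]
  have hPP' : ∀ x, P (P x) = P x := fun x => by rw [← mul_apply_eq_comp, hPP]
  induction k generalizing x with
  | zero => rw [(Submodule.mem_bot ℂ).mp hk, map_zero]
  | succ k ih =>
    rw [Function.iterate_succ_apply'] at hk
    obtain ⟨y, hy, e⟩ := (hR.mem_pencilStep_iff (z := w) _ x).mp hk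
    have hPy := ih hy
    have h1 : (1 - (w - z₀) • ((R ∘L M) * (1 - P))) (x - P x) = 0 := by
      rw [one_sub_smul_apply, mul_apply_eq_comp]
      have e1 : (1 - P) (x - P x) = x - P x := by
        change x - P x - P (x - P x) = _
        rw [map_sub, hPP', sub_self, sub_zero]
      have e2 := congrArg P e
      rw [map_sub, map_smul, hTP', hTP', hPy] at e2
      rw [e1, map_sub, smul_sub]
      rw [← e] at e2
      rw [sub_sub_sub_comm, e2, sub_self]
    exact (sub_eq_zero.mp (eq_zero_of_isUnit hu h1)).symm

/-- On the kernel of `P` the resolvent agrees on the circle with the inverse built from `T (1 - P)`,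
which is holomorphic on the whole closed disc; Cauchy's theorem gives zero. -/
theorem IsPencilInverse.pencilProjection_apply_of_splitting {P : X →L[ℂ] X}
    (hTP : Commute (R ∘L M) P) (hPP : P * P = P)
    (hu : ∀ z ∈ closedBall c r, IsUnit (1 - (z - z₀) • ((R ∘L M) * (1 - P)))) {x : X}
    (hx : P x = 0) : pencilProjection B M c r x = 0 := by
  have hTP' : ∀ x, P ((R ∘L M) x) = (R ∘L M) (P x) := fun x => by
    rw [← mul_apply_eq_comp, ← hTP.eq, mul_apply_eq_comp]
  rw [hR.pencilProjection_apply hr hs]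
  have h1 : ∮ z in C(c, r), pencilResolvent B M z x =
      ∮ z in C(c, r), Ring.inverse (1 - (z - z₀) • ((R ∘L M) * (1 - P))) ((R ∘L M) x) := by
    refine circleIntegral.integral_congr hr fun z hz => ?_
    have hz' : z ∉ pencilSpectrum B M := hs.notMem_of_mem_left hz
    have hu1 := (hR.notMem_pencilSpectrum_iff z).mp hz'
    have hu2 := hu z (sphere_subset_closedBall hz)
    rw [hR.pencilResolvent_eq hz', mul_apply_eq_comp]
    set y := Ring.inverse (1 - (z - z₀) • ((R ∘L M) * (1 - P))) ((R ∘L M) x) with hy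
    have h2 : (1 - (z - z₀) • ((R ∘L M) * (1 - P))) y = (R ∘L M) x :=
      apply_inverse_of_isUnit hu2 _
    rw [one_sub_smul_apply, mul_apply_eq_comp] at h2
    have hP1 : P ((1 - P) y) = 0 := by
      change P (y - P y) = 0
      rw [map_sub, ← mul_apply_eq_comp P P, hPP, sub_self]
    have h3 := congrArg P h2
    rw [map_sub, map_smul, hTP', hTP', hP1, hx, map_zero, smul_zero, sub_zero] at h3
    have h4 : (1 - P) y = y := by
      change y - P y = y
      rw [h3, sub_zero]
    rw [h4] at h2
    rw [← h2]
    exact inverse_apply_of_isUnit hu1 y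
  have hd : DifferentiableOn ℂ (fun z => Ring.inverse (1 - (z - z₀) • ((R ∘L M) * (1 - P)))
      ((R ∘L M) x)) (closedBall c r) := by
    intro z hz
    exact ((differentiableAt_inverse_one_sub_smul (hu z hz)).clm_apply
      (differentiableAt_const _)).differentiableWithinAt
  rw [h1, DiffContOnCl.circleIntegral_eq_zero hr
    (DifferentiableOn.diffContOnCl (hd.mono closure_ball_subset_closedBall)), smul_zero]

end PencilProjection

/-! ### Range and rank of the spectral projection. -/

section PencilSplitting

theorem finrank_biSup_eq_sum {X ι : Type*} [AddCommGroup X] [Module ℂ X] {V : ι → Submodule ℂ X}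
    (hV : iSupIndep V) (hfd : ∀ i, FiniteDimensional ℂ (V i)) (s : Finset ι) :
    FiniteDimensional ℂ (⨆ i ∈ s, V i : Submodule ℂ X) ∧
      Module.finrank ℂ (⨆ i ∈ s, V i : Submodule ℂ X) = ∑ i ∈ s, Module.finrank ℂ (V i) := by
  classical
  induction s using Finset.induction_on with
  | empty =>
    have : (⨆ i ∈ (∅ : Finset ι), V i) = ⊥ := by simp
    rw [this]
    exact ⟨inferInstance, by simp⟩
  | insert a s ha ih =>
    obtain ⟨ih1, ih2⟩ := ih
    have hd : V a ⊓ (⨆ i ∈ s, V i) = ⊥ :=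
      (hV.disjoint_biSup (y := (s : Set ι)) (by simpa using ha)).eq_bot
    rw [Finset.iSup_insert]
    refine ⟨inferInstance, ?_⟩
    have h := Submodule.finrank_sup_add_finrank_inf_eq (V a) (⨆ i ∈ s, V i)
    rw [hd, finrank_bot, add_zero, ih2] at h
    rw [h, Finset.sum_insert ha]

variable {X : Type*} [NormedAddCommGroup X] [NormedSpace ℂ X] [CompleteSpace X]
  {B : X →ₗ.[ℂ] X} {M R : X →L[ℂ] X} {z₀ c : ℂ} {r : ℝ}

omit [CompleteSpace X] in
-- In finite dimension `T` decomposes the range of `P` into generalized eigenspaces. The value `0`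
-- does not occur because `T` is injective there, and every other value corresponds to a point of
-- the pencil.
theorem IsPencilInverse.range_splitting_le (hR : IsPencilInverse B M z₀ R) {P : X →L[ℂ] X}
    (hfin : FiniteDimensional ℂ (LinearMap.range P.toLinearMap)) (hTP : Commute (R ∘L M) P)
    (hinj : ∀ x, (R ∘L M) (P x) = 0 → P x = 0) :
    LinearMap.range P.toLinearMap ≤ ⨆ z, pencilGenEigenspace B M z := by
  set f : Module.End ℂ X := ((R ∘L M : X →L[ℂ] X) : Module.End ℂ X) with hf
  have hmaps : ∀ x ∈ LinearMap.range P.toLinearMap, f x ∈ LinearMap.range P.toLinearMap := by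
    rintro _ ⟨y, rfl⟩
    refine ⟨f y, ?_⟩
    change P ((R ∘L M) y) = (R ∘L M) (P y)
    rw [← mul_apply_eq_comp, ← hTP.eq, mul_apply_eq_comp]
  set g : Module.End ℂ (LinearMap.range P.toLinearMap) := f.restrict hmaps with hg
  have hginj : ∀ x, g x = 0 → x = 0 := by
    rintro ⟨_, ⟨y, rfl⟩⟩ h
    exact Subtype.ext (hinj y (congrArg Subtype.val h))
  have hpow : ∀ (ν : ℂ) (k : ℕ) (x : LinearMap.range P.toLinearMap),
      (((g - ν • 1) ^ k) x : X) = ((f - ν • 1) ^ k) (x : X) := by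
    intro ν k
    induction k with
    | zero => exact fun x => rfl
    | succ k ih =>
      intro x
      rw [pow_succ, pow_succ, Module.End.mul_apply, Module.End.mul_apply, ih]
      rfl
  have htop := Module.End.iSup_maxGenEigenspace_eq_top g
  have hle : ∀ ν, (g.maxGenEigenspace ν).map (LinearMap.range P.toLinearMap).subtype ≤
      ⨆ z, pencilGenEigenspace B M z := by
    intro ν
    rcases eq_or_ne ν 0 with rfl | hν
    · have h0 : g.maxGenEigenspace 0 = ⊥ := by
        rw [eq_bot_iff]
        intro x hx
        obtain ⟨k, hk⟩ := (Module.End.mem_maxGenEigenspace _ _ _).mp hx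
        rw [zero_smul, sub_zero] at hk
        clear hx
        induction k with
        | zero => exact hk
        | succ k ih =>
          rw [pow_succ', Module.End.mul_apply] at hk
          exact ih (hginj _ hk)
      rw [h0, Submodule.map_bot]
      exact bot_le
    -- This is the `z` with `(z - z₀)⁻¹ = ν`.
    · refine le_trans ?_ (le_iSup _ (ν⁻¹ + z₀))
      refine le_trans ?_ (hR.maxGenEigenspace_le (by simpa using hν))
      rintro _ ⟨x, hx, rfl⟩
      obtain ⟨k, hk⟩ := (Module.End.mem_maxGenEigenspace _ _ _).mp hx
      refine (Module.End.mem_maxGenEigenspace _ _ _).mpr ⟨k, ?_⟩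
      rw [add_sub_cancel_right, inv_inv]
      have := hpow ν k x
      rw [hk] at this
      exact this.symm
  have h1 : LinearMap.range P.toLinearMap =
      (⊤ : Submodule ℂ (LinearMap.range P.toLinearMap)).map
        (LinearMap.range P.toLinearMap).subtype := by simp
  rw [h1, ← htop, Submodule.map_iSup]
  exact iSup_le hle

variable (hR : IsPencilInverse B M z₀ R)
  (hT : IsCompactOperator ((R ∘L M) * (R ∘L M) : X →L[ℂ] X))

include hR hT

theorem IsPencilInverse.finiteDimensional_pencilGenEigenspace (z : ℂ) :
    FiniteDimensional ℂ (pencilGenEigenspace B M z) := by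
  obtain ⟨P, hfin, hTP, hPP, hu, -⟩ := exists_finiteRank_splitting hT ‖z - z₀‖
  exact Submodule.finiteDimensional_of_le (S₂ := LinearMap.range P.toLinearMap) fun x hx =>
    ⟨x, hR.apply_eq_of_mem_pencilGenEigenspace hTP hPP (hu _ le_rfl) hx⟩

/-- The contour integral factors through the finite-rank `P` of a splitting. The range of `P` is
spanned by generalized eigenvectors, and these are fixed by the integral when the eigenvalue is
inside the circle and killed when it is outside. -/
theorem IsPencilInverse.pencilProjection_spec (hr : 0 ≤ r)
    (hs : Disjoint (sphere c r) (pencilSpectrum B M)) :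
    IsIdempotentElem (pencilProjection B M c r) ∧
      LinearMap.range (pencilProjection B M c r).toLinearMap =
        ⨆ z ∈ ball c r, pencilGenEigenspace B M z ∧
      FiniteDimensional ℂ (LinearMap.range (pencilProjection B M c r).toLinearMap) := by
  -- This radius makes the disc centred at `z₀` contain the closed disc bounded by the contour.
  obtain ⟨P, hfin, hTP, hPP, hu, hinj⟩ := exists_finiteRank_splitting hT (r + dist c z₀)
  have hu' : ∀ z ∈ closedBall c r, IsUnit (1 - (z - z₀) • ((R ∘L M) * (1 - P))) := by
    intro z hz
    refine hu _ ?_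
    rw [← dist_eq_norm]
    have := dist_triangle z c z₀
    have := mem_closedBall.mp hz
    linarith
  set Q := pencilProjection B M c r with hQ
  set V : Submodule ℂ X := ⨆ z ∈ ball c r, pencilGenEigenspace B M z with hV
  have hQP : ∀ x, Q x = Q (P x) := by
    intro x
    have h1 : Q (x - P x) = 0 := by
      refine hR.pencilProjection_apply_of_splitting hr hs hTP hPP hu' ?_
      rw [map_sub, ← mul_apply_eq_comp P P, hPP, sub_self]
    rw [map_sub] at h1
    exact sub_eq_zero.mp h1
  have hVid : ∀ x ∈ V, Q x = x := by
    have : V ≤ LinearMap.eqLocus Q.toLinearMap LinearMap.id :=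
      iSup₂_le fun z hz x hx => hR.pencilProjection_apply_of_mem_ball hr hs hz hx
    exact fun x hx => this hx
  have hQV : ∀ x, Q x ∈ V := by
    intro x
    rw [hQP]
    have h1 := hR.range_splitting_le hfin hTP hinj
    have h2 : (⨆ z, pencilGenEigenspace B M z) ≤ V.comap Q.toLinearMap := by
      refine iSup_le fun z x hx => ?_
      change Q x ∈ V
      by_cases hz : z ∈ ball c r
      · rw [hR.pencilProjection_apply_of_mem_ball hr hs hz hx]
        exact Submodule.mem_iSup_of_mem z (Submodule.mem_iSup_of_mem hz hx)
      · rw [hR.pencilProjection_apply_of_notMem_ball hr hs hz hx]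
        exact zero_mem _
    exact h2 (h1 ⟨x, rfl⟩)
  refine ⟨?_, le_antisymm ?_ ?_, ?_⟩
  · ext x
    exact hVid _ (hQV x)
  · rintro _ ⟨x, rfl⟩
    exact hQV x
  · exact fun x hx => ⟨x, hVid x hx⟩
  · refine Submodule.finiteDimensional_of_le
      (S₂ := (LinearMap.range P.toLinearMap).map Q.toLinearMap) ?_
    rintro _ ⟨x, rfl⟩
    exact ⟨P x, ⟨x, rfl⟩, (hQP x).symm⟩

theorem IsPencilInverse.finsum_finrank_pencilGenEigenspace (hr : 0 ≤ r)
    (hs : Disjoint (sphere c r) (pencilSpectrum B M)) :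
    ∑ᶠ z ∈ ball c r, Module.finrank ℂ (pencilGenEigenspace B M z) =
      Module.finrank ℂ (LinearMap.range (pencilProjection B M c r).toLinearMap) := by
  have hS := hR.finite_pencilSpectrum_inter hT (isBounded_ball (x := c) (r := r))
  have hbot : ∀ z, z ∉ pencilSpectrum B M → pencilGenEigenspace B M z = ⊥ := fun z hz =>
    (isPencilInverse_pencilInverse hz).pencilGenEigenspace_eq_bot
  rw [(hR.pencilProjection_spec hT hr hs).2.1]
  have h1 : (⨆ z ∈ ball c r, pencilGenEigenspace B M z) =
      ⨆ z ∈ hS.toFinset, pencilGenEigenspace B M z := by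
    refine le_antisymm (iSup₂_le fun z hz => ?_) (iSup₂_le fun z hz => ?_)
    · by_cases hz' : z ∈ pencilSpectrum B M
      · exact le_iSup₂_of_le z (by simpa using ⟨hz', hz⟩) le_rfl
      · rw [hbot z hz']
        exact bot_le
    · exact le_iSup₂_of_le z ((hS.mem_toFinset.mp hz).2) le_rfl
  rw [h1, (finrank_biSup_eq_sum hR.iSupIndep_pencilGenEigenspace
    (hR.finiteDimensional_pencilGenEigenspace hT) hS.toFinset).2]
  refine finsum_mem_eq_sum_of_inter_support_eq _ ?_
  ext z
  simp only [mem_inter_iff, Function.mem_support, Finite.coe_toFinset]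
  constructor
  · rintro ⟨h2, h3⟩
    refine ⟨⟨by_contra fun h4 => h3 ?_, h2⟩, h3⟩
    rw [hbot z h4, finrank_bot]
  · rintro ⟨⟨-, h2⟩, h3⟩
    exact ⟨h2, h3⟩

omit hR hT

omit [CompleteSpace X] in
/-- Finite-rank projections at distance less than `1` have the same rank. -/
theorem finrank_range_le_of_norm_sub_lt_one {P Q : X →L[ℂ] X} (hP : IsIdempotentElem P)
    (hfin : FiniteDimensional ℂ (LinearMap.range Q.toLinearMap)) (h : ‖P - Q‖ < 1) :
    Module.finrank ℂ (LinearMap.range P.toLinearMap) ≤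
      Module.finrank ℂ (LinearMap.range Q.toLinearMap) := by
  have hmem : ∀ x, Q x ∈ LinearMap.range Q.toLinearMap := fun x => ⟨x, rfl⟩
  -- `Q` is injective on the range of `P`: if `Q P y = 0`, then `P y = (P - Q) P y`, whose norm is
  -- smaller than that of `P y` unless `P y = 0`.
  let g : LinearMap.range P.toLinearMap →ₗ[ℂ] LinearMap.range Q.toLinearMap :=
    (Q.toLinearMap.codRestrict _ hmem).domRestrict _
  refine LinearMap.finrank_le_finrank_of_injective (f := g) ?_
  rw [injective_iff_map_eq_zero]
  rintro ⟨_, ⟨y, rfl⟩⟩ h0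
  have h1 : Q (P y) = 0 := congrArg Subtype.val h0
  have h2 : P (P y) = P y := by rw [← mul_apply_eq_comp, hP.eq]
  have h3 : ‖P y‖ ≤ ‖P - Q‖ * ‖P y‖ := by
    have := (P - Q).le_opNorm (P y)
    rwa [sub_apply, h1, h2, sub_zero] at this
  refine Subtype.ext ?_
  change P y = 0
  by_contra hne
  have := norm_pos_iff.mpr hne
  nlinarith

end PencilSplitting

/-! ### Compactness criteria -/

section Compactness

variable {E F G : Type*} [NormedAddCommGroup E] [NormedSpace ℂ E] [NormedAddCommGroup F]
  [NormedSpace ℂ F] [NormedAddCommGroup G] [NormedSpace ℂ G]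

/-- An `ε`-net for the image under `C` pulls back to a net for `V`: the two contributions are `ε`
and `ε · 2`, the `2` being the diameter of the unit ball, and `3ε ≤ 4ε`. -/
theorem exists_finite_cover_of_norm_le {V : E →L[ℂ] F} {C : E →L[ℂ] G}
    (hC : IsCompactOperator C) {ε : ℝ} (hε : 0 < ε) (h : ∀ x, ‖V x‖ ≤ ‖C x‖ + ε * ‖x‖) :
    ∃ t : Set F, t.Finite ∧ V '' closedBall 0 1 ⊆ ⋃ y ∈ t, ball y (4 * ε) := by
  obtain ⟨K, hK, hKC⟩ := hC.image_closedBall_subset_compact (f := (C : E →ₗ[ℂ] G)) 1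
  have htb : TotallyBounded (C '' closedBall 0 1) := hK.totallyBounded.subset hKC
  obtain ⟨t, ht1, ht2, ht3⟩ := Metric.finite_approx_of_totallyBounded htb ε hε
  replace ht1 : ∀ y ∈ t, ∃ x ∈ closedBall (0 : E) 1, C x = y := fun y hy => ht1 hy
  choose! p hp hp' using ht1
  refine ⟨(fun y => V (p y)) '' t, ht2.image _, ?_⟩
  rintro _ ⟨x, hx, rfl⟩
  obtain ⟨y, hy, hxy⟩ := mem_iUnion₂.mp (ht3 ⟨x, hx, rfl⟩)
  refine mem_iUnion₂.mpr ⟨_, ⟨y, hy, rfl⟩, ?_⟩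
  rw [mem_ball, dist_eq_norm] at hxy ⊢
  have h1 := h (x - p y)
  rw [map_sub, map_sub, hp' y hy] at h1
  have h2 : ‖x - p y‖ ≤ 2 := by
    refine (norm_sub_le _ _).trans ?_
    have := mem_closedBall_zero_iff.mp hx
    have := mem_closedBall_zero_iff.mp (hp y hy)
    linarith
  nlinarith

theorem isCompactOperator_of_exists_finite_cover [CompleteSpace F] {V : E →L[ℂ] F}
    (h : ∀ ε > 0, ∃ t : Set F, t.Finite ∧ V '' closedBall 0 1 ⊆ ⋃ y ∈ t, ball y (4 * ε)) :
    IsCompactOperator V := by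
  rw [show (V : E → F) = ((V : E →ₗ[ℂ] F) : E → F) from rfl,
    isCompactOperator_iff_isCompact_closure_image_closedBall (V : E →ₗ[ℂ] F) one_pos]
  refine TotallyBounded.isCompact_of_isClosed (TotallyBounded.closure ?_) isClosed_closure
  refine Metric.totallyBounded_iff.mpr fun ε hε => ?_
  obtain ⟨t, ht, htV⟩ := h (ε / 4) (by positivity)
  exact ⟨t, ht, by simpa [mul_div_cancel₀] using htV⟩

/-- An operator `V` is compact when `‖V x‖²` is controlled by compact operators in a quadratic
way. -/
theorem isCompactOperator_of_norm_sq_le [CompleteSpace F] {V : E →L[ℂ] F} {C₁ C₂ : E →L[ℂ] G}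
    (h₁ : IsCompactOperator C₁) (h₂ : IsCompactOperator C₂) {K : ℝ} (hK : 0 ≤ K)
    (h : ∀ x, ‖V x‖ ^ 2 ≤ K * (‖C₁ x‖ ^ 2 + ‖C₂ x‖ * ‖x‖)) : IsCompactOperator V := by
  refine isCompactOperator_of_exists_finite_cover fun ε hε => ?_
  let L₁ : G →L[ℂ] G × G := ContinuousLinearMap.inl ℂ G G
  let L₂ : G →L[ℂ] G × G := ContinuousLinearMap.inr ℂ G G
  -- Chosen so that `K m² + K m ‖x‖ ≤ (a m + ε ‖x‖)²`: the first summand needs `K ≤ a²`, the cross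
  -- term needs `K ≤ 2 a ε`.
  let a : ℝ := K + 1 + K / ε
  have ha : 0 < a := by positivity
  have hC : IsCompactOperator ((a : ℂ) • (L₁ ∘L C₁ + L₂ ∘L C₂) : E →L[ℂ] G × G) :=
    ((h₁.clm_comp L₁).add (h₂.clm_comp L₂)).smul (a : ℂ)
  refine exists_finite_cover_of_norm_le hC hε fun x => ?_
  have e : ((a : ℂ) • (L₁ ∘L C₁ + L₂ ∘L C₂) : E →L[ℂ] G × G) x = (a : ℂ) • (C₁ x, C₂ x) := by
    change (a : ℂ) • ((C₁ x, (0 : G)) + ((0 : G), C₂ x)) = _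
    simp
  rw [e, norm_smul, Prod.norm_def, Complex.norm_real, Real.norm_of_nonneg ha.le]
  set m := max ‖C₁ x‖ ‖C₂ x‖ with hm
  have hm1 : ‖C₁ x‖ ≤ m := le_max_left _ _
  have hm2 : ‖C₂ x‖ ≤ m := le_max_right _ _
  have hm0 : 0 ≤ m := (norm_nonneg _).trans hm1
  have hx0 := norm_nonneg x
  refine abs_le_of_sq_le_sq' ?_ (by positivity) |>.2
  refine (h x).trans ?_
  have h3 : ‖C₁ x‖ ^ 2 ≤ m ^ 2 := by gcongr
  have h4 : ‖C₂ x‖ * ‖x‖ ≤ m * ‖x‖ := by gcongr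
  have h5 : a * m * (ε * ‖x‖) * 2 ≥ K * (m * ‖x‖) := by
    have : K ≤ a * ε := by
      have : K / ε * ε = K := div_mul_cancel₀ K hε.ne'
      nlinarith
    have := mul_le_mul_of_nonneg_right this (mul_nonneg hm0 hx0)
    nlinarith [mul_nonneg hK (mul_nonneg hm0 hx0)]
  have h6 : K * m ^ 2 ≤ (a * m) ^ 2 := by
    have h7 : K + 1 ≤ a := by
      have : 0 ≤ K / ε := by positivity
      linarith
    have : K ≤ a ^ 2 := by nlinarith
    nlinarith [sq_nonneg m, mul_le_mul_of_nonneg_right this (sq_nonneg m)]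
  nlinarith [sq_nonneg (ε * ‖x‖)]

end Compactness

/-! ### A priori estimates for the abstract system -/

section APriori

variable {H : Type*} [NormedAddCommGroup H] [InnerProductSpace ℂ H]

local notation "⟪" x ", " y "⟫" => inner ℂ x y

/-- Two graphs in `H × H` that are adjoint to each other, the smaller one being symmetric and
nonpositive. -/
structure IsAdjointPair (Gmin Gmax : Submodule ℂ (H × H)) : Prop where
  mem_max_iff : ∀ w, w ∈ Gmax ↔ ∀ u ∈ Gmin, ⟪w.1, u.2⟫ = ⟪w.2, u.1⟫
  mem_min_iff : ∀ u, u ∈ Gmin ↔ ∀ w ∈ Gmax, ⟪w.1, u.2⟫ = ⟪w.2, u.1⟫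
  le : Gmin ≤ Gmax
  nonpos : ∀ u ∈ Gmin, (⟪u.1, u.2⟫).re ≤ 0

/-- Interior estimate, uniform in the large parameter `t`, for the localization operator `χ`. -/
def InteriorEstimate (Gmax : Submodule ℂ (H × H)) (χ : H →L[ℂ] H) : Prop :=
  ∃ C : ℝ, ∀ t : ℝ, 1 ≤ t → ∀ w ∈ Gmax,
    ‖χ w.1‖ ≤ ‖χ (w.1 - (t : ℂ)⁻¹ • w.2)‖ + C / √t * ‖w.1‖

/-- For `Δw = l(1+Q)w + h` the interior estimate with `t = l s` compares `χw` with `(1 -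
s⁻¹(1+Q))χw`, up to small terms. Accretivity makes this operator a strict contraction for large
fixed `s`, so `χw` can be absorbed. -/
theorem interior_concentration {Gmax : Submodule ℂ (H × H)} {χ Q : H →L[ℂ] H}
    (hχ : InteriorEstimate Gmax χ) {δ : ℝ} (hδ : 0 < δ)
    (hacc : ∀ x, δ * ‖x‖ ^ 2 ≤ (⟪x, x + Q x⟫).re) (hcomm : ∀ x, χ (Q x) = Q (χ x)) :
    ∃ K : ℝ, 0 ≤ K ∧ ∀ l : ℝ, 1 ≤ l → ∀ w h : H, (w, (l : ℂ) • (w + Q w) + h) ∈ Gmax →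
      ‖χ w‖ ≤ K * (‖h‖ + ‖w‖ / √l) := by
  obtain ⟨C, hC⟩ := hχ
  let m : ℝ := 1 + ‖Q‖
  have hm : ∀ x, ‖x + Q x‖ ≤ m * ‖x‖ := fun x => by
    have := norm_add_le x (Q x)
    have := Q.le_opNorm x
    simp only [m]
    linarith
  -- Ensures `s ≥ 1`, `δ ≤ s` and `m² ≤ δ s`; the last bounds the quadratic term of the contraction
  -- by half of the linear gain `2δ / s`.
  let s : ℝ := 1 + δ + m ^ 2 / δ
  have hm2 : 0 ≤ m ^ 2 / δ := by positivity
  have hs1 : 1 ≤ s := by simp only [s]; linarith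
  have hs0 : 0 < s := by linarith
  have hsδ : δ ≤ s := by simp only [s]; linarith
  have hsm : m ^ 2 ≤ δ * s := by
    have : δ * (m ^ 2 / δ) = m ^ 2 := mul_div_cancel₀ _ hδ.ne'
    simp only [s]
    nlinarith
  have hcontr : ∀ y : H, ‖y - (s : ℂ)⁻¹ • (y + Q y)‖ ≤ (1 - δ / (2 * s)) * ‖y‖ := by
    intro y
    have hρ : 0 ≤ 1 - δ / (2 * s) := by
      rw [sub_nonneg, div_le_one (by positivity)]
      linarith
    refine abs_le_of_sq_le_sq' ?_ (by positivity) |>.2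
    rw [@norm_sub_sq ℂ, inner_smul_right, norm_smul, norm_inv, Complex.norm_real,
      Real.norm_of_nonneg hs0.le]
    have e1 : RCLike.re ((s : ℂ)⁻¹ * ⟪y, y + Q y⟫) = s⁻¹ * (⟪y, y + Q y⟫).re := by
      rw [← Complex.ofReal_inv]
      exact Complex.re_ofReal_mul _ _
    rw [e1]
    have h1 := hacc y
    have h2 : ‖y + Q y‖ ^ 2 ≤ m ^ 2 * ‖y‖ ^ 2 := by
      rw [← mul_pow]
      exact pow_le_pow_left₀ (norm_nonneg _) (hm y) 2
    have h3 : ‖y + Q y‖ ^ 2 ≤ δ * s * ‖y‖ ^ 2 := h2.trans (by gcongr)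
    have h4 : (s⁻¹ * ‖y + Q y‖) ^ 2 ≤ δ * s⁻¹ * ‖y‖ ^ 2 := by
      rw [mul_pow]
      calc s⁻¹ ^ 2 * ‖y + Q y‖ ^ 2 ≤ s⁻¹ ^ 2 * (δ * s * ‖y‖ ^ 2) := by gcongr
        _ = δ * s⁻¹ * ‖y‖ ^ 2 := by field_simp
    have h5 : s⁻¹ * (δ * ‖y‖ ^ 2) ≤ s⁻¹ * (⟪y, y + Q y⟫).re := by gcongr
    have h6 : δ / (2 * s) = δ * s⁻¹ / 2 := by field_simp
    rw [h6]
    nlinarith [sq_nonneg (δ * s⁻¹ / 2 * ‖y‖)]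
  refine ⟨2 * s / δ * (‖χ‖ + |C|), by positivity, fun l hl w h hw => ?_⟩
  have hl0 : 0 < l := by linarith
  have ht : 1 ≤ l * s := by nlinarith
  have h1 := hC (l * s) ht _ hw
  dsimp only at h1
  have e1 : χ (w - ((l * s : ℝ) : ℂ)⁻¹ • ((l : ℂ) • (w + Q w) + h)) =
      (χ w - (s : ℂ)⁻¹ • (χ w + Q (χ w))) - ((l * s : ℝ) : ℂ)⁻¹ • χ h := by
    have hl' : (l : ℂ) ≠ 0 := by exact_mod_cast hl0.ne'
    have hs' : (s : ℂ) ≠ 0 := by exact_mod_cast hs0.ne'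
    rw [map_sub, map_smul, map_add, map_smul, map_add, hcomm, smul_add, smul_smul]
    have : ((l * s : ℝ) : ℂ)⁻¹ * (l : ℂ) = (s : ℂ)⁻¹ := by
      push_cast
      field_simp
    rw [this]
    abel
  rw [e1] at h1
  have h2 := norm_sub_le (χ w - (s : ℂ)⁻¹ • (χ w + Q (χ w))) (((l * s : ℝ) : ℂ)⁻¹ • χ h)
  have h3 := hcontr (χ w)
  have h4 : ‖((l * s : ℝ) : ℂ)⁻¹ • χ h‖ ≤ ‖χ‖ * ‖h‖ := by
    rw [norm_smul, norm_inv, Complex.norm_real, Real.norm_of_nonneg (by positivity)]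
    have h5 : (l * s)⁻¹ ≤ 1 := inv_le_one_of_one_le₀ ht
    calc (l * s)⁻¹ * ‖χ h‖ ≤ 1 * ‖χ h‖ := by gcongr
      _ ≤ ‖χ‖ * ‖h‖ := by rw [one_mul]; exact χ.le_opNorm h
  have h5 : C / √(l * s) * ‖w‖ ≤ |C| * (‖w‖ / √l) := by
    have h6 : √l ≤ √(l * s) := Real.sqrt_le_sqrt (by nlinarith)
    have h7 : 0 < √l := Real.sqrt_pos.mpr hl0
    calc C / √(l * s) * ‖w‖ ≤ |C| / √(l * s) * ‖w‖ := by gcongr; exact le_abs_self C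
      _ ≤ |C| / √l * ‖w‖ := by gcongr
      _ = |C| * (‖w‖ / √l) := by ring
  have h6 : δ / (2 * s) * ‖χ w‖ ≤ ‖χ‖ * ‖h‖ + |C| * (‖w‖ / √l) := by linarith
  have h7 : 0 ≤ ‖w‖ / √l := by positivity
  have h8 : ‖χ‖ * ‖h‖ + |C| * (‖w‖ / √l) ≤ (‖χ‖ + |C|) * (‖h‖ + ‖w‖ / √l) := by
    nlinarith [mul_nonneg (norm_nonneg χ) h7, mul_nonneg (abs_nonneg C) (norm_nonneg h)]
  have h9 : ‖χ w‖ = 2 * s / δ * (δ / (2 * s) * ‖χ w‖) := by field_simp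
  rw [h9, mul_assoc]
  exact mul_le_mul_of_nonneg_left (h6.trans h8) (by positivity)

end APriori

section APriori

variable {H : Type*} [NormedAddCommGroup H] [InnerProductSpace ℂ H]

local notation "⟪" x ", " y "⟫" => inner ℂ x y

/-- The operator `Q` is bounded below away from `-1` in real part, commutes with the localization
`χ`, and is coercive up to an error supported where `χ` lives. -/
structure IsAdmissible (χ Q : H →L[ℂ] H) : Prop where
  accretive : ∃ δ : ℝ, 0 < δ ∧ ∀ x, δ * ‖x‖ ^ 2 ≤ (⟪x, x + Q x⟫).re
  comm : ∀ x, χ (Q x) = Q (χ x)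
  coercive :
    (∃ ζ : ℂ, ‖ζ‖ = 1 ∧ 0 < ζ.re ∧ ∃ c : ℝ, 0 < c ∧ ∃ C : ℝ, 0 ≤ C ∧
      ∀ x, c * ‖x‖ ^ 2 ≤ (ζ * ⟪x, Q x⟫).re + C * ‖χ x‖ ^ 2) ∨
    ((∀ x y, ⟪Q x, y⟫ = ⟪x, Q y⟫) ∧ ∃ c : ℝ, 0 < c ∧ ∃ C : ℝ, 0 ≤ C ∧
      ∀ x, c * ‖x‖ ^ 2 ≤ -(⟪x, Q x⟫).re + C * ‖χ x‖ ^ 2)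

/-- Young's inequality absorbs the linear terms; both energy estimates below end with this. -/
theorem exists_le_mul_of_quadratic_le {a b D : ℝ} (ha : 0 < a) (hb : 0 < b) (hD : 0 ≤ D) :
    ∃ K : ℝ, 0 ≤ K ∧ ∀ x y N : ℝ, 0 ≤ x → 0 ≤ y → 0 ≤ N →
      a * x ^ 2 + b * y ^ 2 ≤ N * x + N * y + D * N ^ 2 → x ≤ K * N ∧ y ≤ K * N := by
  let K : ℝ := (1 / a + 1 / b) * (1 + 1 / a + 1 / b + D) + 1
  have hK : 0 ≤ K := by positivity
  refine ⟨K, hK, fun x y N hx hy hN h => ?_⟩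
  let p := 1 / a
  let q := 1 / b
  have hp : 0 < p := by positivity
  have hq : 0 < q := by positivity
  have hap : a * p = 1 := mul_one_div_cancel ha.ne'
  have hbq : b * q = 1 := mul_one_div_cancel hb.ne'
  have hKe : K = (p + q) * (1 + p + q + D) + 1 := rfl
  have e1 : N * x ≤ a / 2 * x ^ 2 + p / 2 * N ^ 2 := by
    have : a / 2 * (x - p * N) ^ 2 = a / 2 * x ^ 2 + p / 2 * N ^ 2 - N * x := by
      linear_combination (-(x * N) + p * N ^ 2 / 2) * hap
    have : 0 ≤ a / 2 * (x - p * N) ^ 2 := by positivity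
    linarith
  have e2 : N * y ≤ b / 2 * y ^ 2 + q / 2 * N ^ 2 := by
    have : b / 2 * (y - q * N) ^ 2 = b / 2 * y ^ 2 + q / 2 * N ^ 2 - N * y := by
      linear_combination (-(y * N) + q * N ^ 2 / 2) * hbq
    have : 0 ≤ b / 2 * (y - q * N) ^ 2 := by positivity
    linarith
  have h1 : a * x ^ 2 + b * y ^ 2 ≤ (p + q + 2 * D) * N ^ 2 := by linarith
  have key : ∀ P : ℝ, 0 ≤ P → P ≤ p + q → P * (p + q + 2 * D) ≤ K ^ 2 := by
    intro P hP hP'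
    have h2 : P * (p + q + 2 * D) ≤ (p + q) * (2 * (1 + p + q + D)) := by gcongr; linarith
    rw [hKe]
    nlinarith [sq_nonneg ((p + q) * (1 + p + q + D))]
  constructor
  · refine abs_le_of_sq_le_sq' ?_ (by positivity) |>.2
    have h2 : a * x ^ 2 ≤ (p + q + 2 * D) * N ^ 2 := by nlinarith [mul_nonneg hb.le (sq_nonneg y)]
    have h3 : p * (a * x ^ 2) ≤ p * ((p + q + 2 * D) * N ^ 2) := by gcongr
    have h4 : p * (a * x ^ 2) = x ^ 2 := by linear_combination x ^ 2 * hap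
    have h5 := mul_le_mul_of_nonneg_right (key p hp.le (by linarith)) (sq_nonneg N)
    rw [mul_pow]
    linarith
  · refine abs_le_of_sq_le_sq' ?_ (by positivity) |>.2
    have h2 : b * y ^ 2 ≤ (p + q + 2 * D) * N ^ 2 := by nlinarith [mul_nonneg ha.le (sq_nonneg x)]
    have h3 : q * (b * y ^ 2) ≤ q * ((p + q + 2 * D) * N ^ 2) := by gcongr
    have h4 : q * (b * y ^ 2) = y ^ 2 := by linear_combination y ^ 2 * hbq
    have h5 := mul_le_mul_of_nonneg_right (key q hq.le (by linarith)) (sq_nonneg N)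
    rw [mul_pow]
    linarith

variable {Gmin Gmax : Submodule ℂ (H × H)} {χ Q : H →L[ℂ] H}

/-- The quantity `⟪v, Q v⟫` for a solution `(u, v)`. -/
theorem IsAdjointPair.inner_apply_self_eq (hG : IsAdjointPair Gmin Gmax) {l : ℝ} {u v f g : H}
    (hu : (u, (l : ℂ) • (u + Q u) - Q v + f) ∈ Gmin) (hv : (v, (l : ℂ) • v + g) ∈ Gmax) :
    ⟪v, Q v⟫ = l * ⟪v, Q u⟫ + ⟪v, f⟫ - ⟪g, u⟫ := by
  have h := (hG.mem_max_iff _).mp hv _ hu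
  dsimp only at h
  simp only [inner_add_right, inner_sub_right, inner_smul_right, inner_add_left, inner_smul_left,
    Complex.conj_ofReal] at h
  linear_combination -h

/-- Reality matters because after multiplication by the rotation `ζ` only `ζ.re` acts on this term,
so its sign is kept. -/
theorem IsAdjointPair.inner_eq_ofReal (hG : IsAdjointPair Gmin Gmax) {u : H × H} (hu : u ∈ Gmin) :
    ⟪u.1, u.2⟫ = ((⟪u.1, u.2⟫).re : ℂ) := by
  have h := (hG.mem_max_iff _).mp (hG.le hu) _ hu
  have h2 := inner_conj_symm (𝕜 := ℂ) u.1 u.2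
  rw [← h] at h2
  exact (Complex.conj_eq_iff_real.mp h2).elim fun r hr => by rw [hr, Complex.ofReal_re]

theorem re_le_norm_mul_norm (x y : H) : (⟪x, y⟫).re ≤ ‖x‖ * ‖y‖ :=
  (Complex.re_le_norm _).trans (norm_inner_le_norm x y)

theorem neg_re_le_norm_mul_norm (x y : H) : -(⟪x, y⟫).re ≤ ‖x‖ * ‖y‖ :=
  (neg_le_abs _).trans ((Complex.abs_re_le_norm _).trans (norm_inner_le_norm x y))

theorem re_mul_le_norm_mul_norm {ζ : ℂ} (hζ : ‖ζ‖ = 1) (x y : H) :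
    (ζ * ⟪x, y⟫).re ≤ ‖x‖ * ‖y‖ := by
  refine (Complex.re_le_norm _).trans ?_
  rw [norm_mul, hζ, one_mul]
  exact norm_inner_le_norm x y

/-- Bounds for the solutions of the homogeneous-coefficient system at the real point `l`. -/
def SolutionBound (Gmin Gmax : Submodule ℂ (H × H)) (Q : H →L[ℂ] H) (l K : ℝ) : Prop :=
  ∀ u v f g : H, (u, (l : ℂ) • (u + Q u) - Q v + f) ∈ Gmin → (v, (l : ℂ) • v + g) ∈ Gmax →
    ‖u‖ ≤ K * (‖f‖ + ‖g‖) ∧ ‖v‖ ≤ K * (‖f‖ + ‖g‖)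

theorem sq_mul_add_div_sqrt_le {K h w l : ℝ} (hl : 0 < l) {x : ℝ} (hx : 0 ≤ x)
    (h1 : x ≤ K * (h + w / √l)) : x ^ 2 ≤ 2 * K ^ 2 * h ^ 2 + 2 * K ^ 2 / l * w ^ 2 := by
  have h2 : x ^ 2 ≤ (K * (h + w / √l)) ^ 2 := pow_le_pow_left₀ hx h1 2
  have h3 : (w / √l) ^ 2 = w ^ 2 / l := by rw [div_pow, Real.sq_sqrt hl.le]
  have h4 : (K * (h + w / √l)) ^ 2 ≤ K ^ 2 * (2 * h ^ 2 + 2 * (w / √l) ^ 2) := by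
    rw [mul_pow]
    gcongr
    nlinarith [sq_nonneg (h - w / √l)]
  rw [h3] at h4
  calc x ^ 2 ≤ _ := h2.trans h4
    _ = _ := by ring

/-- The substitution `w = v - l u` turns the indefinite term `l⟨v, Qu⟩` into `-l²‖u‖² + l⟨u, Δu⟩`,
which has a favourable sign after multiplication by `ζ`. -/
theorem IsAdjointPair.exists_solutionBound_of_sector (hG : IsAdjointPair Gmin Gmax)
    (hχ : InteriorEstimate Gmax χ) {δ : ℝ} (hδ : 0 < δ)
    (hacc : ∀ x, δ * ‖x‖ ^ 2 ≤ (⟪x, x + Q x⟫).re) (hcomm : ∀ x, χ (Q x) = Q (χ x)) {ζ : ℂ}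
    (hζ1 : ‖ζ‖ = 1) (hζ0 : 0 < ζ.re) {c C : ℝ} (hc : 0 < c) (hC : 0 ≤ C)
    (hco : ∀ x, c * ‖x‖ ^ 2 ≤ (ζ * ⟪x, Q x⟫).re + C * ‖χ x‖ ^ 2) :
    ∃ Λ : ℝ, 1 ≤ Λ ∧ ∀ l : ℝ, Λ ≤ l → ∃ K : ℝ, SolutionBound Gmin Gmax Q l K := by
  obtain ⟨κ, hκ, hint⟩ := interior_concentration hχ hδ hacc hcomm
  -- For such `l` the interior error `2 C κ² / l · ‖w‖²` is at most `c / 2 · ‖w‖²` and can be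
  -- absorbed.
  refine ⟨1 + 4 * C * κ ^ 2 / c, by simp; positivity, fun l hl => ?_⟩
  have hl1 : 1 ≤ l := le_trans (by simp; positivity) hl
  have hl0 : 0 < l := by linarith
  obtain ⟨K, hK, hKb⟩ := exists_le_mul_of_quadratic_le (a := c / 2) (b := ζ.re * l ^ 2)
    (D := 2 * C * κ ^ 2 * (1 + l) ^ 2) (by positivity) (by positivity) (by positivity)
  refine ⟨K + l * K, fun u v f g hu hv => ?_⟩
  set w := v - (l : ℂ) • u with hw
  have hv' : v = w + (l : ℂ) • u := by rw [hw]; abel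
  have hwG : (w, (l : ℂ) • (w + Q w) + (g - (l : ℂ) • f)) ∈ Gmax := by
    have h1 := Gmax.sub_mem hv (Gmax.smul_mem (l : ℂ) (hG.le hu))
    convert h1 using 1
    refine Prod.ext rfl ?_
    change _ = (l : ℂ) • v + g - (l : ℂ) • ((l : ℂ) • (u + Q u) - Q v + f)
    rw [hw, map_sub, map_smul]
    module
  have h1 := hint l hl1 _ _ hwG
  have h2 := sq_mul_add_div_sqrt_le hl0 (norm_nonneg _) h1
  -- The last inner product is `⟨u, Δu⟩`, written out through the equation for `u`.
  have e1 : ⟪w, Q w⟫ = -((l ^ 2 * ‖u‖ ^ 2 : ℝ) : ℂ) + ⟪w, f⟫ - ⟪g, u⟫ +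
      l * ⟪u, (l : ℂ) • (u + Q u) - Q v + f⟫ := by
    have h3 := (hG.mem_max_iff _).mp hwG _ hu
    dsimp only at h3
    have h4 := hG.inner_apply_self_eq hu hv
    have hself : ⟪u, u⟫ = ((‖u‖ ^ 2 : ℝ) : ℂ) := by
      rw [inner_self_eq_norm_sq_to_K]
      norm_cast
    have h5 : ⟪v, Q v⟫ = ⟪w, Q v⟫ + l * ⟪u, Q v⟫ := by
      have h : ∀ y, ⟪v, y⟫ = ⟪w, y⟫ + l * ⟪u, y⟫ := fun y => by
        rw [hv', inner_add_left, inner_smul_left, Complex.conj_ofReal]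
      exact h _
    have h6 : ⟪w, Q w⟫ = ⟪w, Q v⟫ - l * ⟪w, Q u⟫ := by
      have h : ∀ y, ⟪y, Q w⟫ = ⟪y, Q v⟫ - l * ⟪y, Q u⟫ := fun y => by
        rw [hw, map_sub, map_smul, inner_sub_right, inner_smul_right]
      exact h _
    have h7 : ⟪w, Q u⟫ = ⟪v, Q u⟫ - l * ⟪u, Q u⟫ := by
      rw [hw, inner_sub_left, inner_smul_left, Complex.conj_ofReal]
    have h8 : ⟪w, f⟫ = ⟪v, f⟫ - l * ⟪u, f⟫ := by
      rw [hw, inner_sub_left, inner_smul_left, Complex.conj_ofReal]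
    have h9 : ⟪u, (l : ℂ) • (u + Q u) - Q v + f⟫ =
        l * (((‖u‖ ^ 2 : ℝ) : ℂ) + ⟪u, Q u⟫) - ⟪u, Q v⟫ + ⟪u, f⟫ := by
      rw [inner_add_right, inner_sub_right, inner_smul_right, inner_add_right, hself]
    rw [h9, h6, h8, h7]
    push_cast at *
    linear_combination h4 - h5
  have hN := hG.inner_eq_ofReal hu
  have hn := hG.nonpos _ hu
  dsimp only at hN hn
  rw [hN] at e1
  set p := (⟪u, (l : ℂ) • (u + Q u) - Q v + f⟫).re with hp
  have e2 : ζ * ⟪w, Q w⟫ = ζ * ((-(l ^ 2 * ‖u‖ ^ 2) + l * p : ℝ) : ℂ) + ζ * ⟪w, f⟫ -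
      ζ * ⟪g, u⟫ := by
    rw [e1]
    push_cast
    ring
  have e3 : (ζ * ⟪w, Q w⟫).re = ζ.re * (-(l ^ 2 * ‖u‖ ^ 2) + l * p) + (ζ * ⟪w, f⟫).re +
      (-ζ * ⟪g, u⟫).re := by
    rw [e2, Complex.sub_re, Complex.add_re, Complex.re_mul_ofReal, neg_mul, Complex.neg_re]
    ring
  have h3 := hco w
  have h4 := re_mul_le_norm_mul_norm hζ1 w f
  have h5 := re_mul_le_norm_mul_norm (ζ := -ζ) (by rw [norm_neg, hζ1]) g u
  have h6 : ζ.re * (l * p) ≤ 0 :=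
    mul_nonpos_of_nonneg_of_nonpos hζ0.le (mul_nonpos_of_nonneg_of_nonpos hl0.le hn)
  have h7 : C * (2 * κ ^ 2 / l * ‖w‖ ^ 2) ≤ c / 2 * ‖w‖ ^ 2 := by
    have h8 : C * (2 * κ ^ 2 / l) ≤ c / 2 := by
      rw [← mul_div_assoc, div_le_iff₀ hl0]
      have h9 : c * (4 * C * κ ^ 2 / c) = 4 * C * κ ^ 2 := mul_div_cancel₀ _ hc.ne'
      have h10 : c * (1 + 4 * C * κ ^ 2 / c) ≤ c * l := by gcongr
      nlinarith
    nlinarith [mul_le_mul_of_nonneg_right h8 (sq_nonneg ‖w‖)]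
  set N := ‖f‖ + ‖g‖ with hNdef
  have hf0 := norm_nonneg f
  have hg0 := norm_nonneg g
  have hN0 : 0 ≤ N := by positivity
  have h8 : ‖g - (l : ℂ) • f‖ ≤ (1 + l) * N := by
    refine (norm_sub_le _ _).trans ?_
    rw [norm_smul, Complex.norm_real, Real.norm_of_nonneg hl0.le]
    nlinarith
  have h9 : C * (2 * κ ^ 2 * ‖g - (l : ℂ) • f‖ ^ 2) ≤
      2 * C * κ ^ 2 * (1 + l) ^ 2 * N ^ 2 := by
    have : ‖g - (l : ℂ) • f‖ ^ 2 ≤ ((1 + l) * N) ^ 2 := by gcongr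
    calc C * (2 * κ ^ 2 * ‖g - (l : ℂ) • f‖ ^ 2) ≤ C * (2 * κ ^ 2 * ((1 + l) * N) ^ 2) := by
          gcongr
      _ = _ := by ring
  have h10 := mul_le_mul_of_nonneg_left h2 hC
  have h11 : ‖w‖ * ‖f‖ ≤ N * ‖w‖ := by
    rw [mul_comm]
    gcongr
    linarith
  have h12 : ‖g‖ * ‖u‖ ≤ N * ‖u‖ := by
    gcongr
    linarith
  obtain ⟨h13, h14⟩ := hKb ‖w‖ ‖u‖ N (norm_nonneg _) (norm_nonneg _) hN0
    (by linarith only [h3, e3, h4, h5, h6, h7, h9, h10, h11, h12])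
  have h15 : ‖v‖ ≤ ‖w‖ + l * ‖u‖ := by
    rw [hv']
    refine (norm_add_le _ _).trans ?_
    rw [norm_smul, Complex.norm_real, Real.norm_of_nonneg hl0.le]
  have h16 : 0 ≤ l * (K * N) := by positivity
  have h17 : 0 ≤ K * N := by positivity
  constructor
  · linarith
  · have : l * ‖u‖ ≤ l * (K * N) := by gcongr
    linarith

/-- Here no substitution is needed: symmetry gives `Re⟨v, Qu⟩ = Re⟨u, Qv⟩`, and pairing `u` with its
own equation bounds this below by `lδ‖u‖²` up to data, since `⟨u, Δu⟩ ≤ 0`. -/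
theorem IsAdjointPair.exists_solutionBound_of_symmetric (hG : IsAdjointPair Gmin Gmax)
    (hχ : InteriorEstimate Gmax χ) {δ : ℝ} (hδ : 0 < δ)
    (hacc : ∀ x, δ * ‖x‖ ^ 2 ≤ (⟪x, x + Q x⟫).re) (hsym : ∀ x y, ⟪Q x, y⟫ = ⟪x, Q y⟫)
    {c C : ℝ} (hc : 0 < c) (hC : 0 ≤ C)
    (hco : ∀ x, c * ‖x‖ ^ 2 ≤ -(⟪x, Q x⟫).re + C * ‖χ x‖ ^ 2) :
    ∃ Λ : ℝ, 1 ≤ Λ ∧ ∀ l : ℝ, Λ ≤ l → ∃ K : ℝ, SolutionBound Gmin Gmax Q l K := by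
  -- The interior estimate is applied to `v`, whose equation `Δv = l v + g` does not involve `Q`.
  obtain ⟨κ, hκ, hint⟩ := interior_concentration (Q := 0) hχ one_pos
    (fun x => by
      rw [zero_apply, add_zero, one_mul, inner_self_eq_norm_sq_to_K]
      norm_cast) (fun x => by simp)
  refine ⟨1 + 4 * C * κ ^ 2 / c, by simp; positivity, fun l hl => ?_⟩
  have hl1 : 1 ≤ l := le_trans (by simp; positivity) hl
  have hl0 : 0 < l := by linarith
  obtain ⟨K, hK, hKb⟩ := exists_le_mul_of_quadratic_le (a := c / 2) (b := l ^ 2 * δ)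
    (D := 2 * C * κ ^ 2) (by positivity) (by positivity) (by positivity)
  refine ⟨K * (1 + l), fun u v f g hu hv => ?_⟩
  have h1 := hint l hl1 v g (by rwa [zero_apply, add_zero])
  have h2 := sq_mul_add_div_sqrt_le hl0 (norm_nonneg _) h1
  have h4 := hG.inner_apply_self_eq hu hv
  have hn := hG.nonpos _ hu
  dsimp only at hn
  have e1 : (⟪v, Q u⟫).re = (⟪u, Q v⟫).re := by
    rw [← hsym, ← inner_conj_symm, Complex.conj_re]
  have e2 : (⟪u, Q v⟫).re = l * (⟪u, u + Q u⟫).re + (⟪u, f⟫).re -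
      (⟪u, (l : ℂ) • (u + Q u) - Q v + f⟫).re := by
    rw [inner_add_right u (_ - _), inner_sub_right, inner_smul_right, Complex.add_re,
      Complex.sub_re, Complex.re_ofReal_mul]
    ring
  have e3 : (⟪v, Q v⟫).re = l * (⟪v, Q u⟫).re + (⟪v, f⟫).re - (⟪g, u⟫).re := by
    rw [h4, Complex.sub_re, Complex.add_re, Complex.re_ofReal_mul]
  have h3 := hco v
  have h5 := neg_re_le_norm_mul_norm v f
  have h6 := re_le_norm_mul_norm g u
  have h7 := neg_re_le_norm_mul_norm u f
  have h8 := hacc u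
  have h9 : l * (l * (δ * ‖u‖ ^ 2) - ‖u‖ * ‖f‖) ≤ l * (⟪v, Q u⟫).re := by
    refine mul_le_mul_of_nonneg_left ?_ hl0.le
    rw [e1, e2]
    linarith only [mul_le_mul_of_nonneg_left h8 hl0.le, h7, hn]
  have h10 : C * (2 * κ ^ 2 / l * ‖v‖ ^ 2) ≤ c / 2 * ‖v‖ ^ 2 := by
    have h8 : C * (2 * κ ^ 2 / l) ≤ c / 2 := by
      rw [← mul_div_assoc, div_le_iff₀ hl0]
      have h9 : c * (4 * C * κ ^ 2 / c) = 4 * C * κ ^ 2 := mul_div_cancel₀ _ hc.ne'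
      have h10 : c * (1 + 4 * C * κ ^ 2 / c) ≤ c * l := by gcongr
      nlinarith
    linarith only [mul_le_mul_of_nonneg_right h8 (sq_nonneg ‖v‖)]
  set N := ‖f‖ + ‖g‖ with hNdef
  have hf0 := norm_nonneg f
  have hg0 := norm_nonneg g
  have hu0 := norm_nonneg u
  have hv0 := norm_nonneg v
  have hN0 : 0 ≤ N := by positivity
  have hlN : 0 ≤ l * N := by positivity
  have hN1 : N ≤ (1 + l) * N := by linarith only [hlN]
  have hfN : ‖f‖ ≤ N := by linarith only [hNdef, hg0]
  have hgN : ‖g‖ ≤ N := by linarith only [hNdef, hf0]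
  have h11 := mul_le_mul_of_nonneg_left h2 hC
  have h12 : C * (2 * κ ^ 2 * ‖g‖ ^ 2) ≤ 2 * C * κ ^ 2 * ((1 + l) * N) ^ 2 := by
    have : ‖g‖ ^ 2 ≤ ((1 + l) * N) ^ 2 := by
      gcongr
      exact hgN.trans hN1
    calc C * (2 * κ ^ 2 * ‖g‖ ^ 2) ≤ C * (2 * κ ^ 2 * ((1 + l) * N) ^ 2) := by gcongr
      _ = _ := by ring
  have h13 : ‖v‖ * ‖f‖ ≤ (1 + l) * N * ‖v‖ := by
    rw [mul_comm]
    gcongr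
    exact hfN.trans hN1
  have h14 : ‖g‖ * ‖u‖ + l * (‖u‖ * ‖f‖) ≤ (1 + l) * N * ‖u‖ := by
    have : ‖g‖ + l * ‖f‖ ≤ (1 + l) * N := by
      linarith only [hgN, mul_le_mul_of_nonneg_left hfN hl0.le]
    linarith only [mul_le_mul_of_nonneg_right this hu0]
  obtain ⟨h15, h16⟩ := hKb ‖v‖ ‖u‖ ((1 + l) * N) hv0 hu0 (by positivity)
      (by linarith only [h3, e3, h5, h6, h9, h10, h11, h12, h13, h14])
  rw [mul_assoc]
  exact ⟨h16, h15⟩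

theorem IsAdjointPair.exists_solutionBound (hG : IsAdjointPair Gmin Gmax)
    (hχ : InteriorEstimate Gmax χ) (hQ : IsAdmissible χ Q) :
    ∃ Λ : ℝ, 1 ≤ Λ ∧ ∀ l : ℝ, Λ ≤ l → ∃ K : ℝ, SolutionBound Gmin Gmax Q l K := by
  obtain ⟨δ, hδ, hacc⟩ := hQ.accretive
  rcases hQ.coercive with ⟨ζ, hζ1, hζ0, c, hc, C, hC, hco⟩ | ⟨hsym, c, hc, C, hC, hco⟩
  · exact hG.exists_solutionBound_of_sector hχ hδ hacc hQ.comm hζ1 hζ0 hc hC hco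
  · exact hG.exists_solutionBound_of_symmetric hχ hδ hacc hsym hc hC hco

end APriori

/-! ### Unique solvability of the system for a large real parameter. -/

section Solvability

variable {H : Type*} [NormedAddCommGroup H] [InnerProductSpace ℂ H]
  {Gmin Gmax : Submodule ℂ (H × H)} {χ Q : H →L[ℂ] H}

local notation "⟪" x ", " y "⟫" => inner ℂ x y

/-- Makes the a priori bound available for the adjoint system, with `ζ` replaced by its conjugate.
-/
theorem IsAdmissible.adjoint [CompleteSpace H] (hQ : IsAdmissible χ Q)
    (hχ : ∀ x y, ⟪χ x, y⟫ = ⟪x, χ y⟫) : IsAdmissible χ (ContinuousLinearMap.adjoint Q) := by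
  have hre : ∀ x, (⟪x, ContinuousLinearMap.adjoint Q x⟫) =
      (starRingEnd ℂ) (⟪x, Q x⟫) := fun x => by
    rw [ContinuousLinearMap.adjoint_inner_right, inner_conj_symm]
  refine ⟨?_, ?_, ?_⟩
  · obtain ⟨δ, hδ, h⟩ := hQ.accretive
    refine ⟨δ, hδ, fun x => (h x).trans_eq ?_⟩
    rw [inner_add_right, inner_add_right, hre, Complex.add_re, Complex.add_re, Complex.conj_re]
  · intro y
    refine ext_inner_left ℂ fun x => ?_
    rw [← hχ, ContinuousLinearMap.adjoint_inner_right, ContinuousLinearMap.adjoint_inner_right,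
      ← hQ.comm, hχ]
  · rcases hQ.coercive with ⟨ζ, h1, h2, c, hc, C, hC, h⟩ | ⟨hsym, c, hc, C, hC, h⟩
    · refine Or.inl ⟨(starRingEnd ℂ) ζ, by rwa [RCLike.norm_conj], by rwa [Complex.conj_re], c, hc,
        C, hC, fun x => ?_⟩
      rw [hre, ← map_mul, Complex.conj_re]
      exact h x
    · refine Or.inr ⟨fun x y => ?_, c, hc, C, hC, fun x => ?_⟩
      · rw [ContinuousLinearMap.adjoint_inner_right, ContinuousLinearMap.adjoint_inner_left, hsym]
      · rw [hre, Complex.conj_re]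
        exact h x

theorem IsAdjointPair.isClosed_max (hG : IsAdjointPair Gmin Gmax) :
    IsClosed (Gmax : Set (H × H)) := by
  have : (Gmax : Set (H × H)) = ⋂ u ∈ Gmin, {w : H × H | ⟪w.1, u.2⟫ = ⟪w.2, u.1⟫} := by
    ext w
    simpa using hG.mem_max_iff w
  rw [this]
  exact isClosed_biInter fun u _ => isClosed_eq (by fun_prop) (by fun_prop)

theorem IsAdjointPair.isClosed_min (hG : IsAdjointPair Gmin Gmax) :
    IsClosed (Gmin : Set (H × H)) := by
  have : (Gmin : Set (H × H)) = ⋂ w ∈ Gmax, {u : H × H | ⟪w.1, u.2⟫ = ⟪w.2, u.1⟫} := by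
    ext u
    simpa using hG.mem_min_iff u
  rw [this]
  exact isClosed_biInter fun u _ => isClosed_eq (by fun_prop) (by fun_prop)

/-- The right-hand sides `(f, g)` for which the system has a solution. -/
def solvableData (Gmin Gmax : Submodule ℂ (H × H)) (Q : H →L[ℂ] H) (l : ℝ) :
    Submodule ℂ (WithLp 2 (H × H)) where
  carrier := {p | ∃ u v : H, (u, (l : ℂ) • (u + Q u) - Q v + p.fst) ∈ Gmin ∧
    (v, (l : ℂ) • v + p.snd) ∈ Gmax}
  add_mem' := by
    rintro p q ⟨u, v, hu, hv⟩ ⟨u', v', hu', hv'⟩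
    refine ⟨u + u', v + v', ?_, ?_⟩
    · convert Gmin.add_mem hu hu' using 1
      refine Prod.ext rfl ?_
      change _ = (l : ℂ) • (u + Q u) - Q v + p.fst + ((l : ℂ) • (u' + Q u') - Q v' + q.fst)
      rw [map_add, map_add, WithLp.add_fst]
      module
    · convert Gmax.add_mem hv hv' using 1
      refine Prod.ext rfl ?_
      change _ = (l : ℂ) • v + p.snd + ((l : ℂ) • v' + q.snd)
      rw [WithLp.add_snd]
      module
  zero_mem' := ⟨0, 0,
    by
      simp only [map_zero, add_zero, smul_zero, sub_zero, WithLp.zero_fst]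
      exact Gmin.zero_mem,
    by simp only [add_zero, smul_zero, WithLp.zero_snd]; exact Gmax.zero_mem⟩
  smul_mem' := by
    rintro c p ⟨u, v, hu, hv⟩
    refine ⟨c • u, c • v, ?_, ?_⟩
    · convert Gmin.smul_mem c hu using 1
      refine Prod.ext rfl ?_
      change _ = c • ((l : ℂ) • (u + Q u) - Q v + p.fst)
      rw [map_smul, map_smul, WithLp.smul_fst]
      module
    · convert Gmax.smul_mem c hv using 1
      refine Prod.ext rfl ?_
      change _ = c • ((l : ℂ) • v + p.snd)
      rw [WithLp.smul_snd]
      module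

/-- The bound makes solutions for convergent data Cauchy, and both graphs are closed. -/
theorem IsAdjointPair.isClosed_solvableData [CompleteSpace H] (hG : IsAdjointPair Gmin Gmax)
    {l K : ℝ} (hK : SolutionBound Gmin Gmax Q l K) :
    IsClosed (solvableData Gmin Gmax Q l : Set (WithLp 2 (H × H))) := by
  refine IsSeqClosed.isClosed fun p q hp hpq => ?_
  choose u v hu hv using hp
  have hf : Filter.Tendsto (fun n => (p n).fst) Filter.atTop (nhds q.fst) :=
    ((WithLp.prod_continuous_ofLp 2 H H).fst.tendsto q).comp hpq
  have hg : Filter.Tendsto (fun n => (p n).snd) Filter.atTop (nhds q.snd) :=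
    ((WithLp.prod_continuous_ofLp 2 H H).snd.tendsto q).comp hpq
  have hdiff : ∀ i j, ‖u i - u j‖ ≤ K * (‖(p i).fst - (p j).fst‖ + ‖(p i).snd - (p j).snd‖) ∧
      ‖v i - v j‖ ≤ K * (‖(p i).fst - (p j).fst‖ + ‖(p i).snd - (p j).snd‖) := by
    intro i j
    refine hK _ _ _ _ ?_ ?_
    · convert Gmin.sub_mem (hu i) (hu j) using 1
      refine Prod.ext rfl ?_
      change _ = (l : ℂ) • (u i + Q (u i)) - Q (v i) + (p i).fst -
        ((l : ℂ) • (u j + Q (u j)) - Q (v j) + (p j).fst)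
      rw [map_sub, map_sub]
      module
    · convert Gmax.sub_mem (hv i) (hv j) using 1
      refine Prod.ext rfl ?_
      change _ = (l : ℂ) • v i + (p i).snd - ((l : ℂ) • v j + (p j).snd)
      module
  have hlim : Filter.Tendsto (fun ij : ℕ × ℕ =>
      K * (‖(p ij.1).fst - (p ij.2).fst‖ + ‖(p ij.1).snd - (p ij.2).snd‖))
      Filter.atTop (nhds 0) := by
    rw [← Filter.prod_atTop_atTop_eq]
    have h1 := (((hf.comp Filter.tendsto_fst).sub (hf.comp Filter.tendsto_snd)).norm.add
      ((hg.comp Filter.tendsto_fst).sub (hg.comp Filter.tendsto_snd)).norm).const_mul K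
    simpa using h1
  have hcu : CauchySeq u := by
    rw [cauchySeq_iff_tendsto_dist_atTop_0]
    refine squeeze_zero (fun _ => dist_nonneg) (fun ij => ?_) hlim
    rw [dist_eq_norm]
    exact (hdiff _ _).1
  have hcv : CauchySeq v := by
    rw [cauchySeq_iff_tendsto_dist_atTop_0]
    refine squeeze_zero (fun _ => dist_nonneg) (fun ij => ?_) hlim
    rw [dist_eq_norm]
    exact (hdiff _ _).2
  obtain ⟨U, hU⟩ := cauchySeq_tendsto_of_complete hcu
  obtain ⟨W, hW⟩ := cauchySeq_tendsto_of_complete hcv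
  refine ⟨U, W, ?_, ?_⟩
  · refine hG.isClosed_min.mem_of_tendsto (hU.prodMk_nhds ?_) (Filter.Eventually.of_forall hu)
    exact (((hU.add ((Q.continuous.tendsto U).comp hU)).const_smul (l : ℂ)).sub
      ((Q.continuous.tendsto W).comp hW)).add hf
  · refine hG.isClosed_max.mem_of_tendsto (hW.prodMk_nhds ?_) (Filter.Eventually.of_forall hv)
    exact (hW.const_smul (l : ℂ)).add hg

/-- A vector `(a, b)` orthogonal to all solvable data satisfies the system of the adjoint multiplier
with the components interchanged, so uniqueness for that system forces it to vanish. -/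
theorem IsAdjointPair.solvableData_eq_top [CompleteSpace H] (hG : IsAdjointPair Gmin Gmax)
    {l K K' : ℝ} (hK : SolutionBound Gmin Gmax Q l K)
    (hK' : SolutionBound Gmin Gmax (ContinuousLinearMap.adjoint Q) l K') :
    solvableData Gmin Gmax Q l = ⊤ := by
  have hcl := hG.isClosed_solvableData hK
  have : CompleteSpace (solvableData Gmin Gmax Q l) := hcl.completeSpace_coe
  rw [← Submodule.orthogonal_eq_bot_iff, eq_bot_iff]
  intro p hp
  set a := p.fst with ha
  set b := p.snd with hb
  set Q' := ContinuousLinearMap.adjoint Q with hQ'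
  have hort : ∀ q ∈ solvableData Gmin Gmax Q l, ⟪a, q.fst⟫ + ⟪b, q.snd⟫ = 0 := by
    intro q hq
    have h := (Submodule.mem_orthogonal' _ p).mp hp q hq
    rwa [WithLp.prod_inner_apply] at h
  have hamax : (a, (l : ℂ) • (a + Q' a)) ∈ Gmax := by
    refine (hG.mem_max_iff _).mpr fun u hu => ?_
    have h := hort (WithLp.toLp 2 (u.2 - (l : ℂ) • (u.1 + Q u.1), 0)) ⟨u.1, 0, by simpa using hu,
      by
        rw [smul_zero, zero_add]; exact Gmax.zero_mem⟩
    have h' : ⟪a, u.2 - (l : ℂ) • (u.1 + Q u.1)⟫ + ⟪b, (0 : H)⟫ = 0 := h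
    rw [inner_zero_right, add_zero, inner_sub_right, sub_eq_zero] at h'
    dsimp only
    rw [h', inner_smul_right, inner_smul_left, Complex.conj_ofReal, inner_add_right,
      inner_add_left, ContinuousLinearMap.adjoint_inner_left]
  have hbmin : (b, (l : ℂ) • b - Q' a) ∈ Gmin := by
    refine (hG.mem_min_iff _).mpr fun v hv => ?_
    have h := hort (WithLp.toLp 2 (Q v.1, v.2 - (l : ℂ) • v.1)) ⟨0, v.1,
      by
        rw [map_zero, add_zero, smul_zero, zero_sub]
        change ((0 : H), -Q v.1 + Q v.1) ∈ Gmin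
        rw [neg_add_cancel]; exact Gmin.zero_mem, by simpa using hv⟩
    have h' : ⟪a, Q v.1⟫ + ⟪b, v.2 - (l : ℂ) • v.1⟫ = 0 := h
    dsimp only
    rw [← inner_conj_symm v.2 b, ← inner_conj_symm v.1]
    congr 1
    rw [inner_sub_left, inner_smul_left, Complex.conj_ofReal,
      ContinuousLinearMap.adjoint_inner_left]
    rw [inner_sub_right, inner_smul_right] at h'
    linear_combination -h'
  -- From `Δa = l(1+Q')a` and `Δb = l b - Q'a`, the pair `(b, a + l b)` solves the homogeneous
  -- adjoint system.
  have h0 := hK' b (a + (l : ℂ) • b) 0 0 (by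
    convert hbmin using 2
    rw [map_add, map_smul]
    module) (by
    convert Gmax.add_mem hamax (Gmax.smul_mem (l : ℂ) (hG.le hbmin)) using 1
    refine Prod.ext rfl ?_
    change _ = (l : ℂ) • (a + Q' a) + (l : ℂ) • ((l : ℂ) • b - Q' a)
    module)
  simp only [norm_zero, add_zero, mul_zero, norm_le_zero_iff] at h0
  obtain ⟨hb0, ha0⟩ := h0
  rw [hb0, smul_zero, add_zero] at ha0
  rw [Submodule.mem_bot]
  exact (WithLp.ofLp_injective 2) (Prod.ext ha0 hb0)

/-- For a large real parameter, the system is uniquely solvable with bounds. -/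
theorem IsAdjointPair.exists_solvable [CompleteSpace H] (hG : IsAdjointPair Gmin Gmax)
    (hint : InteriorEstimate Gmax χ) (hχ : ∀ x y, ⟪χ x, y⟫ = ⟪x, χ y⟫) (hQ : IsAdmissible χ Q) :
    ∃ l K : ℝ, SolutionBound Gmin Gmax Q l K ∧ ∀ f g : H, ∃ u v : H,
      (u, (l : ℂ) • (u + Q u) - Q v + f) ∈ Gmin ∧ (v, (l : ℂ) • v + g) ∈ Gmax := by
  obtain ⟨Λ, -, h⟩ := hG.exists_solutionBound hint hQ
  obtain ⟨Λ', -, h'⟩ := hG.exists_solutionBound hint (hQ.adjoint hχ)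
  obtain ⟨K, hK⟩ := h (max Λ Λ') (le_max_left _ _)
  obtain ⟨K', hK'⟩ := h' (max Λ Λ') (le_max_right _ _)
  refine ⟨max Λ Λ', K, hK, fun f g => ?_⟩
  have htop := hG.solvableData_eq_top hK hK'
  have hmem : WithLp.toLp 2 (f, g) ∈ solvableData Gmin Gmax Q (max Λ Λ') := by
    rw [htop]
    trivial
  exact hmem

end Solvability

/-! ### Plane waves -/

section PlaneWave

variable {n : ℕ}

local notation "𝔼" => EuclideanSpace ℝ (Fin n)

/-- The plane wave `exp (-i κ·x)`. -/
def planeWave (κ x : EuclideanSpace ℝ (Fin n)) : ℂ :=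
  Complex.exp (-(Complex.I * (inner ℝ κ x : ℝ)))

theorem norm_planeWave (κ x : 𝔼) : ‖planeWave κ x‖ = 1 := by
  rw [planeWave, Complex.norm_exp]
  simp

theorem contDiff_planeWave (κ : 𝔼) : ContDiff ℝ ∞ (planeWave κ) := by
  unfold planeWave
  have h1 : ContDiff ℝ ∞ fun x : 𝔼 => ((inner ℝ κ x : ℝ) : ℂ) :=
    Complex.ofRealCLM.contDiff.comp (contDiff_const.inner ℝ contDiff_id)
  exact (contDiff_const.mul h1).neg.cexp

theorem hasFDerivAt_planeWave (κ x : 𝔼) :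
    HasFDerivAt (planeWave κ)
      (planeWave κ x • -(Complex.I • (Complex.ofRealCLM ∘L innerSL ℝ κ))) x := by
  have h1 : HasFDerivAt (fun x : 𝔼 => ((inner ℝ κ x : ℝ) : ℂ))
      (Complex.ofRealCLM ∘L innerSL ℝ κ) x :=
    (Complex.ofRealCLM ∘L innerSL ℝ κ).hasFDerivAt
  exact ((h1.const_mul Complex.I).neg).cexp

/-- The directional derivative of `φ` times a plane wave. -/
theorem fderiv_mul_planeWave {φ : 𝔼 → ℂ} {x : 𝔼} (hφ : DifferentiableAt ℝ φ x) (κ b : 𝔼) :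
    fderiv ℝ (fun y => φ y * planeWave κ y) x b =
      (fderiv ℝ φ x b - Complex.I * (inner ℝ κ b : ℝ) * φ x) * planeWave κ x := by
  have h := hφ.hasFDerivAt.mul (hasFDerivAt_planeWave κ x)
  have h' := h.fderiv
  rw [show (φ * planeWave κ) = fun y => φ y * planeWave κ y from rfl] at h'
  rw [h']
  simp
  ring

theorem laplacian_eq_sum_fderiv {f : 𝔼 → ℂ} (hf : ContDiff ℝ 2 f) (x : 𝔼) :
    Δ f x = ∑ i, fderiv ℝ (fun y => fderiv ℝ f y (EuclideanSpace.basisFun (Fin n) ℝ i)) x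
      (EuclideanSpace.basisFun (Fin n) ℝ i) := by
  rw [InnerProductSpace.laplacian_eq_iteratedFDeriv_orthonormalBasis f
    (EuclideanSpace.basisFun (Fin n) ℝ)]
  refine Finset.sum_congr rfl fun i _ => ?_
  rw [iteratedFDeriv_two_apply]
  have hd : DifferentiableAt ℝ (fderiv ℝ f) x :=
    ((hf.fderiv_right (m := 1) (by norm_num)).differentiable (by norm_num)).differentiableAt
  rw [fderiv_clm_apply hd (differentiableAt_const _)]
  simp

theorem laplacian_mul_planeWave {φ : 𝔼 → ℂ} (hφ : ContDiff ℝ 2 φ) (κ x : 𝔼) :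
    Δ (fun y => φ y * planeWave κ y) x =
      (Δ φ x - 2 * Complex.I * ∑ i, (κ i : ℂ) *
        fderiv ℝ φ x (EuclideanSpace.basisFun (Fin n) ℝ i) - (‖κ‖ ^ 2 : ℝ) * φ x) *
        planeWave κ x := by
  have hw : ContDiff ℝ 2 (planeWave κ) := by
    exact_mod_cast contDiff_infty.mp (contDiff_planeWave κ) 2
  have hd : Differentiable ℝ φ := hφ.differentiable (by norm_num)
  rw [laplacian_eq_sum_fderiv (hφ.mul hw), laplacian_eq_sum_fderiv hφ]
  have hd2 : ∀ b, Differentiable ℝ fun y => fderiv ℝ φ y b := fun b =>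
    ((hφ.fderiv_right (m := 1) (by norm_num)).differentiable (by norm_num)).clm_apply
      (differentiable_const b)
  have h1 : ∀ i, fderiv ℝ (fun y => fderiv ℝ (fun y => φ y * planeWave κ y) y
      (EuclideanSpace.basisFun (Fin n) ℝ i)) x (EuclideanSpace.basisFun (Fin n) ℝ i) =
      (fderiv ℝ (fun y => fderiv ℝ φ y (EuclideanSpace.basisFun (Fin n) ℝ i)) x
        (EuclideanSpace.basisFun (Fin n) ℝ i) - 2 * Complex.I * ((κ i : ℂ) *
        fderiv ℝ φ x (EuclideanSpace.basisFun (Fin n) ℝ i)) - (κ i : ℂ) ^ 2 * φ x) *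
        planeWave κ x := by
    intro i
    set b := EuclideanSpace.basisFun (Fin n) ℝ i with hb
    have e1 : (fun y => fderiv ℝ (fun y => φ y * planeWave κ y) y b) = fun y =>
        (fderiv ℝ φ y b - Complex.I * (inner ℝ κ b : ℝ) * φ y) * planeWave κ y := by
      funext y
      exact fderiv_mul_planeWave (hd y) κ b
    have e2 : inner ℝ κ b = κ i := by
      rw [hb]
      simp [EuclideanSpace.inner_single_right]
    have e3 := fderiv_mul_planeWave (φ := fun y => fderiv ℝ φ y b -
      Complex.I * (inner ℝ κ b : ℝ) * φ y) (x := x) ((hd2 b x).sub ((hd x).const_mul _)) κ b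
    rw [e1, e3, e2,
      fderiv_fun_sub (hd2 b x) ((hd x).const_mul _), fderiv_const_mul (hd x)]
    simp only [sub_apply, smul_apply, smul_eq_mul]
    linear_combination (κ i : ℂ) ^ 2 * φ x * planeWave κ x * Complex.I_sq
  rw [Finset.sum_congr rfl fun i _ => h1 i, ← Finset.sum_mul, Finset.sum_sub_distrib,
    Finset.sum_sub_distrib, Finset.mul_sum, ← Finset.sum_mul]
  congr 3
  rw [EuclideanSpace.norm_sq_eq]
  push_cast
  refine Finset.sum_congr rfl fun i _ => ?_
  rw [Real.norm_eq_abs, ← Complex.ofReal_pow, ← Complex.ofReal_pow, sq_abs]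

end PlaneWave

/-! ### Fourier coefficients on a bounded domain -/

section Fourier

variable {n : ℕ}

local notation "𝔼" => EuclideanSpace ℝ (Fin n)

local instance : MeasureSpace UnitAddCircle := ⟨AddCircle.haarAddCircle⟩

/-- The fundamental domain parametrization of the cube with side `l` by the torus. -/
def torusChart (n : ℕ) (l : ℝ) (t : UnitAddTorus (Fin n)) : EuclideanSpace ℝ (Fin n) :=
  l • WithLp.toLp 2 (UnitAddTorus.measurableEquivPiIoc (fun _ : Fin n => (-(1 / 2) : ℝ)) t).1

theorem measurable_torusChart (l : ℝ) : Measurable (torusChart n l) := by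
  unfold torusChart
  exact ((WithLp.measurable_toLp 2 _).comp
    (measurable_subtype_coe.comp (MeasurableEquiv.measurable _))).const_smul l

theorem map_torusChart_restrict {D : Set 𝔼} (hD : MeasurableSet D) {l : ℝ} (hl : 0 < l)
    (hDl : D ⊆ ball 0 (l / 2)) :
    ((volume : Measure (UnitAddTorus (Fin n))).map (torusChart n l)).restrict D =
      ENNReal.ofReal ((l ^ n)⁻¹) • volume.restrict D := by
  let a : Fin n → ℝ := fun _ => -(1 / 2)
  let J : Set (Fin n → ℝ) := {x | ∀ i, x i ∈ Ioc (a i) (a i + 1)}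
  have hJ : MeasurableSet J := MeasurableSet.univ_pi' fun i => measurableSet_Ioc
  let g : (Fin n → ℝ) → 𝔼 := fun y => l • WithLp.toLp 2 y
  have hg : Measurable g := (WithLp.measurable_toLp 2 _).const_smul l
  have h1 : ((volume : Measure (UnitAddTorus (Fin n))).map (torusChart n l)) =
      (volume.restrict J).map g := by
    have e : torusChart n l = g ∘ (Subtype.val ∘ UnitAddTorus.measurableEquivPiIoc a) := rfl
    rw [e, ← Measure.map_map hg
      (measurable_subtype_coe.comp (MeasurableEquiv.measurable _)),
      ← Measure.map_map measurable_subtype_coe (MeasurableEquiv.measurable _),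
      (UnitAddTorus.measurePreserving_equivPiIoc a).map_eq]
    exact congrArg (Measure.map g) (map_comap_subtype_coe hJ _)
  have h2 : (volume : Measure (Fin n → ℝ)).map g =
      ENNReal.ofReal ((l ^ n)⁻¹) • (volume : Measure 𝔼) := by
    have e : g = (fun x : 𝔼 => l • x) ∘ WithLp.toLp 2 := rfl
    rw [e, ← Measure.map_map (measurable_const_smul l) (WithLp.measurable_toLp 2 _),
      (PiLp.volume_preserving_toLp (Fin n)).map_eq,
      Measure.map_addHaar_smul _ hl.ne', finrank_euclideanSpace_fin, abs_of_pos (by positivity)]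
  have h3 : g ⁻¹' D ⊆ J := by
    intro y hy i
    have h4 := hDl hy
    rw [mem_ball_zero_iff, norm_smul, Real.norm_of_nonneg hl.le] at h4
    have h5 : ‖(WithLp.toLp 2 y : 𝔼) i‖ ≤ ‖(WithLp.toLp 2 y : 𝔼)‖ := PiLp.norm_apply_le _ i
    have h6 : ‖y i‖ < 1 / 2 := by
      refine h5.trans_lt ?_
      by_contra h
      push Not at h
      nlinarith
    rw [Real.norm_eq_abs, abs_lt] at h6
    simp only [a]
    constructor <;> linarith [h6.1, h6.2]
  rw [h1, Measure.restrict_map hg hD, Measure.restrict_restrict (hg hD),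
    inter_eq_left.mpr h3, ← Measure.restrict_map hg hD, h2, Measure.restrict_smul]

theorem mFourier_neg_eq_planeWave {l : ℝ} (hl : 0 < l) (k : Fin n → ℤ)
    (t : UnitAddTorus (Fin n)) :
    UnitAddTorus.mFourier (-k) t =
      planeWave (WithLp.toLp 2 fun i => 2 * Real.pi / l * k i) (torusChart n l t) := by
  let a : Fin n → ℝ := fun _ => -(1 / 2)
  let z := UnitAddTorus.measurableEquivPiIoc a t
  have ht : t = fun i => ((z.1 i : ℝ) : UnitAddCircle) :=
    ((UnitAddTorus.measurableEquivPiIoc a).symm_apply_apply t).symm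
  have hc : torusChart n l t = l • WithLp.toLp 2 z.1 := rfl
  rw [hc]
  clear_value z
  clear hc
  obtain ⟨y, hy⟩ := z
  dsimp only at ht ⊢
  subst ht
  have h0 : UnitAddTorus.mFourier (-k) (fun i => ((y i : ℝ) : UnitAddCircle)) =
      ∏ i, fourier ((-k) i) ((y i : ℝ) : UnitAddCircle) := rfl
  rw [h0, planeWave]
  simp only [fourier_coe_apply]
  rw [← Complex.exp_sum]
  congr 1
  rw [real_inner_smul_right, PiLp.inner_apply]
  push_cast
  rw [Finset.mul_sum, Finset.mul_sum, ← Finset.sum_neg_distrib]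
  refine Finset.sum_congr rfl fun i _ => ?_
  have hl' : (l : ℂ) ≠ 0 := by exact_mod_cast hl.ne'
  simp
  field_simp

theorem finite_setOf_norm_lattice_le {l : ℝ} (hl : 0 < l) (r : ℝ) :
    {k : Fin n → ℤ | ‖(WithLp.toLp 2 fun i => 2 * Real.pi / l * k i : 𝔼)‖ ≤ r}.Finite := by
  let N : ℤ := ⌈r * l / (2 * Real.pi)⌉
  refine (finite_Icc (fun _ : Fin n => -N) (fun _ => N)).subset fun k hk => ?_
  have h : ∀ i, |k i| ≤ N := by
    intro i
    have h1 : ‖(WithLp.toLp 2 fun i => 2 * Real.pi / l * k i : 𝔼) i‖ ≤ r :=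
      (PiLp.norm_apply_le _ i).trans hk
    have h2 : 2 * Real.pi / l * |(k i : ℝ)| ≤ r := by
      rw [Real.norm_eq_abs] at h1
      change |2 * Real.pi / l * k i| ≤ r at h1
      rwa [abs_mul, abs_of_pos (by positivity)] at h1
    have h3 : |(k i : ℝ)| ≤ r * l / (2 * Real.pi) := by
      rw [le_div_iff₀ (by positivity)]
      rw [div_mul_eq_mul_div, div_le_iff₀ hl] at h2
      linarith
    have h4 := h3.trans (Int.le_ceil _)
    exact_mod_cast h4
  exact ⟨fun i => (abs_le.mp (h i)).1, fun i => (abs_le.mp (h i)).2⟩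

/-- Fourier coefficients on a bounded domain, with Parseval's identity. -/
theorem exists_fourier_coefficients {D : Set 𝔼} (hDo : IsOpen D)
    (hDb : Bornology.IsBounded D) :
    ∃ (κ : (Fin n → ℤ) → 𝔼) (F : (Fin n → ℤ) → L2 D →L[ℂ] ℂ) (c : ℂ),
      (∀ r : ℝ, {k | ‖κ k‖ ≤ r}.Finite) ∧
      (∀ k f, F k f = c * ∫ x in D, f x * planeWave (κ k) x) ∧
      ∀ f, HasSum (fun k => ‖F k f‖ ^ 2) (‖f‖ ^ 2) := by
  obtain ⟨ρ, hρ⟩ := hDb.subset_ball 0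
  -- The side of a cube large enough for the ball of radius `l / 2` to contain `D`; the summand `1`
  -- keeps it positive.
  let l : ℝ := 2 * (max ρ 0 + 1)
  have hl : 0 < l := by
    have := le_max_right ρ 0
    simp only [l]; linarith
  have hDl : D ⊆ ball 0 (l / 2) := hρ.trans (ball_subset_ball (by
    have := le_max_left ρ 0
    simp only [l]; linarith))
  have hDm := hDo.measurableSet
  have hfin : IsFiniteMeasure (domainMeasure D) :=
    ⟨by simpa using hDb.measure_lt_top⟩
  let κ : (Fin n → ℤ) → 𝔼 := fun k => WithLp.toLp 2 fun i => 2 * Real.pi / l * k i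
  have hw : ∀ κ : 𝔼, MemLp (planeWave κ) 2 (domainMeasure D) := fun κ =>
    MemLp.of_bound (contDiff_planeWave κ).continuous.aestronglyMeasurable 1
      (Filter.Eventually.of_forall fun x => (norm_planeWave κ x).le)
  -- The density of normalized Haar measure of the torus with respect to Lebesgue measure on `D`;
  -- its square root normalizes the coefficients for Parseval's identity.
  let c₀ : ℝ := (l ^ n)⁻¹
  have hc₀ : 0 < c₀ := by positivity
  let F : (Fin n → ℤ) → L2 D →L[ℂ] ℂ := fun k => ((√c₀ : ℝ) : ℂ) •
    ((ContinuousLinearMap.mul ℂ ℂ).lpPairing (domainMeasure D) 2 2).flip ((hw (κ k)).toLp _)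
  have hF : ∀ k f, F k f = ((√c₀ : ℝ) : ℂ) * ∫ x in D, f x * planeWave (κ k) x := by
    intro k f
    have : F k f = ((√c₀ : ℝ) : ℂ) * (ContinuousLinearMap.mul ℂ ℂ).lpPairing (domainMeasure D) 2 2 f
      ((hw (κ k)).toLp _) := rfl
    rw [this, ContinuousLinearMap.lpPairing_eq_integral]
    congr 1
    refine integral_congr_ae ?_
    filter_upwards [(hw (κ k)).coeFn_toLp] with x hx
    simp [hx]
  refine ⟨κ, F, _, finite_setOf_norm_lattice_le hl, hF, fun f => ?_⟩
  have hmap := map_torusChart_restrict hDm hl hDl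
  have hint : ∀ {E : Type} [NormedAddCommGroup E] [NormedSpace ℝ E] (h : 𝔼 → E),
      AEStronglyMeasurable h (domainMeasure D) →
      ∫ t : UnitAddTorus (Fin n), (torusChart n l ⁻¹' D).indicator (h ∘ torusChart n l) t =
        c₀ • ∫ x in D, h x := by
    intro E _ _ h hh
    rw [integral_indicator (measurable_torusChart l hDm)]
    have h1 := hmap
    rw [Measure.restrict_map (measurable_torusChart l) hDm] at h1
    have h2 : AEStronglyMeasurable h
        (((volume : Measure (UnitAddTorus (Fin n))).restrict (torusChart n l ⁻¹' D)).map
          (torusChart n l)) := by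
      rw [h1]
      exact hh.smul_measure _
    have h3 := integral_map (measurable_torusChart l).aemeasurable h2
    rw [h1, integral_smul_measure, ENNReal.toReal_ofReal hc₀.le] at h3
    exact h3.symm
  -- The function is extended by zero from `D` to the torus.
  have hG : MemLp ((torusChart n l ⁻¹' D).indicator (f ∘ torusChart n l)) 2
      (volume : Measure (UnitAddTorus (Fin n))) := by
    have h1 : MemLp (D.indicator f) 2 (volume.map (torusChart n l)) := by
      rw [memLp_indicator_iff_restrict hDm, hmap]
      exact (Lp.memLp f).smul_measure ENNReal.ofReal_ne_top
    exact h1.comp_of_map (measurable_torusChart l).aemeasurable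
  have hs := UnitAddTorus.hasSum_sq_mFourierCoeff (hG.toLp _)
  have hcoef : ∀ k, UnitAddTorus.mFourierCoeff (hG.toLp _) k =
      c₀ * ∫ x in D, f x * planeWave (κ k) x := by
    intro k
    rw [UnitAddTorus.mFourierCoeff]
    have h1 := hint (fun x => f x * planeWave (κ k) x)
      ((Lp.aestronglyMeasurable f).mul (hw (κ k)).aestronglyMeasurable)
    rw [Complex.real_smul] at h1
    rw [← h1]
    refine integral_congr_ae ?_
    filter_upwards [hG.coeFn_toLp] with t ht
    rw [ht, mFourier_neg_eq_planeWave hl]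
    by_cases htD : t ∈ torusChart n l ⁻¹' D
    · simp [htD, indicator_of_mem, mul_comm, κ]
    · simp [htD, indicator_of_notMem]
  have hnorm : ∫ t, ‖(hG.toLp _ : UnitAddTorus (Fin n) → ℂ) t‖ ^ 2 = c₀ * ‖f‖ ^ 2 := by
    have h1 := hint (fun x => ‖f x‖ ^ 2) ((Lp.aestronglyMeasurable f).norm.pow 2)
    have h2 : ‖f‖ ^ 2 = ∫ x in D, ‖f x‖ ^ 2 := by
      rw [← inner_self_eq_norm_sq (𝕜 := ℂ), L2.inner_def, ← integral_re (L2.integrable_inner f f)]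
      simp only [inner_self_eq_norm_sq]
    rw [h2, ← smul_eq_mul, ← h1]
    refine integral_congr_ae ?_
    filter_upwards [hG.coeFn_toLp] with t ht
    rw [ht]
    by_cases htD : t ∈ torusChart n l ⁻¹' D
    · simp [htD, indicator_of_mem]
    · simp [htD, indicator_of_notMem]
  rw [hnorm] at hs
  have hs' := hs.mul_left c₀⁻¹
  rw [inv_mul_cancel_left₀ hc₀.ne'] at hs'
  have he : (fun k => ‖F k f‖ ^ 2) = fun k =>
      c₀⁻¹ * ‖UnitAddTorus.mFourierCoeff (hG.toLp _ : UnitAddTorus (Fin n) → ℂ) k‖ ^ 2 := by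
    funext k
    rw [hF, hcoef, norm_mul, norm_mul, mul_pow, mul_pow, Complex.norm_real, Complex.norm_real,
    Real.norm_of_nonneg hc₀.le, Real.norm_of_nonneg (Real.sqrt_nonneg _), Real.sq_sqrt hc₀.le]
    field_simp
  rw [he]
  exact hs'

end Fourier

/-! ### Comparison and compactness through coefficients -/

section Minkowski

/-- Minkowski's inequality in `ℓ²` for a finite family of majorants. -/
theorem le_sum_of_hasSum_sq {K J : Type*} (s : Finset J) {a : K → ℝ} {b : J → K → ℝ} {A : ℝ}
    {B : J → ℝ} (ha : ∀ k, 0 ≤ a k) (hb : ∀ j k, 0 ≤ b j k) (hB : ∀ j, 0 ≤ B j)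
    (hA : HasSum (fun k => a k ^ 2) (A ^ 2))
    (hBs : ∀ j ∈ s, HasSum (fun k => b j k ^ 2) (B j ^ 2)) (h : ∀ k, a k ≤ ∑ j ∈ s, b j k) :
    A ≤ ∑ j ∈ s, B j := by
  classical
  have key : ∃ C, 0 ≤ C ∧ C ≤ ∑ j ∈ s, B j ∧
      HasSum (fun k => (∑ j ∈ s, b j k) ^ 2) (C ^ 2) := by
    clear h
    induction s using Finset.induction_on with
    | empty => exact ⟨0, le_rfl, by simp, by simp⟩
    | insert j s hj ih =>
      obtain ⟨C, hC0, hC1, hC2⟩ := ih fun i hi => hBs i (Finset.mem_insert_of_mem hi)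
      have h1 := hBs j (Finset.mem_insert_self j s)
      simp only [← Real.rpow_two] at h1 hC2
      obtain ⟨C', h2, h3, h4⟩ := Real.Lp_add_le_hasSum_of_nonneg one_le_two (hb j)
        (fun k => Finset.sum_nonneg fun i _ => hb i k) (hB j) hC0 h1 hC2
      refine ⟨C', h2, ?_, ?_⟩
      · rw [Finset.sum_insert hj]
        linarith
      · simp only [Finset.sum_insert hj, ← Real.rpow_two]
        exact h4
  obtain ⟨C, hC0, hC1, hC2⟩ := key
  have h1 : A ^ 2 ≤ C ^ 2 := hasSum_le (fun k => pow_le_pow_left₀ (ha k) (h k) 2) hA hC2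
  exact (abs_le_of_sq_le_sq' h1 hC0).2.trans hC1

variable {K H : Type*} [NormedAddCommGroup H] [NormedSpace ℂ H] {F : K → H →L[ℂ] ℂ}

/-- Comparison of norms through coefficients satisfying Parseval's identity. -/
theorem norm_le_sum_of_coefficients (hF : ∀ f, HasSum (fun k => ‖F k f‖ ^ 2) (‖f‖ ^ 2))
    {J : Type*} (s : Finset J) (c : J → ℝ) (hc : ∀ j, 0 ≤ c j) (x : H) (y : J → H)
    (h : ∀ k, ‖F k x‖ ≤ ∑ j ∈ s, c j * ‖F k (y j)‖) : ‖x‖ ≤ ∑ j ∈ s, c j * ‖y j‖ := by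
  refine le_sum_of_hasSum_sq s (fun k => norm_nonneg (F k x)) (b := fun j k => c j * ‖F k (y j)‖)
    (fun j k => mul_nonneg (hc j) (norm_nonneg _)) (fun j => mul_nonneg (hc j) (norm_nonneg _))
    (hF x) (fun j _ => ?_) h
  simp only [mul_pow]
  exact (hF (y j)).mul_left _

/-- Rellich's criterion: an operator gaining a factor that tends to infinity in its coefficients is
compact. -/
theorem isCompactOperator_of_coefficients [CompleteSpace H]
    (hF : ∀ f, HasSum (fun k => ‖F k f‖ ^ 2) (‖f‖ ^ 2))
    {ρ : K → ℝ} (hρ : ∀ r : ℝ, {k | ρ k ≤ r}.Finite)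
    {E J : Type*} [NormedAddCommGroup E] [NormedSpace ℂ E] (s : Finset J) (c : J → ℝ)
    (hc : ∀ j, 0 ≤ c j) (V : E →L[ℂ] H)
    (W : J → E →L[ℂ] H) (h : ∀ x k, ρ k * ‖F k (V x)‖ ≤ ∑ j ∈ s, c j * ‖F k (W j x)‖) :
    IsCompactOperator V := by
  classical
  refine isCompactOperator_of_exists_finite_cover fun ε hε => ?_
  let M : ℝ := ∑ j ∈ s, c j * ‖W j‖
  have hM : 0 ≤ M := Finset.sum_nonneg fun j _ => mul_nonneg (hc j) (norm_nonneg _)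
  let r : ℝ := (M + 1) / ε
  have hr : 0 < r := by positivity
  let t : Finset K := (hρ r).toFinset
  let C : E →L[ℂ] EuclideanSpace ℂ t :=
    (EuclideanSpace.equiv t ℂ).symm.toContinuousLinearMap ∘L
      ContinuousLinearMap.pi fun k : t => F k ∘L V
  have hCc : IsCompactOperator C := isCompactOperator_of_locallyCompactSpace_dom C
  refine exists_finite_cover_of_norm_le hCc hε fun x => ?_
  have hCx : ‖C x‖ ^ 2 = ∑ k ∈ t, ‖F k (V x)‖ ^ 2 := by
    rw [EuclideanSpace.norm_sq_eq, ← Finset.sum_coe_sort t]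
    rfl
  -- The finitely many indices with `ρ k ≤ r` form the finite-rank part `C`, indexed by `none`; the
  -- others gain a factor `r⁻¹`, and `r` is chosen so that they contribute at most `ε ‖x‖`.
  have h1 := le_sum_of_hasSum_sq (Finset.insertNone s) (a := fun k => ‖F k (V x)‖) (A := ‖V x‖)
    (b := fun j k => j.elim (if k ∈ t then ‖F k (V x)‖ else 0)
      fun j => r⁻¹ * (c j * ‖F k (W j x)‖))
    (B := fun j => j.elim ‖C x‖ fun j => r⁻¹ * (c j * ‖W j x‖))
    (fun k => norm_nonneg _) ?_ ?_ (hF _) ?_ ?_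
  · rw [Finset.sum_insertNone] at h1
    simp only [Option.elim] at h1
    refine h1.trans ?_
    gcongr
    rw [← Finset.mul_sum]
    have h2 : ∑ j ∈ s, c j * ‖W j x‖ ≤ M * ‖x‖ := by
      rw [Finset.sum_mul]
      refine Finset.sum_le_sum fun j _ => ?_
      rw [mul_assoc]
      exact mul_le_mul_of_nonneg_left ((W j).le_opNorm x) (hc j)
    calc r⁻¹ * ∑ j ∈ s, c j * ‖W j x‖ ≤ r⁻¹ * ((M + 1) * ‖x‖) := by
          gcongr
          nlinarith [norm_nonneg x]
      _ = ε * ‖x‖ := by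
        simp only [r]
        field_simp
  · rintro (_ | j) k
    · simp only [Option.elim]
      split_ifs <;> positivity
    · have := hc j
      simp only [Option.elim]
      positivity
  · rintro (_ | j)
    · exact norm_nonneg _
    · have := hc j
      simp only [Option.elim]
      positivity
  · rintro (_ | j) _
    · simp only [Option.elim]
      rw [hCx]
      have : (fun k => (if k ∈ t then ‖F k (V x)‖ else 0) ^ 2) =
          fun k => if k ∈ t then ‖F k (V x)‖ ^ 2 else 0 := by
        funext k
        split_ifs <;> simp
      rw [this]
      have h3 := hasSum_sum_of_ne_finset_zero (L := SummationFilter.unconditional K)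
        (f := fun k => if k ∈ t then ‖F k (V x)‖ ^ 2 else 0)
        (s := t) (fun k hk => if_neg hk)
      rwa [Finset.sum_congr rfl fun k hk => if_pos hk] at h3
    · simp only [Option.elim, mul_pow]
      exact ((hF _).mul_left _).mul_left _
  · intro k
    rw [Finset.sum_insertNone]
    simp only [Option.elim]
    have h2 : 0 ≤ ∑ j ∈ s, r⁻¹ * (c j * ‖F k (W j x)‖) := Finset.sum_nonneg fun j _ => by
      have := hc j
      positivity
    split_ifs with hk
    · linarith
    · have hk' : r < ρ k := by
        by_contra hcon
        exact hk ((hρ r).mem_toFinset.mpr (not_lt.mp hcon))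
      rw [zero_add, ← Finset.mul_sum]
      have h3 := h x k
      rw [inv_mul_eq_div, le_div_iff₀ hr]
      nlinarith [norm_nonneg (F k (V x))]

end Minkowski

/-! ### Test functions and the adjointness of the two Laplacians -/

section TestFunctions

variable {n : ℕ} {D : Set (EuclideanSpace ℝ (Fin n))}

local notation "𝔼" => EuclideanSpace ℝ (Fin n)

theorem mulBy_coeFn (m : LInf D) (f : L2 D) :
    mulBy m f =ᵐ[domainMeasure D] fun x => m x * f x :=
  ContinuousLinearMap.coeFn_holder _ m f

theorem norm_mulBy_sub_le (p m : LInf D) : ‖mulBy p - mulBy m‖ ≤ ‖p - m‖ := by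
  have h1 : mulBy p - mulBy m =
      (ContinuousLinearMap.mul ℂ ℂ).holderL (domainMeasure D) ∞ 2 2 (p - m) := by
    rw [map_sub]; rfl
  rw [h1]
  refine (ContinuousLinearMap.le_opNorm _ _).trans ?_
  have h2 : ‖(ContinuousLinearMap.mul ℂ ℂ).holderL (domainMeasure D) ∞ 2 2‖ ≤ 1 :=
    (ContinuousLinearMap.norm_holderL_le _).trans (ContinuousLinearMap.opNorm_mul_le ℂ ℂ)
  nlinarith [norm_nonneg (p - m)]

theorem inner_eq_integral (f g : L2 D) :
    inner ℂ f g = ∫ x in D, g x * (starRingEnd ℂ) (f x) := by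
  rw [L2.inner_def]
  rfl

theorem IsTest.fderiv_apply {φ : 𝔼 → ℂ} (h : IsTest D φ) (b : 𝔼) :
    IsTest D fun x => fderiv ℝ φ x b := by
  have h1 : ContDiff ℝ ∞ (fderiv ℝ φ) := h.1.fderiv_right (m := ∞) (by simp)
  refine ⟨h1.clm_apply contDiff_const, ?_, ?_⟩
  · exact (h.2.1.fderiv (𝕜 := ℝ)).comp_left (g := fun L : 𝔼 →L[ℝ] ℂ => L b) (by simp)
  · refine (closure_mono fun x hx => ?_).trans ((tsupport_fderiv_subset ℝ (f := φ)).trans h.2.2)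
    rw [Function.mem_support] at hx ⊢
    intro h0
    exact hx (by rw [h0]; rfl)

theorem IsTest.laplacian {φ : 𝔼 → ℂ} (h : IsTest D φ) : IsTest D (Δ φ) := by
  refine ⟨?_, h.laplacian_hasCompactSupport, (closure_minimal (fun x hx => ?_)
    (isClosed_tsupport φ)).trans h.2.2⟩
  · have h2 : ContDiff ℝ 2 φ := by exact_mod_cast contDiff_infty.mp h.1 2
    rw [funext (laplacian_eq_sum_fderiv h2)]
    refine ContDiff.sum fun i _ => ?_
    exact ((h.fderiv_apply _).fderiv_apply _).1
  · by_contra hx'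
    have h0 : φ =ᶠ[nhds x] fun _ => (0 : ℂ) := notMem_tsupport_iff_eventuallyEq.mp hx'
    have h1 := (InnerProductSpace.laplacian_congr_nhds h0).self_of_nhds
    rw [Function.mem_support, h1] at hx
    simp at hx

theorem IsTest.mul_contDiff {φ w : 𝔼 → ℂ} (h : IsTest D φ) (hw : ContDiff ℝ ∞ w) :
    IsTest D fun x => φ x * w x :=
  ⟨h.1.mul hw, h.2.1.mul_right, (tsupport_mul_subset_left (f := φ) (g := w)).trans h.2.2⟩

theorem IsTest.conj {φ : 𝔼 → ℂ} (h : IsTest D φ) :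
    IsTest D fun x => (starRingEnd ℂ) (φ x) := by
  refine ⟨Complex.conjCLE.contDiff.comp h.1, h.2.1.comp_left (map_zero _), ?_⟩
  refine (closure_mono fun x hx => ?_).trans h.2.2
  rw [Function.mem_support] at hx ⊢
  intro h0
  exact hx (by rw [h0, map_zero])

theorem laplacian_conj {φ : 𝔼 → ℂ} (x : 𝔼) :
    Δ (fun x => (starRingEnd ℂ) (φ x)) x = (starRingEnd ℂ) (Δ φ x) :=
  congrFun (InnerProductSpace.laplacian_CLE_comp_left (l := Complex.conjCLE) (f := φ)) x

/-- Smooth cutoff functions. -/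
theorem exists_cutoff (hDo : IsOpen D) {K : Set 𝔼} (hK : IsCompact K) (hKD : K ⊆ D) :
    ∃ χ : 𝔼 → ℝ, IsTest D (fun x => (χ x : ℂ)) ∧ ∀ᶠ x in nhdsSet K, χ x = 1 := by
  obtain ⟨L, hL, hKL, hLD⟩ := exists_compact_between hK hDo hKD
  obtain ⟨f, hf1, hf0, -⟩ := exists_contMDiffMap_one_nhds_of_subset_interior
    (modelWithCornersSelf ℝ 𝔼) (n := (⊤ : ℕ∞)) hK.isClosed hKL
  have hsupp : tsupport (fun x => ((f x : ℝ) : ℂ)) ⊆ L := by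
    refine closure_minimal (fun x hx => ?_) hL.isClosed
    by_contra hxL
    exact hx (by simp [hf0 x hxL])
  exact ⟨f, ⟨Complex.ofRealCLM.contDiff.comp f.contMDiff.contDiff,
    hL.of_isClosed_subset (isClosed_tsupport _) hsupp, hsupp.trans hLD⟩, hf1⟩

/-- Multiplication by a test function on `L²(D)`. -/
def IsTest.mulOp {χ : 𝔼 → ℂ} (h : IsTest D χ) : L2 D →L[ℂ] L2 D :=
  mulBy ((h.memLp ∞).toLp χ)

theorem IsTest.mulOp_coeFn {χ : 𝔼 → ℂ} (h : IsTest D χ) (f : L2 D) :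
    h.mulOp f =ᵐ[domainMeasure D] fun x => χ x * f x := by
  filter_upwards [mulBy_coeFn ((h.memLp ∞).toLp χ) f, (h.memLp ∞).coeFn_toLp] with x h1 h2
  rw [IsTest.mulOp, h1, h2]

theorem testLaplacianGraph_induction {S : Submodule ℂ (L2 D × L2 D)}
    (hS : IsClosed (S : Set (L2 D × L2 D)))
    (h : ∀ φ, ∀ hφ : IsTest D φ, ((hφ.memLp 2).toLp φ, (hφ.laplacian_memLp 2).toLp (Δ φ)) ∈ S) :
    testLaplacianGraph D ≤ S := by
  refine Submodule.topologicalClosure_minimal _ ?_ hS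
  rw [Submodule.span_le]
  rintro w ⟨φ, hφ, h1, h2⟩
  have e1 : w.1 = (hφ.memLp 2).toLp φ := Lp.ext (h1.trans (hφ.memLp 2).coeFn_toLp.symm)
  have e2 : w.2 = (hφ.laplacian_memLp 2).toLp (Δ φ) :=
    Lp.ext (h2.trans (hφ.laplacian_memLp 2).coeFn_toLp.symm)
  have e : w = ((hφ.memLp 2).toLp φ, (hφ.laplacian_memLp 2).toLp (Δ φ)) := Prod.ext e1 e2
  rw [e]
  exact h φ hφ

theorem mem_testLaplacianGraph {φ : 𝔼 → ℂ} (hφ : IsTest D φ) :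
    ((hφ.memLp 2).toLp φ, (hφ.laplacian_memLp 2).toLp (Δ φ)) ∈ testLaplacianGraph D :=
  Submodule.le_topologicalClosure _ (Submodule.subset_span
    ⟨φ, hφ, (hφ.memLp 2).coeFn_toLp, (hφ.laplacian_memLp 2).coeFn_toLp⟩)

theorem inner_toLp {ψ : 𝔼 → ℂ} (hψ : MemLp ψ 2 (domainMeasure D)) (v : L2 D) :
    inner ℂ (hψ.toLp ψ) v = ∫ x in D, v x * (starRingEnd ℂ) (ψ x) := by
  rw [inner_eq_integral]
  refine integral_congr_ae ?_
  filter_upwards [hψ.coeFn_toLp] with x hx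
  rw [hx]

/-- The distributional definition is bilinear and the inner product sesquilinear; test functions are
closed under conjugation, which links the two. Density of test functions in the small graph does the
rest. -/
theorem mem_weakLaplacianGraph_iff (w : L2 D × L2 D) : w ∈ weakLaplacianGraph D ↔
    ∀ u ∈ testLaplacianGraph D, inner ℂ w.1 u.2 = inner ℂ w.2 u.1 := by
  have key : w ∈ weakLaplacianGraph D ↔ ∀ φ, ∀ hφ : IsTest D φ,
      inner ℂ w.1 ((hφ.laplacian_memLp 2).toLp (Δ φ)) = inner ℂ w.2 ((hφ.memLp 2).toLp φ) := by
    have e : ∀ φ, ∀ hφ : IsTest D φ, (inner ℂ w.1 ((hφ.laplacian_memLp 2).toLp (Δ φ)) =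
        inner ℂ w.2 ((hφ.memLp 2).toLp φ) ↔
        ∫ x in D, w.1 x * Δ (fun x => (starRingEnd ℂ) (φ x)) x =
          ∫ x in D, w.2 x * (starRingEnd ℂ) (φ x)) := by
      intro φ hφ
      rw [← inner_conj_symm (𝕜 := ℂ) w.1, ← inner_conj_symm (𝕜 := ℂ) w.2,
        (starRingEnd ℂ).injective.eq_iff, inner_toLp, inner_toLp]
      simp only [laplacian_conj]
    constructor
    · intro hw φ hφ
      exact (e φ hφ).mpr (hw _ hφ.conj)
    · intro hw φ hφ
      have h1 := (e _ hφ.conj).mp (hw _ hφ.conj)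
      simpa only [Complex.conj_conj] using h1
  rw [key]
  constructor
  · intro h
    let S : Submodule ℂ (L2 D × L2 D) := LinearMap.ker
      (innerSL ℂ w.1 ∘L ContinuousLinearMap.snd ℂ (L2 D) (L2 D) -
        innerSL ℂ w.2 ∘L ContinuousLinearMap.fst ℂ (L2 D) (L2 D)).toLinearMap
    have hS : testLaplacianGraph D ≤ S :=
      testLaplacianGraph_induction (ContinuousLinearMap.isClosed_ker _) fun φ hφ => by
        change _ - _ = (0 : ℂ)
        exact sub_eq_zero.mpr (h φ hφ)
    intro u hu
    exact sub_eq_zero.mp (hS hu)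
  · intro h φ hφ
    exact h _ (mem_testLaplacianGraph hφ)

/-- The closed graph equals its double orthogonal complement, and the rotation `(a, b) ↦ (b, -a)`
sends its orthogonal complement into the weak graph. -/
theorem mem_testLaplacianGraph_iff (u : L2 D × L2 D) : u ∈ testLaplacianGraph D ↔
    ∀ w ∈ weakLaplacianGraph D, inner ℂ w.1 u.2 = inner ℂ w.2 u.1 := by
  refine ⟨fun hu w hw => (mem_weakLaplacianGraph_iff w).mp hw u hu, fun hu => ?_⟩
  let e := WithLp.prodContinuousLinearEquiv 2 ℂ (L2 D) (L2 D)
  let G : Submodule ℂ (L2Sum D) := (testLaplacianGraph D).comap e.toLinearMap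
  have hG : IsClosed (G : Set (L2Sum D)) :=
    (Submodule.isClosed_topologicalClosure _).preimage e.continuous
  have hGc : CompleteSpace G := hG.completeSpace_coe
  have h1 : WithLp.toLp 2 u ∈ Gᗮᗮ := by
    refine (Submodule.mem_orthogonal _ _).mpr fun p hp => ?_
    have hp' : ((p.snd, -p.fst) : L2 D × L2 D) ∈ weakLaplacianGraph D := by
      refine (mem_weakLaplacianGraph_iff _).mpr fun q hq => ?_
      have h2 : inner ℂ p (WithLp.toLp 2 q) = 0 :=
        (Submodule.mem_orthogonal' _ p).mp hp _ hq
      rw [WithLp.prod_inner_apply] at h2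
      rw [inner_neg_left]
      exact eq_neg_of_add_eq_zero_right h2
    have h2 := hu _ hp'
    rw [WithLp.prod_inner_apply]
    rw [inner_neg_left] at h2
    exact (add_comm _ _).trans (eq_neg_iff_add_eq_zero.mp h2)
  rw [Submodule.orthogonal_orthogonal] at h1
  exact h1

end TestFunctions

/-! ### Interior estimates and compactness -/

section FourierOnDomain

variable {n : ℕ} {D : Set (EuclideanSpace ℝ (Fin n))}

local notation "𝔼" => EuclideanSpace ℝ (Fin n)

/-- Fourier coefficients on `L²(D)` satisfying Parseval's identity, with frequencies tending to
infinity. -/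
structure FourierSystem (D : Set (EuclideanSpace ℝ (Fin n))) where
  freq : (Fin n → ℤ) → EuclideanSpace ℝ (Fin n)
  coeff : (Fin n → ℤ) → L2 D →L[ℂ] ℂ
  scale : ℂ
  finite_setOf_norm_freq_le : ∀ r : ℝ, {k | ‖freq k‖ ≤ r}.Finite
  coeff_apply : ∀ k f, coeff k f = scale * ∫ x in D, f x * planeWave (freq k) x
  parseval : ∀ f, HasSum (fun k => ‖coeff k f‖ ^ 2) (‖f‖ ^ 2)

theorem nonempty_fourierSystem (hDo : IsOpen D) (hDb : Bornology.IsBounded D) :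
    Nonempty (FourierSystem D) := by
  obtain ⟨κ, F, c, h1, h2, h3⟩ := exists_fourier_coefficients hDo hDb
  exact ⟨⟨κ, F, c, h1, h2, h3⟩⟩

namespace FourierSystem

theorem coeff_mulOp (S : FourierSystem D) {χ : 𝔼 → ℂ} (h : IsTest D χ) (k : Fin n → ℤ)
    (f : L2 D) :
    S.coeff k (h.mulOp f) = S.scale * ∫ x in D, f x * (χ x * planeWave (S.freq k) x) := by
  rw [S.coeff_apply]
  congr 1
  refine integral_congr_ae ?_
  filter_upwards [h.mulOp_coeFn f] with x hx
  rw [hx]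
  ring

/-- The partial derivative of a test function in the direction of a basis vector. -/
theorem _root_.InteriorTransmission.IsTest.partial {χ : 𝔼 → ℂ} (h : IsTest D χ) (i : Fin n) :
    IsTest D fun x => fderiv ℝ χ x (EuclideanSpace.basisFun (Fin n) ℝ i) :=
  h.fderiv_apply _

/-- The weak equation is tested with `χ` times a plane wave. The commutator terms have at most one
power of the frequency, against two in the main term. -/
theorem coeff_mulOp_snd (S : FourierSystem D) {χ : 𝔼 → ℂ} (h : IsTest D χ) {w : L2 D × L2 D}
    (hw : w ∈ weakLaplacianGraph D) (k : Fin n → ℤ) :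
    S.coeff k (h.mulOp w.2) = S.coeff k (h.laplacian.mulOp w.1) -
      2 * Complex.I * ∑ i, (S.freq k i : ℂ) * S.coeff k ((h.partial i).mulOp w.1) -
      (‖S.freq k‖ ^ 2 : ℝ) * S.coeff k (h.mulOp w.1) := by
  simp only [coeff_mulOp]
  have hw' := hw _ (h.mul_contDiff (contDiff_planeWave (S.freq k)))
  have h2 : ContDiff ℝ 2 χ := by exact_mod_cast contDiff_infty.mp h.1 2
  simp only [laplacian_mul_planeWave h2] at hw'
  rw [← hw']
  set e := planeWave (S.freq k) with he
  have hec : ContDiff ℝ ∞ e := contDiff_planeWave _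
  have hi : ∀ {ψ : 𝔼 → ℂ}, IsTest D ψ →
      Integrable (fun x => w.1 x * (ψ x * e x)) (domainMeasure D) := fun hψ =>
    integrable_mul_of_memLp w.1 ((hψ.mul_contDiff hec).memLp 2)
  have e1 : (fun x => w.1 x * ((Δ χ x - 2 * Complex.I * ∑ i, (S.freq k i : ℂ) *
      fderiv ℝ χ x (EuclideanSpace.basisFun (Fin n) ℝ i) -
      ((‖S.freq k‖ ^ 2 : ℝ) : ℂ) * χ x) * e x)) =
      fun x => w.1 x * (Δ χ x * e x) - 2 * Complex.I * ∑ i, (S.freq k i : ℂ) *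
        (w.1 x * (fderiv ℝ χ x (EuclideanSpace.basisFun (Fin n) ℝ i) * e x)) -
        ((‖S.freq k‖ ^ 2 : ℝ) : ℂ) * (w.1 x * (χ x * e x)) := by
    funext x
    have e2 : ∑ i, (S.freq k i : ℂ) *
        (w.1 x * (fderiv ℝ χ x (EuclideanSpace.basisFun (Fin n) ℝ i) * e x)) =
        w.1 x * e x * ∑ i, (S.freq k i : ℂ) *
          fderiv ℝ χ x (EuclideanSpace.basisFun (Fin n) ℝ i) := by
      rw [Finset.mul_sum]
      exact Finset.sum_congr rfl fun i _ => by ring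
    rw [e2]
    ring
  have hsum : Integrable (fun x => 2 * Complex.I * ∑ i, (S.freq k i : ℂ) *
        (w.1 x * (fderiv ℝ χ x (EuclideanSpace.basisFun (Fin n) ℝ i) * e x)))
        (domainMeasure D) :=
    (integrable_finsetSum _ fun i _ => (hi (h.partial i)).const_mul _).const_mul _
  rw [e1, integral_sub (f := fun x => _ - _) ((hi h.laplacian).sub hsum) ((hi h).const_mul _),
    integral_sub (hi h.laplacian) hsum, integral_const_mul, integral_const_mul,
    integral_finsetSum _ fun i _ => (hi (h.partial i)).const_mul _]
  simp only [integral_const_mul]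
  rw [mul_sub, mul_sub]
  refine congrArg₂ (· - ·) (congrArg₂ (· - ·) rfl ?_) ?_
  · rw [Finset.mul_sum, Finset.mul_sum, Finset.mul_sum]
    exact Finset.sum_congr rfl fun i _ => by ring
  · ring

/-- Plane waves are not test functions, so for a test function `φ` a cutoff equal to `1` near its
support is inserted; its derivatives vanish there and the commutator terms drop out. Density extends
the formula to the closure. -/
theorem coeff_snd (S : FourierSystem D) {u : L2 D × L2 D} (hDo : IsOpen D)
    (hu : u ∈ testLaplacianGraph D)
    (k : Fin n → ℤ) : S.coeff k u.2 = -((‖S.freq k‖ ^ 2 : ℝ) : ℂ) * S.coeff k u.1 := by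
  let T : L2 D × L2 D →L[ℂ] ℂ := S.coeff k ∘L ContinuousLinearMap.snd ℂ (L2 D) (L2 D) +
    ((‖S.freq k‖ ^ 2 : ℝ) : ℂ) • (S.coeff k ∘L ContinuousLinearMap.fst ℂ (L2 D) (L2 D))
  have hT : testLaplacianGraph D ≤ LinearMap.ker T.toLinearMap := by
    refine testLaplacianGraph_induction (ContinuousLinearMap.isClosed_ker T) fun φ hφ => ?_
    obtain ⟨χ, hχ, hχ1⟩ := exists_cutoff hDo hφ.2.1 hφ.2.2
    have hnear : ∀ x ∈ tsupport φ, (fun y => (χ y : ℂ)) =ᶠ[nhds x] fun _ => 1 := fun x hx => by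
      filter_upwards [hχ1.filter_mono (nhds_le_nhdsSet hx)] with y hy
      rw [hy, Complex.ofReal_one]
    have hloc := S.coeff_mulOp_snd hχ (testLaplacianGraph_le (mem_testLaplacianGraph hφ)) k
    have e1 : hχ.mulOp ((hφ.memLp 2).toLp φ) = (hφ.memLp 2).toLp φ := by
      refine Lp.ext ?_
      filter_upwards [hχ.mulOp_coeFn ((hφ.memLp 2).toLp φ), (hφ.memLp 2).coeFn_toLp] with x h1 h2
      rw [h1, h2]
      by_cases hx : x ∈ tsupport φ
      · rw [show (χ x : ℂ) = 1 from (hnear x hx).self_of_nhds, one_mul]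
      · rw [image_eq_zero_of_notMem_tsupport hx, mul_zero]
    have e2 : hχ.mulOp ((hφ.laplacian_memLp 2).toLp (Δ φ)) =
        (hφ.laplacian_memLp 2).toLp (Δ φ) := by
      refine Lp.ext ?_
      filter_upwards [hχ.mulOp_coeFn ((hφ.laplacian_memLp 2).toLp (Δ φ)),
        (hφ.laplacian_memLp 2).coeFn_toLp] with x h1 h2
      rw [h1, h2]
      by_cases hx : x ∈ tsupport φ
      · rw [show (χ x : ℂ) = 1 from (hnear x hx).self_of_nhds, one_mul]
      · have h0 : φ =ᶠ[nhds x] fun _ => (0 : ℂ) := notMem_tsupport_iff_eventuallyEq.mp hx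
        rw [(InnerProductSpace.laplacian_congr_nhds h0).self_of_nhds]
        simp
    have hz : ∀ {ψ : 𝔼 → ℂ} (hψ : IsTest D ψ), (∀ x ∈ tsupport φ, ψ x = 0) →
        hψ.mulOp ((hφ.memLp 2).toLp φ) = 0 := by
      intro ψ hψ h0
      refine Lp.ext ?_
      filter_upwards [hψ.mulOp_coeFn ((hφ.memLp 2).toLp φ), (hφ.memLp 2).coeFn_toLp,
        Lp.coeFn_zero ℂ 2 (domainMeasure D)] with x h1 h2 h3
      rw [h1, h2, h3]
      by_cases hx : x ∈ tsupport φ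
      · rw [h0 x hx, zero_mul]; rfl
      · rw [image_eq_zero_of_notMem_tsupport hx, mul_zero]; rfl
    have e3 : hχ.laplacian.mulOp ((hφ.memLp 2).toLp φ) = 0 := hz _ fun x hx => by
      rw [(InnerProductSpace.laplacian_congr_nhds (hnear x hx)).self_of_nhds]
      simp
    have e4 : ∀ i, (hχ.partial i).mulOp ((hφ.memLp 2).toLp φ) = 0 := fun i => hz _ fun x hx => by
      rw [(hnear x hx).fderiv_eq]
      simp
    dsimp only at hloc
    rw [e1, e2, e3] at hloc
    simp only [e4, map_zero, mul_zero, Finset.sum_const_zero, sub_zero, zero_sub] at hloc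
    change S.coeff k ((hφ.laplacian_memLp 2).toLp (Δ φ)) +
      ((‖S.freq k‖ ^ 2 : ℝ) : ℂ) * S.coeff k ((hφ.memLp 2).toLp φ) = 0
    rw [hloc]
    ring
  have h1 : S.coeff k u.2 + ((‖S.freq k‖ ^ 2 : ℝ) : ℂ) * S.coeff k u.1 = 0 := hT hu
  linear_combination h1

/-- Elements of `H²₀(D)` together with their Laplacians depend compactly on parameters. -/
theorem isCompactOperator_of_mem_testLaplacianGraph (S : FourierSystem D) (hDo : IsOpen D)
    {E : Type*}
    [NormedAddCommGroup E] [NormedSpace ℂ E] (U dU : E →L[ℂ] L2 D)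
    (h : ∀ x, (U x, dU x) ∈ testLaplacianGraph D) : IsCompactOperator U := by
  refine isCompactOperator_of_coefficients S.parseval S.finite_setOf_norm_freq_le
    (Finset.univ : Finset (Fin 2)) (fun _ => 1) (fun _ => zero_le_one) U ![U, dU] fun x k => ?_
  have h1 := congrArg norm (S.coeff_snd hDo (h x) k)
  rw [norm_mul, norm_neg, Complex.norm_real, Real.norm_of_nonneg (sq_nonneg _)] at h1
  simp only [Fin.sum_univ_two, one_mul, Matrix.cons_val_zero, Matrix.cons_val_one]
  dsimp only at h1
  rw [h1]
  -- The two majorants together carry the weight `1 + ‖κ‖²`; a gain of one power of the frequency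
  -- suffices.
  have h2 : ‖S.freq k‖ ≤ 1 + ‖S.freq k‖ ^ 2 := by nlinarith [sq_nonneg (‖S.freq k‖ - 1)]
  nlinarith [norm_nonneg (S.coeff k (U x))]

theorem norm_sum_freq_le (S : FourierSystem D) {χ : 𝔼 → ℂ} (h : IsTest D χ) (k : Fin n → ℤ)
    (v : L2 D) :
    ‖2 * Complex.I * ∑ i, (S.freq k i : ℂ) * S.coeff k ((h.partial i).mulOp v)‖ ≤
      2 * ‖S.freq k‖ * ∑ i, ‖S.coeff k ((h.partial i).mulOp v)‖ := by
  rw [norm_mul, norm_mul, Complex.norm_I, mul_one, Complex.norm_ofNat, mul_assoc]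
  gcongr
  refine (norm_sum_le _ _).trans ?_
  rw [Finset.mul_sum]
  refine Finset.sum_le_sum fun i _ => ?_
  rw [norm_mul, Complex.norm_real]
  gcongr
  exact PiLp.norm_apply_le _ i

/-- Interior regularity: localized solutions of `Δ v = g` depend compactly on parameters. -/
theorem isCompactOperator_mulOp_comp (S : FourierSystem D) {χ : 𝔼 → ℂ} (hχ : IsTest D χ)
    {E : Type*}
    [NormedAddCommGroup E] [NormedSpace ℂ E] (V dV : E →L[ℂ] L2 D)
    (h : ∀ x, (V x, dV x) ∈ weakLaplacianGraph D) : IsCompactOperator (hχ.mulOp ∘L V) := by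
  refine isCompactOperator_of_coefficients S.parseval S.finite_setOf_norm_freq_le
    (Finset.univ : Finset (Fin 3 ⊕ Fin n)) (Sum.elim (fun _ => 1) fun _ => 2)
    (by rintro (_ | _) <;> simp) (hχ.mulOp ∘L V)
    (Sum.elim ![hχ.mulOp ∘L V, hχ.mulOp ∘L dV, hχ.laplacian.mulOp ∘L V]
      fun i => (hχ.partial i).mulOp ∘L V) fun x k => ?_
  have h1 := S.coeff_mulOp_snd hχ (h x) k
  have h3 := S.norm_sum_freq_le hχ k (V x)
  rw [Fintype.sum_sum_type, Fin.sum_univ_three]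
  simp only [Sum.elim_inl, Sum.elim_inr, one_mul, Matrix.cons_val_zero, Matrix.cons_val_one,
    Matrix.cons_val_two, Matrix.tail_cons, Matrix.head_cons, ContinuousLinearMap.comp_apply,
    ← Finset.mul_sum]
  dsimp only at h1 h3
  set a := S.coeff k (hχ.mulOp (V x))
  set b := S.coeff k (hχ.mulOp (dV x))
  set d := S.coeff k (hχ.laplacian.mulOp (V x))
  set σ := ∑ i, ‖S.coeff k ((hχ.partial i).mulOp (V x))‖
  set τ := 2 * Complex.I * ∑ i, (S.freq k i : ℂ) * S.coeff k ((hχ.partial i).mulOp (V x))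
  set ρ := ‖S.freq k‖
  have hσ : 0 ≤ σ := Finset.sum_nonneg fun i _ => norm_nonneg _
  have hρ : 0 ≤ ρ := norm_nonneg _
  have h2 : ρ ^ 2 * ‖a‖ ≤ ‖b‖ + ‖d‖ + 2 * ρ * σ := by
    have e : ((ρ ^ 2 : ℝ) : ℂ) * a = d - τ - b := by linear_combination h1
    have e' := congrArg norm e
    rw [norm_mul, Complex.norm_real, Real.norm_of_nonneg (sq_nonneg _)] at e'
    rw [e']
    have := norm_sub_le (d - τ) b
    have := norm_sub_le d τ
    linarith
  have ha := norm_nonneg a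
  have hb := norm_nonneg b
  have hd := norm_nonneg d
  -- At low frequency the majorant `‖a‖` itself suffices; at high frequency one power of `ρ` is
  -- divided out.
  rcases le_total ρ 1 with h4 | h4
  · nlinarith
  · have h5 : ρ * (ρ * ‖a‖) ≤ ρ * (‖b‖ + ‖d‖ + 2 * σ) := by nlinarith
    have := le_of_mul_le_mul_left h5 (by linarith)
    linarith

theorem interiorEstimate (S : FourierSystem D) {χ : 𝔼 → ℂ} (hχ : IsTest D χ) :
    InteriorEstimate (weakLaplacianGraph D) hχ.mulOp := by
  refine ⟨‖hχ.laplacian.mulOp‖ + ∑ i, ‖(hχ.partial i).mulOp‖, fun t ht w hw => ?_⟩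
  have ht0 : 0 < t := by linarith
  have hst : 0 < √t := Real.sqrt_pos.mpr ht0
  have hst1 : 1 ≤ √t := Real.one_le_sqrt.mpr ht
  have hstt : √t * √t = t := Real.mul_self_sqrt ht0.le
  have key := norm_le_sum_of_coefficients S.parseval
    (Finset.univ : Finset (Option (Option (Fin n))))
    (fun j => j.elim 1 fun _ => (√t)⁻¹) (by rintro (_ | _) <;> simp) (hχ.mulOp w.1)
    (fun j => j.elim (hχ.mulOp (w.1 - (t : ℂ)⁻¹ • w.2)) fun j => j.elim (hχ.laplacian.mulOp w.1)
      fun i => (hχ.partial i).mulOp w.1) ?_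
  · rw [Fintype.sum_option, Fintype.sum_option] at key
    simp only [Option.elim, one_mul] at key
    refine key.trans ?_
    gcongr
    rw [← Finset.mul_sum, ← mul_add, inv_mul_eq_div, div_mul_eq_mul_div]
    gcongr
    rw [add_mul, Finset.sum_mul]
    gcongr
    · exact ContinuousLinearMap.le_opNorm _ _
    · exact ContinuousLinearMap.le_opNorm _ _
  · intro k
    rw [Fintype.sum_option, Fintype.sum_option]
    simp only [Option.elim, one_mul, ← Finset.mul_sum]
    have h1 := S.coeff_mulOp_snd hχ hw k
    have h3 := S.norm_sum_freq_le hχ k w.1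
    have h4 : S.coeff k (hχ.mulOp (w.1 - (t : ℂ)⁻¹ • w.2)) =
        S.coeff k (hχ.mulOp w.1) - (t : ℂ)⁻¹ * S.coeff k (hχ.mulOp w.2) := by
      rw [map_sub, map_smul, map_sub, map_smul, smul_eq_mul]
    set a := S.coeff k (hχ.mulOp w.1)
    set y := S.coeff k (hχ.mulOp (w.1 - (t : ℂ)⁻¹ • w.2))
    set b := S.coeff k (hχ.mulOp w.2)
    set d := S.coeff k (hχ.laplacian.mulOp w.1)
    set σ := ∑ i, ‖S.coeff k ((hχ.partial i).mulOp w.1)‖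
    set τ := 2 * Complex.I * ∑ i, (S.freq k i : ℂ) * S.coeff k ((hχ.partial i).mulOp w.1)
    set ρ := ‖S.freq k‖
    have hσ : 0 ≤ σ := Finset.sum_nonneg fun i _ => norm_nonneg _
    have hρ : 0 ≤ ρ := norm_nonneg _
    have htc : (t : ℂ) ≠ 0 := by exact_mod_cast ht0.ne'
    have e : ((t + ρ ^ 2 : ℝ) : ℂ) * a = t * y + d - τ := by
      have : (t : ℂ) * y = t * a - b := by
        rw [h4]
        field_simp
      rw [this]
      push_cast at h1 ⊢
      linear_combination h1
    have h2 : (t + ρ ^ 2) * ‖a‖ ≤ t * ‖y‖ + ‖d‖ + 2 * ρ * σ := by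
      have e' := congrArg norm e
      rw [norm_mul, Complex.norm_real, Real.norm_of_nonneg (by positivity)] at e'
      rw [e']
      have h5 := norm_sub_le (t * y + d) τ
      have h6 := norm_add_le (t * y) d
      rw [norm_mul, Complex.norm_real, Real.norm_of_nonneg ht0.le] at h6
      linarith
    -- This is what makes the first-order commutator term of size `1 / √t` after division by `t +
    -- ρ²`.
    have h5 : 2 * ρ * √t ≤ t + ρ ^ 2 := by nlinarith [sq_nonneg (ρ - √t)]
    have h6 : ‖d‖ ≤ (t + ρ ^ 2) * ((√t)⁻¹ * ‖d‖) := by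
      have : 1 ≤ (t + ρ ^ 2) * (√t)⁻¹ := by
        rw [← div_eq_mul_inv, le_div_iff₀ hst]
        nlinarith [sq_nonneg ρ]
      nlinarith [norm_nonneg d]
    have h7 : 2 * ρ * σ ≤ (t + ρ ^ 2) * ((√t)⁻¹ * σ) := by
      have : 2 * ρ ≤ (t + ρ ^ 2) * (√t)⁻¹ := by
        rw [← div_eq_mul_inv, le_div_iff₀ hst]
        exact h5
      nlinarith
    have h8 : t * ‖y‖ ≤ (t + ρ ^ 2) * ‖y‖ := by
      have := norm_nonneg y
      nlinarith [sq_nonneg ρ]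
    have h9 : (t + ρ ^ 2) * ‖a‖ ≤ (t + ρ ^ 2) * (‖y‖ + ((√t)⁻¹ * ‖d‖ + (√t)⁻¹ * σ)) := by
      linarith
    exact le_of_mul_le_mul_left h9 (by positivity)

/-- By Parseval `‖u‖ ≤ ‖u - tΔu‖` for all `t > 0`; expanding the square and letting `t` be small
gives the sign. -/
theorem inner_nonpos_of_mem_testLaplacianGraph (S : FourierSystem D) (hDo : IsOpen D)
    {u : L2 D × L2 D}
    (hu : u ∈ testLaplacianGraph D) : (inner ℂ u.1 u.2).re ≤ 0 := by
  have h1 : ∀ t : ℝ, 0 < t → 2 * (inner ℂ u.1 u.2).re ≤ t * ‖u.2‖ ^ 2 := by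
    intro t ht
    have h2 : ‖u.1‖ ^ 2 ≤ ‖u.1 - (t : ℂ) • u.2‖ ^ 2 := by
      refine hasSum_le (fun k => ?_) (S.parseval u.1) (S.parseval (u.1 - (t : ℂ) • u.2))
      refine pow_le_pow_left₀ (norm_nonneg _) ?_ 2
      rw [map_sub, map_smul, S.coeff_snd hDo hu k]
      have e : S.coeff k u.1 - (t : ℂ) • (-((‖S.freq k‖ ^ 2 : ℝ) : ℂ) * S.coeff k u.1) =
          ((1 + t * ‖S.freq k‖ ^ 2 : ℝ) : ℂ) * S.coeff k u.1 := by
        rw [smul_eq_mul]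
        push_cast
        ring
      rw [e, norm_mul, Complex.norm_real, Real.norm_of_nonneg (by positivity)]
      have : 0 ≤ t * ‖S.freq k‖ ^ 2 := by positivity
      nlinarith [norm_nonneg (S.coeff k u.1)]
    rw [@norm_sub_sq ℂ, inner_smul_right, norm_smul, Complex.norm_real,
      Real.norm_of_nonneg ht.le] at h2
    have e : RCLike.re ((t : ℂ) * inner ℂ u.1 u.2) = t * (inner ℂ u.1 u.2).re :=
      Complex.re_ofReal_mul _ _
    rw [e] at h2
    have h3 : t * (2 * (inner ℂ u.1 u.2).re) ≤ t * (t * ‖u.2‖ ^ 2) := by nlinarith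
    exact le_of_mul_le_mul_left h3 ht
  by_contra hcon
  push Not at hcon
  have h2 := h1 ((inner ℂ u.1 u.2).re / (‖u.2‖ ^ 2 + 1)) (by positivity)
  have h3 : (inner ℂ u.1 u.2).re / (‖u.2‖ ^ 2 + 1) * ‖u.2‖ ^ 2 ≤ (inner ℂ u.1 u.2).re := by
    rw [div_mul_eq_mul_div, div_le_iff₀ (by positivity)]
    nlinarith
  linarith

theorem isAdjointPair (S : FourierSystem D) (hDo : IsOpen D) :
    IsAdjointPair (testLaplacianGraph D) (weakLaplacianGraph D) where
  mem_max_iff := mem_weakLaplacianGraph_iff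
  mem_min_iff := mem_testLaplacianGraph_iff
  le := testLaplacianGraph_le
  nonpos _ hu := S.inner_nonpos_of_mem_testLaplacianGraph hDo hu

end FourierSystem

end FourierOnDomain

/-! ### Compactness of compositions and sums. -/

section CompactComposition

variable {E F G : Type*} [NormedAddCommGroup E] [NormedSpace ℂ E] [NormedAddCommGroup F]
  [NormedSpace ℂ F] [NormedAddCommGroup G] [NormedSpace ℂ G]

theorem isCompactOperator_comp_left {A : E →L[ℂ] F} (hA : IsCompactOperator A) (L : F →L[ℂ] G) :
    IsCompactOperator (L ∘L A) := hA.clm_comp L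

theorem isCompactOperator_comp_right {A : F →L[ℂ] G} (hA : IsCompactOperator A) (L : E →L[ℂ] F) :
    IsCompactOperator (A ∘L L) := hA.comp_clm L

theorem isCompactOperator_add {A A' : E →L[ℂ] F} (hA : IsCompactOperator A)
    (hA' : IsCompactOperator A') : IsCompactOperator (A + A') := hA.add hA'

end CompactComposition

/-! ### A bounded inverse from a lower bound and surjectivity. -/

section PencilExistence

variable {X : Type*} [NormedAddCommGroup X] [NormedSpace ℂ X]

theorem exists_isPencilInverse {B : X →ₗ.[ℂ] X} {M : X →L[ℂ] X} {z : ℂ} {C : ℝ}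
    (hb : ∀ w : B.domain, ‖(w : X)‖ ≤ C * ‖B w - z • M (w : X)‖)
    (hs : ∀ f, ∃ w : B.domain, B w - z • M (w : X) = f) : ∃ R, IsPencilInverse B M z R := by
  let A : B.domain →ₗ[ℂ] X := B.toFun - z • (M.toLinearMap ∘ₗ B.domain.subtype)
  have hA : ∀ w, A w = B w - z • M (w : X) := fun w => rfl
  have hinj : Function.Injective A := by
    refine (injective_iff_map_eq_zero A).mpr fun w hw => ?_
    have h1 := hb w
    rw [← hA, hw, norm_zero, mul_zero] at h1
    exact Subtype.ext (norm_le_zero_iff.mp h1)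
  let e := LinearEquiv.ofBijective A ⟨hinj, hs⟩
  have he : ∀ f, A (e.symm f) = f := fun f => e.apply_symm_apply f
  refine ⟨(B.domain.subtype ∘ₗ e.symm.toLinearMap).mkContinuous C fun f => ?_, fun f => ?_,
    fun w => ?_⟩
  · have h1 := hb (e.symm f)
    rw [← hA, he] at h1
    exact h1
  · exact ⟨(e.symm f).2, he f⟩
  · have h1 : e.symm (A w) = w := e.symm_apply_apply w
    rw [← hA]
    exact congrArg Subtype.val h1

end PencilExistence

/-! ### The resolvent of the transmission operator -/

section Resolvent

variable {n : ℕ} {D : Set (EuclideanSpace ℝ (Fin n))}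

local notation "𝔼" => EuclideanSpace ℝ (Fin n)
local notation "⟪" x ", " y "⟫" => inner ℂ x y

theorem minLaplacian_eq_iff (hDo : IsOpen D) (u g : L2 D) :
    (∃ h : u ∈ H20 D, minLaplacian D ⟨u, h⟩ = g) ↔ (u, g) ∈ testLaplacianGraph D := by
  rw [← graph_minLaplacian hDo, LinearPMap.mem_graph_iff]
  constructor
  · rintro ⟨h, rfl⟩
    exact ⟨⟨u, h⟩, rfl, rfl⟩
  · rintro ⟨y, h1, h2⟩
    obtain rfl : (y : L2 D) = u := h1
    exact ⟨y.2, h2⟩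

theorem maxLaplacian_eq_iff (hDo : IsOpen D) (v g : L2 D) :
    (∃ h : v ∈ (maxLaplacian D).domain, maxLaplacian D ⟨v, h⟩ = g) ↔
      (v, g) ∈ weakLaplacianGraph D := by
  rw [← graph_maxLaplacian hDo, LinearPMap.mem_graph_iff]
  constructor
  · rintro ⟨h, rfl⟩
    exact ⟨⟨v, h⟩, rfl, rfl⟩
  · rintro ⟨y, h1, h2⟩
    obtain rfl : (y : L2 D) = v := h1
    exact ⟨y.2, h2⟩

/-- The resolvent equation as a system for the two components. -/
theorem transmissionOp_eq_iff (hDo : IsOpen D) (m : LInf D) (z : ℂ) (w f : L2Sum D) :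
    (∃ h : w ∈ (transmissionOp m).domain, transmissionOp m ⟨w, h⟩ - z • weightOp m w = f) ↔
      (w.fst, z • (w.fst + mulBy m w.fst) - mulBy m w.snd + f.fst) ∈ testLaplacianGraph D ∧
        (w.snd, z • w.snd + f.snd) ∈ weakLaplacianGraph D := by
  rw [← minLaplacian_eq_iff hDo, ← maxLaplacian_eq_iff hDo]
  constructor
  · rintro ⟨h, rfl⟩
    refine ⟨⟨h.1, ?_⟩, ⟨h.2, ?_⟩⟩
    · change _ = z • (w.fst + mulBy m w.fst) - mulBy m w.snd +
        ((minLaplacian D ⟨w.fst, h.1⟩ + mulBy m w.snd) - z • (w.fst + mulBy m w.fst))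
      abel
    · change _ = z • w.snd + (maxLaplacian D ⟨w.snd, h.2⟩ - z • w.snd)
      abel
  · rintro ⟨⟨h1, e1⟩, ⟨h2, e2⟩⟩
    refine ⟨⟨h1, h2⟩, ?_⟩
    refine (WithLp.equiv 2 _).injective (Prod.ext ?_ ?_)
    · change (minLaplacian D ⟨w.fst, h1⟩ + mulBy m w.snd) - z • (w.fst + mulBy m w.fst) = f.fst
      rw [e1]
      abel
    · change maxLaplacian D ⟨w.snd, h2⟩ - z • w.snd = f.snd
      rw [e2]
      abel

theorem norm_le_norm_fst_add_norm_snd (w : L2Sum D) : ‖w‖ ≤ ‖w.fst‖ + ‖w.snd‖ := by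
  rw [WithLp.prod_norm_eq_of_L2]
  refine Real.sqrt_le_iff.mpr ⟨by positivity, ?_⟩
  nlinarith [norm_nonneg w.fst, norm_nonneg w.snd]

theorem norm_fst_le (w : L2Sum D) : ‖w.fst‖ ≤ ‖w‖ := by
  rw [WithLp.prod_norm_eq_of_L2]
  exact Real.le_sqrt_of_sq_le (by nlinarith [sq_nonneg ‖w.snd‖])

theorem norm_snd_le (w : L2Sum D) : ‖w.snd‖ ≤ ‖w‖ := by
  rw [WithLp.prod_norm_eq_of_L2]
  exact Real.le_sqrt_of_sq_le (by nlinarith [sq_nonneg ‖w.fst‖])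

theorem exists_isPencilInverse_transmissionOp (hDo : IsOpen D) (S : FourierSystem D) (m : LInf D)
    {χ : L2 D →L[ℂ] L2 D} (hint : InteriorEstimate (weakLaplacianGraph D) χ)
    (hχ : ∀ x y, ⟪χ x, y⟫ = ⟪x, χ y⟫) (hm : IsAdmissible χ (mulBy m)) :
    ∃ (z : ℂ) (R : L2Sum D →L[ℂ] L2Sum D),
      IsPencilInverse (transmissionOp m) (weightOp m) z R := by
  obtain ⟨l, K, hK, hs⟩ := (S.isAdjointPair hDo).exists_solvable hint hχ hm
  refine ⟨l, exists_isPencilInverse (C := 4 * |K|) (fun w => ?_) fun f => ?_⟩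
  · set f := transmissionOp m w - (l : ℂ) • weightOp m (w : L2Sum D) with hf
    have h1 := (transmissionOp_eq_iff hDo m l w f).mp ⟨w.2, hf.symm⟩
    obtain ⟨h2, h3⟩ := hK _ _ _ _ h1.1 h1.2
    have h4 := norm_le_norm_fst_add_norm_snd (w : L2Sum D)
    have h5 := norm_fst_le f
    have h6 := norm_snd_le f
    have h7 : K * (‖f.fst‖ + ‖f.snd‖) ≤ |K| * (2 * ‖f‖) := by
      calc K * (‖f.fst‖ + ‖f.snd‖) ≤ |K| * (‖f.fst‖ + ‖f.snd‖) := by gcongr; exact le_abs_self K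
        _ ≤ |K| * (2 * ‖f‖) := by gcongr; linarith
    linarith
  · obtain ⟨u, v, hu, hv⟩ := hs f.fst f.snd
    obtain ⟨h, e⟩ := (transmissionOp_eq_iff hDo m l (WithLp.toLp 2 (u, v)) f).mpr ⟨hu, hv⟩
    exact ⟨⟨_, h⟩, e⟩

/-- Coercivity of `Q` up to an error supported where the localization `χ` lives. -/
def IsLocallyCoercive (χ Q : L2 D →L[ℂ] L2 D) (ζ : ℂ) (c C : ℝ) : Prop :=
  ∀ x, c * ‖x‖ ^ 2 ≤ (ζ * ⟪x, Q x⟫).re + C * ‖χ x‖ ^ 2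

/-- A nearby coefficient `p` need not satisfy the hypotheses on `m`; local coercivity is the part
that persists, and it suffices for compactness. -/
theorem IsLocallyCoercive.perturb {χ Q Q' : L2 D →L[ℂ] L2 D} {ζ : ℂ} {c C : ℝ} (hζ : ‖ζ‖ = 1)
    (h : IsLocallyCoercive χ Q ζ c C) (hQ : ‖Q' - Q‖ ≤ c / 2) :
    IsLocallyCoercive χ Q' ζ (c / 2) C := by
  intro x
  have h1 := h x
  have e : ζ * ⟪x, Q x⟫ = ζ * ⟪x, Q' x⟫ - ζ * ⟪x, (Q' - Q) x⟫ := by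
    rw [sub_apply, inner_sub_right]
    ring
  rw [e, Complex.sub_re] at h1
  have h2 : -(ζ * ⟪x, (Q' - Q) x⟫).re ≤ c / 2 * ‖x‖ ^ 2 := by
    refine (neg_le_abs _).trans ((Complex.abs_re_le_norm _).trans ?_)
    rw [norm_mul, hζ, one_mul]
    refine (norm_inner_le_norm _ _).trans ?_
    have h3 := (Q' - Q).le_of_opNorm_le hQ x
    nlinarith [norm_nonneg x]
  linarith

/-- The inclusion of the first summand in `L²(D) ⊕ L²(D)`. -/
def inlOp (D : Set (EuclideanSpace ℝ (Fin n))) : L2 D →L[ℂ] L2Sum D :=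
  (WithLp.prodContinuousLinearEquiv 2 ℂ (L2 D) (L2 D)).symm.toContinuousLinearMap ∘L
    ContinuousLinearMap.inl ℂ (L2 D) (L2 D)

/-- The inclusion of the second summand in `L²(D) ⊕ L²(D)`. -/
def inrOp (D : Set (EuclideanSpace ℝ (Fin n))) : L2 D →L[ℂ] L2Sum D :=
  (WithLp.prodContinuousLinearEquiv 2 ℂ (L2 D) (L2 D)).symm.toContinuousLinearMap ∘L
    ContinuousLinearMap.inr ℂ (L2 D) (L2 D)

/-- The projection of `L²(D) ⊕ L²(D)` to the first summand. -/
def fstOp (D : Set (EuclideanSpace ℝ (Fin n))) : L2Sum D →L[ℂ] L2 D :=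
  ContinuousLinearMap.fst ℂ (L2 D) (L2 D) ∘L
    (WithLp.prodContinuousLinearEquiv 2 ℂ (L2 D) (L2 D)).toContinuousLinearMap

/-- The projection of `L²(D) ⊕ L²(D)` to the second summand. -/
def sndOp (D : Set (EuclideanSpace ℝ (Fin n))) : L2Sum D →L[ℂ] L2 D :=
  ContinuousLinearMap.snd ℂ (L2 D) (L2 D) ∘L
    (WithLp.prodContinuousLinearEquiv 2 ℂ (L2 D) (L2 D)).toContinuousLinearMap

theorem inlOp_fstOp_add_inrOp_sndOp (w : L2Sum D) :
    inlOp D (fstOp D w) + inrOp D (sndOp D w) = w :=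
  (WithLp.equiv 2 _).injective (Prod.ext (add_zero w.fst) (zero_add w.snd))

/-- The square of the operator `(B - z I_m)⁻¹ I_m` is compact. -/
theorem isCompactOperator_sq (hDo : IsOpen D) (S : FourierSystem D) {m : LInf D} {z : ℂ}
    {R : L2Sum D →L[ℂ] L2Sum D} (hR : IsPencilInverse (transmissionOp m) (weightOp m) z R)
    {χ : 𝔼 → ℂ} (hχ : IsTest D χ) {ζ : ℂ} (hζ : ‖ζ‖ = 1) {c C : ℝ} (hc : 0 < c) (hC : 0 ≤ C)
    (hm : IsLocallyCoercive hχ.mulOp (mulBy m) ζ c C) :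
    IsCompactOperator ((R ∘L weightOp m) * (R ∘L weightOp m) : L2Sum D →L[ℂ] L2Sum D) := by
  set Q := mulBy m
  let U := fstOp D ∘L R
  let V := sndOp D ∘L R
  have hsol : ∀ f, (U f, z • (U f + Q (U f)) - Q (V f) + f.fst) ∈ testLaplacianGraph D ∧
      (V f, z • V f + f.snd) ∈ weakLaplacianGraph D := fun f =>
    (transmissionOp_eq_iff hDo m z (R f) f).mp (hR.1 f)
  have hU : IsCompactOperator U :=
    S.isCompactOperator_of_mem_testLaplacianGraph hDo U
      (z • (U + Q ∘L U) - Q ∘L V + fstOp D) fun f => (hsol f).1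
  have hχV : IsCompactOperator (hχ.mulOp ∘L V) :=
    S.isCompactOperator_mulOp_comp hχ V (z • V + sndOp D) fun f => (hsol f).2
  -- With first datum zero, the pairing identity for `⟨v, Qv⟩` contains only terms with the factor
  -- `u`, which depends compactly on `g`. A nonzero first datum `f` would contribute `⟨v, f⟩`, which
  -- is not controlled this way.
  have hV₂ : IsCompactOperator (V ∘L inrOp D) := by
    let K : ℝ := (1 + C + ‖V ∘L inrOp D‖ * (‖z‖ * (1 + ‖Q‖) + ‖z‖)) / c + 1 / c
    have hK : 0 ≤ K := by positivity
    refine isCompactOperator_of_norm_sq_le (isCompactOperator_comp_right hχV (inrOp D))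
      (isCompactOperator_comp_right hU (inrOp D)) hK fun g => ?_
    set u := U (inrOp D g) with hu
    set v := V (inrOp D g) with hv
    have e1 : (V ∘L inrOp D) g = v := rfl
    have e2 : ((hχ.mulOp ∘L V) ∘L inrOp D) g = hχ.mulOp v := rfl
    have e3 : (U ∘L inrOp D) g = u := rfl
    have hvg : ‖v‖ ≤ ‖V ∘L inrOp D‖ * ‖g‖ := (V ∘L inrOp D).le_opNorm g
    rw [e1, e2, e3]
    have h1 := hsol (inrOp D g)
    have h2 := (mem_weakLaplacianGraph_iff _).mp h1.2 _ h1.1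
    have h3 : ⟪v, z • (u + Q u) - Q v + 0⟫ = ⟪z • v + g, u⟫ := h2
    rw [add_zero, inner_sub_right, inner_smul_right, inner_add_left, inner_smul_left] at h3
    have h4 : ⟪v, Q v⟫ = z * ⟪v, u + Q u⟫ - (starRingEnd ℂ) z * ⟪v, u⟫ - ⟪g, u⟫ := by
      linear_combination -h3
    have h5 : ‖⟪v, Q v⟫‖ ≤ (‖V ∘L inrOp D‖ * (‖z‖ * (1 + ‖Q‖) + ‖z‖) + 1) * (‖u‖ * ‖g‖) := by
      rw [h4]
      have i1 : ‖z * ⟪v, u + Q u⟫‖ ≤ ‖z‖ * (‖v‖ * ((1 + ‖Q‖) * ‖u‖)) := by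
        rw [norm_mul]
        gcongr
        refine (norm_inner_le_norm _ _).trans ?_
        gcongr
        refine (norm_add_le _ _).trans ?_
        have := Q.le_opNorm u
        linarith
      have i2 : ‖(starRingEnd ℂ) z * ⟪v, u⟫‖ ≤ ‖z‖ * (‖v‖ * ‖u‖) := by
        rw [norm_mul, RCLike.norm_conj]
        gcongr
        exact norm_inner_le_norm _ _
      have i3 : ‖⟪g, u⟫‖ ≤ ‖g‖ * ‖u‖ := norm_inner_le_norm _ _
      have i4 := norm_sub_le (z * ⟪v, u + Q u⟫ - (starRingEnd ℂ) z * ⟪v, u⟫) ⟪g, u⟫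
      have i5 := norm_sub_le (z * ⟪v, u + Q u⟫) ((starRingEnd ℂ) z * ⟪v, u⟫)
      have i6 : ‖v‖ * ((‖z‖ * (1 + ‖Q‖) + ‖z‖) * ‖u‖) ≤
          ‖V ∘L inrOp D‖ * ‖g‖ * ((‖z‖ * (1 + ‖Q‖) + ‖z‖) * ‖u‖) := by gcongr
      linarith
    have h6 := hm v
    have h7 : (ζ * ⟪v, Q v⟫).re ≤ ‖⟪v, Q v⟫‖ := by
      refine (Complex.re_le_norm _).trans ?_
      rw [norm_mul, hζ, one_mul]
    have h8 : c * ‖v‖ ^ 2 ≤ c * (K * (‖hχ.mulOp v‖ ^ 2 + ‖u‖ * ‖g‖)) := by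
      have e : c * K = (1 + C + ‖V ∘L inrOp D‖ * (‖z‖ * (1 + ‖Q‖) + ‖z‖)) + 1 := by
        simp only [K]
        field_simp
      rw [← mul_assoc, e]
      have j1 : 0 ≤ ‖u‖ * ‖g‖ := by positivity
      have j2 := sq_nonneg ‖hχ.mulOp v‖
      have j3 : 0 ≤ ‖V ∘L inrOp D‖ * (‖z‖ * (1 + ‖Q‖) + ‖z‖) := by positivity
      nlinarith [mul_nonneg hC j1, mul_nonneg j3 j2]
    exact le_of_mul_le_mul_left h8 hc
  have hRr : IsCompactOperator (R ∘L inrOp D) := by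
    have e : R ∘L inrOp D =
        inlOp D ∘L (U ∘L inrOp D) + inrOp D ∘L (V ∘L inrOp D) := by
      ext1 g
      exact (inlOp_fstOp_add_inrOp_sndOp (R (inrOp D g))).symm
    rw [e]
    exact isCompactOperator_add
      (isCompactOperator_comp_left (isCompactOperator_comp_right hU _) _)
      (isCompactOperator_comp_left hV₂ _)
  -- In the square the possibly noncompact entry `R ∘L inlOp D` is always preceded by the compact
  -- `U`, and `V` is followed by the compact `R ∘L inrOp D`.
  have e : ((R ∘L weightOp m) * (R ∘L weightOp m) : L2Sum D →L[ℂ] L2Sum D) =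
      (R ∘L inlOp D ∘L (ContinuousLinearMap.id ℂ (L2 D) + Q)) ∘L (U ∘L weightOp m) +
        (R ∘L inrOp D) ∘L (V ∘L weightOp m) := by
    ext1 f
    have h1 : weightOp m (R (weightOp m f)) =
        inlOp D (U (weightOp m f) + Q (U (weightOp m f))) + inrOp D (V (weightOp m f)) :=
      (inlOp_fstOp_add_inrOp_sndOp (weightOp m (R (weightOp m f)))).symm
    change R (weightOp m (R (weightOp m f))) = _
    rw [h1, map_add]
    rfl
  rw [e]
  exact isCompactOperator_add
    (isCompactOperator_comp_left (isCompactOperator_comp_right hU _) _)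
    (isCompactOperator_comp_right hRr _)

end Resolvent

/-! ### Localization of the coercivity of the contrast -/

section Multipliers

variable {n : ℕ} {D : Set (EuclideanSpace ℝ (Fin n))}

local notation "𝔼" => EuclideanSpace ℝ (Fin n)
local notation "⟪" x ", " y "⟫" => inner ℂ x y

theorem norm_sq_eq_integral (f : L2 D) : ‖f‖ ^ 2 = ∫ x in D, ‖f x‖ ^ 2 := by
  rw [← inner_self_eq_norm_sq (𝕜 := ℂ), L2.inner_def, ← integral_re (L2.integrable_inner f f)]
  simp only [inner_self_eq_norm_sq]

theorem integrable_norm_sq (f : L2 D) : Integrable (fun x => ‖f x‖ ^ 2) (domainMeasure D) :=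
  (Lp.memLp f).integrable_norm_pow two_ne_zero

/-- A pointwise lower bound for a multiplier gives local coercivity. -/
theorem isLocallyCoercive_mulBy {m : LInf D} {χ : 𝔼 → ℂ} (hχ : IsTest D χ) {ζ : ℂ} {c C : ℝ}
    (h : ∀ᵐ x ∂(domainMeasure D), c ≤ (ζ * m x).re + C * ‖χ x‖ ^ 2) :
    IsLocallyCoercive hχ.mulOp (mulBy m) ζ c C := by
  intro f
  have e1 : (ζ * ⟪f, mulBy m f⟫).re = ∫ x in D, (ζ * ⟪f x, (mulBy m f) x⟫).re := by
    rw [L2.inner_def, ← integral_const_mul]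
    exact (integral_re ((L2.integrable_inner f (mulBy m f)).const_mul ζ)).symm
  have i1 : Integrable (fun x => (ζ * ⟪f x, (mulBy m f) x⟫).re) (domainMeasure D) :=
    ((L2.integrable_inner f (mulBy m f)).const_mul ζ).re
  rw [e1, norm_sq_eq_integral, norm_sq_eq_integral, ← integral_const_mul, ← integral_const_mul,
    ← integral_add i1 ((integrable_norm_sq _).const_mul C)]
  refine integral_mono_ae ((integrable_norm_sq f).const_mul c)
    (i1.add ((integrable_norm_sq _).const_mul C)) ?_
  filter_upwards [h, mulBy_coeFn m f, hχ.mulOp_coeFn f] with x h1 h2 h3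
  rw [h2, h3]
  have e2 : ζ * ⟪f x, m x * f x⟫ = (ζ * m x) * ((‖f x‖ ^ 2 : ℝ) : ℂ) := by
    rw [← smul_eq_mul (m x), inner_smul_right, inner_self_eq_norm_sq_to_K]
    push_cast
    ring_nf
    rfl
  rw [e2, Complex.re_mul_ofReal, norm_mul, mul_pow, ← mul_assoc, ← add_mul]
  exact mul_le_mul_of_nonneg_right h1 (sq_nonneg _)

theorem mulBy_symmetric {m : LInf D} (h : ∀ᵐ x ∂(domainMeasure D), (m x).im = 0) (f g : L2 D) :
    ⟪mulBy m f, g⟫ = ⟪f, mulBy m g⟫ := by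
  rw [inner_eq_integral, inner_eq_integral]
  refine integral_congr_ae ?_
  filter_upwards [h, mulBy_coeFn m f, mulBy_coeFn m g] with x h1 h2 h3
  rw [h2, h3, map_mul, Complex.conj_eq_iff_im.mpr h1]
  ring

theorem IsTest.mulOp_mulBy_comm {χ : 𝔼 → ℂ} (hχ : IsTest D χ) (m : LInf D) (f : L2 D) :
    hχ.mulOp (mulBy m f) = mulBy m (hχ.mulOp f) := by
  refine Lp.ext ?_
  filter_upwards [hχ.mulOp_coeFn (mulBy m f), hχ.mulOp_coeFn f, mulBy_coeFn m f,
    mulBy_coeFn m (hχ.mulOp f)] with x h1 h2 h3 h4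
  rw [h1, h4, h2, h3]
  ring

theorem IsTest.mulOp_symmetric {χ : 𝔼 → ℝ} (hχ : IsTest D fun x => (χ x : ℂ)) (f g : L2 D) :
    ⟪hχ.mulOp f, g⟫ = ⟪f, hχ.mulOp g⟫ := by
  refine mulBy_symmetric ?_ f g
  filter_upwards [(hχ.memLp ∞).coeFn_toLp] with x h1
  rw [h1, Complex.ofReal_im]

theorem accretive_mulBy {m : LInf D} {δ : ℝ}
    (hre : ∀ᵐ x ∂(domainMeasure D), δ ≤ (1 + m x).re) (f : L2 D) :
    δ * ‖f‖ ^ 2 ≤ (⟪f, f + mulBy m f⟫).re := by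
  -- With zero localization the coercivity lemma carries no interior error.
  have ht : IsTest D fun _ : 𝔼 => (0 : ℂ) :=
    ⟨contDiff_const, HasCompactSupport.zero, by simp [tsupport]⟩
  have h1 : IsLocallyCoercive ht.mulOp (mulBy m) 1 (δ - 1) 0 := by
    refine isLocallyCoercive_mulBy ht ?_
    filter_upwards [hre] with x hx
    rw [Complex.add_re, Complex.one_re] at hx
    rw [one_mul, zero_mul, add_zero]
    linarith
  have h2 := h1 f
  rw [one_mul, zero_mul, add_zero] at h2
  have h3 : (⟪f, f⟫).re = ‖f‖ ^ 2 := inner_self_eq_norm_sq (𝕜 := ℂ) f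
  rw [inner_add_right, Complex.add_re, h3]
  linarith

/-- The hypotheses on `m` provide a localization for which multiplication by `m` is admissible. -/
theorem exists_admissible_localization (hDo : IsOpen D) (hDb : Bornology.IsBounded D)
    {m : LInf D} {mlow mup δ : ℝ} (hlow : 0 < mlow) (hle : mlow ≤ mup) (hδ : 0 < δ)
    (hbdry : ∃ N : Set 𝔼, IsOpen N ∧ frontier D ⊆ N ∧
      ((∃ θ ∈ Ioo (-(Real.pi / 2)) (Real.pi / 2), ∀ᵐ x ∂(domainMeasure D),
          x ∈ N → mlow < (Complex.exp (θ * Complex.I) * m x).re) ∨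
        ((∀ᵐ x ∂(domainMeasure D), (m x).im = 0) ∧
          ∀ᵐ x ∂(domainMeasure D), x ∈ N → (m x).re ≤ -mlow)))
    (hbound : ∀ᵐ x ∂(domainMeasure D), ‖m x‖ < mup)
    (hre : ∀ᵐ x ∂(domainMeasure D), δ ≤ (1 + m x).re) :
    ∃ (χ : 𝔼 → ℂ) (hχ : IsTest D χ) (ζ : ℂ) (c C : ℝ), ‖ζ‖ = 1 ∧ 0 < c ∧ 0 ≤ C ∧
      (∀ f g, ⟪hχ.mulOp f, g⟫ = ⟪f, hχ.mulOp g⟫) ∧ IsAdmissible hχ.mulOp (mulBy m) ∧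
      IsLocallyCoercive hχ.mulOp (mulBy m) ζ c C := by
  obtain ⟨N, hN, hDN, hm⟩ := hbdry
  have hKD : closure D \ N ⊆ D := by
    rintro x ⟨hx, hxN⟩
    by_contra hxD
    exact hxN (hDN (by rw [hDo.frontier_eq]; exact ⟨hx, hxD⟩))
  have hK : IsCompact (closure D \ N) :=
    hDb.isCompact_closure.of_isClosed_subset (isClosed_closure.sdiff hN) sdiff_subset
  obtain ⟨χ, hχ, hχ1⟩ := exists_cutoff hDo hK hKD
  have hone : ∀ x ∈ D, x ∉ N → χ x = 1 := fun x hx hxN =>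
    hχ1.self_of_nhdsSet x ⟨subset_closure hx, hxN⟩
  have hmem : ∀ᵐ x ∂(domainMeasure D), x ∈ D := ae_restrict_mem hDo.measurableSet
  -- Away from `N` the cutoff is `1` and `Re(ζ m) ≥ -mup`, so the constant `mlow + mup` restores the
  -- lower bound `mlow`.
  have hC : 0 ≤ mlow + mup := by linarith
  have key : ∀ ζ : ℂ, ‖ζ‖ = 1 → (∀ᵐ x ∂(domainMeasure D), x ∈ N → mlow ≤ (ζ * m x).re) →
      IsLocallyCoercive hχ.mulOp (mulBy m) ζ mlow (mlow + mup) := by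
    intro ζ hζ h
    refine isLocallyCoercive_mulBy hχ ?_
    filter_upwards [h, hbound, hmem] with x h1 h2 h3
    by_cases hx : x ∈ N
    · have := h1 hx
      have : 0 ≤ (mlow + mup) * ‖(χ x : ℂ)‖ ^ 2 := by positivity
      linarith
    · rw [hone x h3 hx, Complex.ofReal_one, norm_one, one_pow, mul_one]
      have h4 := (abs_le.mp (Complex.abs_re_le_norm (ζ * m x))).1
      rw [norm_mul, hζ, one_mul] at h4
      linarith
  rcases hm with ⟨θ, hθ, h⟩ | ⟨h1, h2⟩
  · have hζ : ‖Complex.exp (θ * Complex.I)‖ = 1 := Complex.norm_exp_ofReal_mul_I θ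
    have hco := key _ hζ (h.mono fun x hx hxN => (hx hxN).le)
    refine ⟨_, hχ, _, mlow, mlow + mup, hζ, hlow, hC, hχ.mulOp_symmetric,
      ⟨⟨δ, hδ, accretive_mulBy hre⟩, hχ.mulOp_mulBy_comm m,
        Or.inl ⟨_, hζ, ?_, mlow, hlow, mlow + mup, hC, hco⟩⟩, hco⟩
    rw [Complex.exp_ofReal_mul_I_re]
    exact Real.cos_pos_of_mem_Ioo hθ
  · have hζ : ‖(-1 : ℂ)‖ = 1 := by simp
    have hco := key (-1) hζ (h2.mono fun x hx hxN => by
      have := hx hxN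
      rw [neg_one_mul, Complex.neg_re]
      linarith)
    refine ⟨_, hχ, _, mlow, mlow + mup, hζ, hlow, hC, hχ.mulOp_symmetric,
      ⟨⟨δ, hδ, accretive_mulBy hre⟩, hχ.mulOp_mulBy_comm m,
        Or.inr ⟨mulBy_symmetric h1, mlow, hlow, mlow + mup, hC, fun f => ?_⟩⟩, hco⟩
    have h3 := hco f
    rwa [neg_one_mul, Complex.neg_re] at h3

end Multipliers

/-! ### Bounded perturbations of a pencil. -/

section PencilPerturbation

variable {X : Type*} [NormedAddCommGroup X] [NormedSpace ℂ X]

/-- The perturbed operator is `(B - z M)(1 + R E)` on the common domain. -/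
theorem IsPencilInverse.perturb {B B' : X →ₗ.[ℂ] X} {M M' R E : X →L[ℂ] X} {z z' : ℂ}
    (hR : IsPencilInverse B M z R) (hdom : ∀ w, w ∈ B'.domain ↔ w ∈ B.domain)
    (hE : ∀ w (h : w ∈ B.domain) (h' : w ∈ B'.domain),
      B' ⟨w, h'⟩ - z' • M' w = B ⟨w, h⟩ - z • M w + E w) (hu : IsUnit (1 + R ∘L E)) :
    IsPencilInverse B' M' z' (Ring.inverse (1 + R ∘L E) ∘L R) := by
  refine ⟨fun f => ?_, fun w => ?_⟩
  · set w := (Ring.inverse (1 + R ∘L E) ∘L R) f with hw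
    have h1 : w + R (E w) = R f := apply_inverse_of_isUnit hu (R f)
    have h2 : w = R (f - E w) := by
      rw [map_sub, ← h1]
      abel
    obtain ⟨h3, h4⟩ := hR.1 (f - E w)
    have h5 : w ∈ B.domain := by
      rw [h2]
      exact h3
    have h6 : B ⟨w, h5⟩ - z • M w = f - E w := by
      rw [← h4]
      congr! 4
    refine ⟨(hdom w).mpr h5, ?_⟩
    rw [hE w h5, h6]
    abel
  · have h5 : (w : X) ∈ B.domain := (hdom w).mp w.2
    have h1 := hE w h5 w.2
    have h2 := hR.2 ⟨w, h5⟩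
    dsimp only at h2
    have h3 : R (B' w - z' • M' (w : X)) = (1 + R ∘L E) (w : X) := by
      rw [show B' w = B' ⟨w, w.2⟩ from rfl, h1, map_add, h2]
      rfl
    change Ring.inverse (1 + R ∘L E) (R _) = _
    rw [h3, inverse_apply_of_isUnit hu]

end PencilPerturbation

/-! ### Continuity in the contrast -/

section Continuity

variable {n : ℕ} {D : Set (EuclideanSpace ℝ (Fin n))}

local notation "𝔼" => EuclideanSpace ℝ (Fin n)
local notation "⟪" x ", " y "⟫" => inner ℂ x y

theorem continuous_mulBy : Continuous (mulBy : LInf D → L2 D →L[ℂ] L2 D) :=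
  ((ContinuousLinearMap.mul ℂ ℂ).holderL (domainMeasure D) ∞ 2 2).continuous

theorem weightOp_eq (m : LInf D) :
    weightOp m = ContinuousLinearMap.id ℂ _ + inlOp D ∘L mulBy m ∘L fstOp D := by
  ext1 w
  refine (WithLp.equiv 2 _).injective (Prod.ext rfl ?_)
  exact (add_zero w.snd).symm

theorem continuous_weightOp : Continuous (weightOp : LInf D → L2Sum D →L[ℂ] L2Sum D) := by
  rw [funext weightOp_eq]
  exact continuous_const.add
    (continuous_const.clm_comp (continuous_mulBy.clm_comp continuous_const))

/-- The difference `(B_p - z I_p) - (B_m - z₀ I_m)`, which is a bounded operator. -/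
def pencilDifference (m : LInf D) (z₀ : ℂ) (q : LInf D × ℂ) : L2Sum D →L[ℂ] L2Sum D :=
  inlOp D ∘L (mulBy q.1 - mulBy m) ∘L sndOp D - (q.2 • weightOp q.1 - z₀ • weightOp m)

theorem continuous_pencilDifference (m : LInf D) (z₀ : ℂ) :
    Continuous (pencilDifference m z₀) := by
  unfold pencilDifference
  have h1 : Continuous fun q : LInf D × ℂ => mulBy q.1 := continuous_mulBy.comp continuous_fst
  have h2 : Continuous fun q : LInf D × ℂ => weightOp q.1 := continuous_weightOp.comp continuous_fst
  exact (continuous_const.clm_comp ((h1.sub continuous_const).clm_comp continuous_const)).sub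
    ((continuous_snd.smul h2).sub continuous_const)

theorem pencilDifference_self (m : LInf D) (z₀ : ℂ) : pencilDifference m z₀ (m, z₀) = 0 := by
  simp [pencilDifference]

theorem transmissionOp_sub_eq (m p : LInf D) (z₀ z : ℂ) (w : L2Sum D)
    (h : w ∈ (transmissionOp m).domain) (h' : w ∈ (transmissionOp p).domain) :
    transmissionOp p ⟨w, h'⟩ - z • weightOp p w =
      transmissionOp m ⟨w, h⟩ - z₀ • weightOp m w + pencilDifference m z₀ (p, z) w := by
  have e : transmissionOp p ⟨w, h'⟩ =
      transmissionOp m ⟨w, h⟩ + inlOp D ((mulBy p - mulBy m) w.snd) := by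
    refine (WithLp.equiv 2 _).injective (Prod.ext ?_ ?_)
    · change minLaplacian D ⟨w.fst, h'.1⟩ + mulBy p w.snd =
        minLaplacian D ⟨w.fst, h.1⟩ + mulBy m w.snd + (mulBy p w.snd - mulBy m w.snd)
      abel
    · exact (add_zero (maxLaplacian D ⟨w.snd, h.2⟩)).symm
  rw [e]
  change _ = _ + (inlOp D ((mulBy p - mulBy m) w.snd) - (z • weightOp p w - z₀ • weightOp m w))
  abel

variable {m : LInf D} {z₀ : ℂ}

theorem eventually_resolventOp_eq (hz : z₀ ∉ transmissionSpectrum m) :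
    ∀ᶠ q in nhds (m, z₀), q.2 ∉ transmissionSpectrum q.1 ∧ resolventOp q.1 q.2 =
      Ring.inverse (1 + pencilInverse (transmissionOp m) (weightOp m) z₀ ∘L
        pencilDifference m z₀ q) ∘L pencilInverse (transmissionOp m) (weightOp m) z₀ ∘L
          weightOp q.1 := by
  set R := pencilInverse (transmissionOp m) (weightOp m) z₀
  have hR : IsPencilInverse (transmissionOp m) (weightOp m) z₀ R :=
    isPencilInverse_pencilInverse hz
  have hc : Continuous fun q => 1 + R ∘L pencilDifference m z₀ q :=
    continuous_const.add (continuous_const.clm_comp (continuous_pencilDifference m z₀))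
  have hu : ∀ᶠ q in nhds (m, z₀), IsUnit (1 + R ∘L pencilDifference m z₀ q) := by
    refine hc.continuousAt.eventually (Units.isOpen.mem_nhds ?_)
    change IsUnit (1 + R ∘L pencilDifference m z₀ (m, z₀))
    rw [pencilDifference_self, ContinuousLinearMap.comp_zero, add_zero]
    exact isUnit_one
  filter_upwards [hu] with q hq
  have h1 : IsPencilInverse (transmissionOp q.1) (weightOp q.1) q.2
      (Ring.inverse (1 + R ∘L pencilDifference m z₀ q) ∘L R) :=
    hR.perturb (fun w => Iff.rfl) (fun w h h' => transmissionOp_sub_eq m q.1 z₀ q.2 w h h') hq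
  refine ⟨fun hcon => hcon ⟨_, h1⟩, ?_⟩
  rw [resolventOp, pencilResolvent, pencilInverse_eq h1]
  rfl

theorem continuousAt_resolventOp (hz : z₀ ∉ transmissionSpectrum m) :
    ContinuousAt (fun q : LInf D × ℂ => resolventOp q.1 q.2) (m, z₀) := by
  refine ContinuousAt.congr ?_ ((eventually_resolventOp_eq hz).mono fun q hq => hq.2.symm)
  set R := pencilInverse (transmissionOp m) (weightOp m) z₀
  have hc : Continuous fun q => 1 + R ∘L pencilDifference m z₀ q :=
    continuous_const.add (continuous_const.clm_comp (continuous_pencilDifference m z₀))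
  have h1 : ContinuousAt (fun q => Ring.inverse (1 + R ∘L pencilDifference m z₀ q)) (m, z₀) := by
    refine ContinuousAt.comp (g := Ring.inverse) ?_ hc.continuousAt
    rw [pencilDifference_self, ContinuousLinearMap.comp_zero, add_zero]
    exact NormedRing.inverse_continuousAt (1 : (L2Sum D →L[ℂ] L2Sum D)ˣ)
  exact h1.clm_comp (continuous_const.clm_comp
    (continuous_weightOp.comp continuous_fst)).continuousAt

/-- The Laplacian of the first component of the resolvent. -/
def resolventLaplacian (m : LInf D) (z : ℂ) : L2Sum D →L[ℂ] L2 D :=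
  (z • (ContinuousLinearMap.id ℂ (L2 D) + mulBy m)) ∘L fstOp D ∘L resolventOp m z -
    mulBy m ∘L sndOp D ∘L resolventOp m z + fstOp D ∘L weightOp m

/-- The equation itself expresses the Laplacian through bounded operators, so continuity in the norm
of `H²₀(D)` reduces to operator-norm continuity in `L²`. -/
theorem mem_testLaplacianGraph_resolvent (hDo : IsOpen D) {z : ℂ}
    (hz : z ∉ transmissionSpectrum m) (f : L2Sum D) :
    ((resolventOp m z f).fst, resolventLaplacian m z f) ∈ testLaplacianGraph D :=
  ((transmissionOp_eq_iff hDo m z _ (weightOp m f)).mp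
    ((isPencilInverse_pencilInverse hz).1 (weightOp m f))).1

theorem continuousAt_resolventLaplacian (hz : z₀ ∉ transmissionSpectrum m) :
    ContinuousAt (fun q : LInf D × ℂ => resolventLaplacian q.1 q.2) (m, z₀) := by
  unfold resolventLaplacian
  have hr := continuousAt_resolventOp hz
  have hm : ContinuousAt (fun q : LInf D × ℂ => mulBy q.1) (m, z₀) :=
    (continuous_mulBy.comp continuous_fst).continuousAt
  have hw : ContinuousAt (fun q : LInf D × ℂ => weightOp q.1) (m, z₀) :=
    (continuous_weightOp.comp continuous_fst).continuousAt
  exact (((continuousAt_snd.smul (continuousAt_const.add hm)).clm_comp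
    (continuousAt_const.clm_comp hr)).sub (hm.clm_comp (continuousAt_const.clm_comp hr))).add
    (continuousAt_const.clm_comp hw)

/-- Uniform continuity of a family at a fixed parameter, along a compact set. -/
theorem eventually_forall_norm_sub_lt {P Y : Type*} [TopologicalSpace P] [SeminormedAddCommGroup Y]
    {Φ : P × ℂ → Y} {p₀ : P} {K : Set ℂ} (hK : IsCompact K)
    (h : ∀ z ∈ K, ContinuousAt Φ (p₀, z)) {ε : ℝ} (hε : 0 < ε) :
    ∀ᶠ p in nhds p₀, ∀ z ∈ K, ‖Φ (p, z) - Φ (p₀, z)‖ < ε := by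
  refine hK.eventually_forall_of_forall_eventually fun z hz => ?_
  have h1 := h z hz
  have h2 : ContinuousAt (fun q : P × ℂ => Φ (p₀, q.2)) (p₀, z) :=
    ContinuousAt.comp (g := Φ) (f := fun q : P × ℂ => (p₀, q.2)) h1
      (by fun_prop)
  have h3 := (h1.sub h2).norm
  have h4 : ∀ᶠ q in nhds (p₀, z), ‖Φ q - Φ (p₀, q.2)‖ < ε := by
    refine h3.eventually (gt_mem_nhds ?_)
    simpa using hε
  exact h4

theorem eventually_resolventOp_near {K : Set ℂ} (hK : IsCompact K)
    (hd : Disjoint K (transmissionSpectrum m)) {ε : ℝ} (hε : 0 < ε) :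
    ∀ᶠ p in nhds m, Disjoint K (transmissionSpectrum p) ∧ ∀ z ∈ K,
      ‖resolventOp p z - resolventOp m z‖ < ε ∧
        ‖resolventLaplacian p z - resolventLaplacian m z‖ < ε := by
  have hd' : ∀ z ∈ K, z ∉ transmissionSpectrum m := fun z hz => disjoint_left.mp hd hz
  have h1 : ∀ᶠ p in nhds m, ∀ z ∈ K, z ∉ transmissionSpectrum p :=
    hK.eventually_forall_of_forall_eventually fun z hz =>
      (eventually_resolventOp_eq (hd' z hz)).mono fun q hq => hq.1
  filter_upwards [h1, eventually_forall_norm_sub_lt (Φ := fun q : LInf D × ℂ => resolventOp q.1 q.2)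
    hK (fun z hz => continuousAt_resolventOp (hd' z hz)) hε,
    eventually_forall_norm_sub_lt (Φ := fun q : LInf D × ℂ => resolventLaplacian q.1 q.2)
    hK (fun z hz => continuousAt_resolventLaplacian (hd' z hz)) hε] with p hp1 hp2 hp3
  exact ⟨disjoint_left.mpr hp1, fun z hz => ⟨hp2 z hz, hp3 z hz⟩⟩

theorem h20NormLE_of_norm_le (hDo : IsOpen D) {T : L2Sum D →L[ℂ] L2Sum D}
    {L : L2Sum D →L[ℂ] L2 D} (hTL : ∀ f, ((T f).fst, L f) ∈ testLaplacianGraph D) {ε : ℝ}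
    (hε : 0 ≤ ε) (hT : ‖T‖ ≤ ε / 2) (hL : ‖L‖ ≤ ε / 2) : H20NormLE T ε := by
  refine ⟨hε, fun f => ?_⟩
  obtain ⟨h, e⟩ := (minLaplacian_eq_iff hDo _ _).mpr (hTL f)
  refine ⟨h, ?_⟩
  rw [e]
  have h1 : ‖T f‖ ^ 2 = ‖(T f).fst‖ ^ 2 + ‖(T f).snd‖ ^ 2 := WithLp.prod_norm_sq_eq_of_L2 _
  have h2 : ‖T f‖ ^ 2 ≤ (ε / 2 * ‖f‖) ^ 2 :=
    pow_le_pow_left₀ (norm_nonneg _) (T.le_of_opNorm_le hT f) 2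
  have h3 : ‖L f‖ ^ 2 ≤ (ε / 2 * ‖f‖) ^ 2 :=
    pow_le_pow_left₀ (norm_nonneg _) (L.le_of_opNorm_le hL f) 2
  -- The two halves enter quadratically: `2 (ε / 2)² ≤ ε²`.
  nlinarith [sq_nonneg (ε * ‖f‖)]

section Projection

variable {c : ℂ} {r : ℝ}

theorem continuousOn_resolventOp (hs : Disjoint (sphere c r) (transmissionSpectrum m)) :
    ContinuousOn (resolventOp m) (sphere c r) := fun z hz =>
  (ContinuousAt.comp (g := fun q : LInf D × ℂ => resolventOp q.1 q.2) (f := fun z => (m, z))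
    (continuousAt_resolventOp (disjoint_left.mp hs hz)) (by fun_prop)).continuousWithinAt

theorem continuousOn_resolventLaplacian (hs : Disjoint (sphere c r) (transmissionSpectrum m)) :
    ContinuousOn (resolventLaplacian m) (sphere c r) := fun z hz =>
  (ContinuousAt.comp (g := fun q : LInf D × ℂ => resolventLaplacian q.1 q.2) (f := fun z => (m, z))
    (continuousAt_resolventLaplacian (disjoint_left.mp hs hz)) (by fun_prop)).continuousWithinAt

/-- The Laplacian of the first component of the spectral projection. -/
def projectionLaplacian (m : LInf D) (c : ℂ) (r : ℝ) : L2Sum D →L[ℂ] L2 D :=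
  (2 * Real.pi * Complex.I : ℂ)⁻¹ • ∮ z in C(c, r), -resolventLaplacian m z

/-- Membership in the small graph is tested by inner products against the weak graph, and these
continuous functionals pass through the contour integral. -/
theorem mem_testLaplacianGraph_projection (hDo : IsOpen D) (hr : 0 ≤ r)
    (hs : Disjoint (sphere c r) (transmissionSpectrum m)) (f : L2Sum D) :
    ((spectralProjection m c r f).fst, projectionLaplacian m c r f) ∈ testLaplacianGraph D := by
  refine (mem_testLaplacianGraph_iff _).mpr fun w hw => ?_
  let Λ₁ : (L2Sum D →L[ℂ] L2Sum D) →L[ℂ] ℂ :=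
    (innerSL ℂ w.2 ∘L fstOp D) ∘L ContinuousLinearMap.apply ℂ (L2Sum D) f
  let Λ₂ : (L2Sum D →L[ℂ] L2 D) →L[ℂ] ℂ :=
    innerSL ℂ w.1 ∘L ContinuousLinearMap.apply ℂ (L2 D) f
  change Λ₂ (projectionLaplacian m c r) = Λ₁ (spectralProjection m c r)
  have i1 : CircleIntegrable (fun z => -resolventOp m z) c r :=
    (continuousOn_resolventOp hs).neg.circleIntegrable hr
  have i2 : CircleIntegrable (fun z => -resolventLaplacian m z) c r :=
    (continuousOn_resolventLaplacian hs).neg.circleIntegrable hr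
  have e1 : Λ₁ (spectralProjection m c r) =
      (2 * Real.pi * Complex.I : ℂ)⁻¹ • ∮ z in C(c, r), Λ₁ (-resolventOp m z) := by
    rw [ContinuousLinearMap.circleIntegral_comp_comm Λ₁ i1, ← map_smul]
    rfl
  have e2 : Λ₂ (projectionLaplacian m c r) =
      (2 * Real.pi * Complex.I : ℂ)⁻¹ • ∮ z in C(c, r), Λ₂ (-resolventLaplacian m z) := by
    rw [ContinuousLinearMap.circleIntegral_comp_comm Λ₂ i2, ← map_smul]
    rfl
  rw [e1, e2]
  congr 1
  refine circleIntegral.integral_congr hr fun z hz => ?_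
  have h1 := mem_testLaplacianGraph_resolvent hDo (disjoint_left.mp hs hz) f
  have h2 := (mem_weakLaplacianGraph_iff w).mp hw _ h1
  rw [map_neg, map_neg]
  exact congrArg Neg.neg h2

theorem norm_circleIntegral_sub_le {Y : Type*} [NormedAddCommGroup Y] [NormedSpace ℂ Y]
    [CompleteSpace Y] {f g : ℂ → Y} (hr : 0 ≤ r) (hf : ContinuousOn f (sphere c r))
    (hg : ContinuousOn g (sphere c r)) {ε : ℝ} (h : ∀ z ∈ sphere c r, ‖f z - g z‖ ≤ ε) :
    ‖((2 * Real.pi * Complex.I : ℂ)⁻¹ • ∮ z in C(c, r), -f z) -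
      (2 * Real.pi * Complex.I : ℂ)⁻¹ • ∮ z in C(c, r), -g z‖ ≤ r * ε := by
  have hf' : CircleIntegrable (fun z => -f z) c r := hf.neg.circleIntegrable hr
  have hg' : CircleIntegrable (fun z => -g z) c r := hg.neg.circleIntegrable hr
  rw [← smul_sub, ← circleIntegral.integral_sub hf' hg']
  refine circleIntegral.norm_two_pi_i_inv_smul_integral_le_of_norm_le_const hr fun z hz => ?_
  rw [← norm_neg, neg_sub_neg, neg_sub]
  exact h z hz

end Projection

end Continuity

/-! ### The splitting along a circle. -/

section SpectralSplitting

variable {n : ℕ} {D : Set (EuclideanSpace ℝ (Fin n))} {m : LInf D} {z₀ : ℂ}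
  {R : L2Sum D →L[ℂ] L2Sum D}

theorem splitsAlong (hR : IsPencilInverse (transmissionOp m) (weightOp m) z₀ R)
    (hT : IsCompactOperator ((R ∘L weightOp m) * (R ∘L weightOp m) : L2Sum D →L[ℂ] L2Sum D))
    {c : ℂ} {r : ℝ} (hr : 0 ≤ r) (hs : Disjoint (sphere c r) (transmissionSpectrum m)) :
    SplitsAlong m c r := by
  obtain ⟨h1, h2, -⟩ := hR.pencilProjection_spec hT hr hs
  exact ⟨hs, hR.finite_pencilSpectrum_inter hT isBounded_ball,
    fun z _ => ⟨hR.mem_pencilSpectrum_iff hT z, hR.finiteDimensional_pencilGenEigenspace hT z⟩,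
    h1, h2⟩

end SpectralSplitting

end InteriorTransmission

end

/-! ### The main theorem. -/

open InteriorTransmission in
theorem theorem1 {n : ℕ} (hn : 0 < n) (D : Set (EuclideanSpace ℝ (Fin n)))
    (hDo : IsOpen D) (hDb : Bornology.IsBounded D)
    (m : LInf D) (mlow mup δ : ℝ) (hlow : 0 < mlow) (hle : mlow ≤ mup) (hδ : 0 < δ)
    -- condition near the boundary
    (hbdry : ∃ N : Set (EuclideanSpace ℝ (Fin n)), IsOpen N ∧ frontier D ⊆ N ∧
      ((∃ θ ∈ Ioo (-(Real.pi / 2)) (Real.pi / 2), ∀ᵐ x ∂(domainMeasure D),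
          x ∈ N → mlow < (Complex.exp (θ * Complex.I) * m x).re) ∨
        ((∀ᵐ x ∂(domainMeasure D), (m x).im = 0) ∧
          ∀ᵐ x ∂(domainMeasure D), x ∈ N → (m x).re ≤ -mlow)))
    (hbound : ∀ᵐ x ∂(domainMeasure D), ‖m x‖ < mup)
    (hre : ∀ᵐ x ∂(domainMeasure D), δ ≤ (1 + m x).re) :
    -- the spectrum is closed and discrete
    (∀ K : Set ℂ, IsCompact K → (transmissionSpectrum m ∩ K).Finite) ∧
    -- it consists of eigenvalues with finite-dimensional generalized eigenspaces
    (∀ z : ℂ, z ∈ transmissionSpectrum m ↔ eigenspace m z ≠ ⊥) ∧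
    (∀ z : ℂ, FiniteDimensional ℂ (genEigenspace m z)) ∧
    -- (generalized) eigenspaces of different eigenvalues are linearly independent
    iSupIndep (eigenspace m) ∧ iSupIndep (genEigenspace m) ∧
    -- continuity of the resolvent, uniformly on compact sets without spectrum
    (∀ K : Set ℂ, IsCompact K → Disjoint K (transmissionSpectrum m) →
      ∀ ε : ℝ, 0 < ε → ∃ η : ℝ, 0 < η ∧ ∀ p : LInf D, ‖p - m‖ < η →
        Disjoint K (transmissionSpectrum p) ∧
          ∀ z ∈ K, H20NormLE (resolventOp p z - resolventOp m z) ε) ∧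
    -- continuity of the eigenvalues and generalized eigenspaces
    (∀ (c : ℂ) (r : ℝ), 0 < r → Disjoint (sphere c r) (transmissionSpectrum m) →
      ∀ ε : ℝ, 0 < ε → ∃ η : ℝ, 0 < η ∧ ∀ p : LInf D, ‖p - m‖ < η →
        SplitsAlong p c r ∧
        H20NormLE (spectralProjection p c r - spectralProjection m c r) ε ∧
        ∑ᶠ z ∈ ball c r, algMult p z = ∑ᶠ z ∈ ball c r, algMult m z) := by
  obtain ⟨S⟩ := nonempty_fourierSystem hDo hDb
  obtain ⟨χ, hχ, ζ, c₀, C₀, hζ, hc₀, hC₀, hsymm, hadm, hco⟩ :=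
    exists_admissible_localization hDo hDb hlow hle hδ hbdry hbound hre
  obtain ⟨z₀, R, hR⟩ :=
    exists_isPencilInverse_transmissionOp hDo S m (S.interiorEstimate hχ) hsymm hadm
  have hT := isCompactOperator_sq hDo S hR hχ hζ hc₀ hC₀ hco
  have hind : iSupIndep (genEigenspace m) := hR.iSupIndep_pencilGenEigenspace
  have hη : ∀ {P : LInf D → Prop}, (∀ᶠ p in nhds m, P p) →
      ∃ η : ℝ, 0 < η ∧ ∀ p : LInf D, ‖p - m‖ < η → P p := fun h => by
    obtain ⟨η, h1, h2⟩ := Metric.eventually_nhds_iff.mp h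
    exact ⟨η, h1, fun p hp => h2 (by rwa [dist_eq_norm])⟩
  refine ⟨fun K hK => hR.finite_pencilSpectrum_inter hT hK.isBounded,
    fun z => hR.mem_pencilSpectrum_iff hT z, hR.finiteDimensional_pencilGenEigenspace hT,
    hind.mono fun z => pencilEigenspace_le_pencilGenEigenspace, hind, ?_, ?_⟩
  · intro K hK hd ε hε
    refine hη ((eventually_resolventOp_near hK hd (half_pos hε)).mono fun p hp => ⟨hp.1, ?_⟩)
    intro z hz
    refine h20NormLE_of_norm_le hDo (L := resolventLaplacian p z - resolventLaplacian m z)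
      (fun f => ?_) hε.le (hp.2 z hz).1.le (hp.2 z hz).2.le
    exact (testLaplacianGraph D).sub_mem
      (mem_testLaplacianGraph_resolvent hDo (disjoint_left.mp hp.1 hz) f)
      (mem_testLaplacianGraph_resolvent hDo (disjoint_left.mp hd hz) f)
  · intro c r hr hs ε hε
    -- A resolvent error `ε'` on the circle gives a projection error `r ε'`: at most `ε / 2` for the
    -- norm estimate, and at most `1 / 2 < 1` for equality of ranks.
    let ε' : ℝ := min (ε / 2) (1 / 2) / r
    have hε' : 0 < ε' := by positivity
    have hrε : r * ε' = min (ε / 2) (1 / 2) := mul_div_cancel₀ _ hr.ne'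
    have hnear := eventually_resolventOp_near (isCompact_sphere c r) hs hε'
    have hclose : ∀ᶠ p in nhds m, ‖p - m‖ < c₀ / 2 := by
      refine Metric.eventually_nhds_iff.mpr ⟨c₀ / 2, half_pos hc₀, fun p hp => ?_⟩
      rwa [← dist_eq_norm]
    refine hη ((hnear.and hclose).mono fun p hp => ?_)
    obtain ⟨⟨hsp, hp1⟩, hp2⟩ := hp
    -- Any point of the circle serves as base point for `p`, so no a priori estimate for `p` is
    -- needed.
    obtain ⟨w, hw⟩ := NormedSpace.sphere_nonempty (x := c).mpr hr.le
    have hRp := isPencilInverse_pencilInverse (disjoint_left.mp hsp hw)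
    have hcop : IsLocallyCoercive hχ.mulOp (mulBy p) ζ (c₀ / 2) C₀ :=
      hco.perturb hζ ((norm_mulBy_sub_le p m).trans hp2.le)
    have hTp := isCompactOperator_sq hDo S hRp hχ hζ (half_pos hc₀) hC₀ hcop
    have hP : ‖spectralProjection p c r - spectralProjection m c r‖ ≤ r * ε' :=
      norm_circleIntegral_sub_le hr.le (continuousOn_resolventOp hsp)
        (continuousOn_resolventOp hs) fun z hz => (hp1 z hz).1.le
    have hL : ‖projectionLaplacian p c r - projectionLaplacian m c r‖ ≤ r * ε' :=
      norm_circleIntegral_sub_le hr.le (continuousOn_resolventLaplacian hsp)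
        (continuousOn_resolventLaplacian hs) fun z hz => (hp1 z hz).2.le
    rw [hrε] at hP hL
    have hP1 : ‖spectralProjection p c r - spectralProjection m c r‖ < 1 :=
      (hP.trans (min_le_right _ _)).trans_lt (by norm_num)
    refine ⟨splitsAlong hRp hTp hr.le hsp, h20NormLE_of_norm_le hDo
      (L := projectionLaplacian p c r - projectionLaplacian m c r) (fun f => ?_) hε.le
      (hP.trans (min_le_left _ _)) (hL.trans (min_le_left _ _)), ?_⟩
    · exact (testLaplacianGraph D).sub_mem (mem_testLaplacianGraph_projection hDo hr.le hsp f)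
        (mem_testLaplacianGraph_projection hDo hr.le hs f)
    · obtain ⟨hp3, -, hp4⟩ := hRp.pencilProjection_spec hTp hr.le hsp
      obtain ⟨hm3, -, hm4⟩ := hR.pencilProjection_spec hT hr.le hs
      have e1 := hRp.finsum_finrank_pencilGenEigenspace hTp hr.le hsp
      have e2 := hR.finsum_finrank_pencilGenEigenspace hT hr.le hs
      refine e1.trans (Eq.trans (le_antisymm ?_ ?_) e2.symm)
      · exact finrank_range_le_of_norm_sub_lt_one hp3 hm4 hP1
      · exact finrank_range_le_of_norm_sub_lt_one hm3 hp4 (by rw [norm_sub_rev]; exact hP1)
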